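/- A knot is a smoothly embedded oriented circle $K\subset S^3$; its reverse $K^r$ is the same circle in the same oriented $S^3$ with the opposite orientation. The three-genus $g_3(K)$ is the minimal genus of a Seifert surface of $K$, i.e. of a compact connected oriented surface smoothly embedded in $S^3$ with oriented boundary $K$. A cobordism from $K$ to $J$ is a compact connected oriented surface properly embedded in $S^3\times[0,1]$ whose oriented boundary is, up to a global sign, $J\times\{1\}\,-\,K\times\{0\}$; the cobordism distance $d(K,J)$ is the minimal genus of such a surface. Theorem. If $K$ is nontrivial (not smoothly isotopic to a great circle of $S^3$), then $$d(K,K^r) < 2g_3(K),\qquad\text{i.e.}\qquad d(K,K^r)\le 2g_3(K)-1 .$$ This holds both for the smooth cobordism distance (smoothly and neatly embedded surfaces) and for the topological one (properly embedded locally flat surfaces). -/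

import Mathlib

open scoped Manifold ContDiff Topology

noncomputable section

namespace KnotCobordism

/-- Euclidean four-space. -/
abbrev E4 : Type := EuclideanSpace ℝ (Fin 4)

/-- The three-sphere, as the unit sphere of Euclidean four-space. -/
abbrev S3 : Type := Metric.sphere (0 : E4) 1

/-! ### Knots -/

/-- A smooth oriented knot: a smooth embedding `S¹ → S³`.  The orientation is the one in which
the counterclockwise circle runs through the image.  All notions below are invariant under
orientation preserving reparametrization. -/
structure Knot where
  toFun : Circle → S3
  smooth : ContMDiff (𝓡 1) (𝓡 3) ∞ toFun
  immersion : ∀ u, Function.Injective (mfderiv (𝓡 1) (𝓡 3) toFun u)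
  injective : Function.Injective toFun

instance : CoeFun Knot (fun _ => Circle → S3) := ⟨Knot.toFun⟩

/-- The reverse `K^r`: the same curve in the same (oriented) `S³`, traversed in the opposite
direction (`u⁻¹` is the complex conjugate of `u`). -/
def Knot.reverse (K : Knot) : Knot where
  toFun := fun u => K u⁻¹
  smooth := K.smooth.comp (contMDiff_inv (𝓡 1) ∞)
  immersion := by
    intro u
    have hinv : ∀ v : Circle, MDifferentiableAt (𝓡 1) (𝓡 1) (fun w : Circle => w⁻¹) v := fun v =>
      (contMDiff_inv (G := Circle) (𝓡 1) ∞).mdifferentiable (by simp) v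
    have hK : MDifferentiableAt (𝓡 1) (𝓡 3) K.toFun u⁻¹ :=
      K.smooth.mdifferentiable (by simp) u⁻¹
    have h1 := mfderiv_comp u hK (hinv u)
    have h2 : (mfderiv (𝓡 1) (𝓡 1) (fun w : Circle => w⁻¹) (u⁻¹)).comp
        (mfderiv (𝓡 1) (𝓡 1) (fun w : Circle => w⁻¹) u) = ContinuousLinearMap.id ℝ _ := by
      rw [← mfderiv_comp u (hinv u⁻¹) (hinv u)]
      have : ((fun w : Circle => w⁻¹) ∘ fun w : Circle => w⁻¹) = id := by
        funext w; simp
      rw [this, mfderiv_id]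
    have h3 : Function.Injective (mfderiv (𝓡 1) (𝓡 1) (fun w : Circle => w⁻¹) u) := by
      intro a b hab
      have := congrArg (mfderiv (𝓡 1) (𝓡 1) (fun w : Circle => w⁻¹) (u⁻¹)) hab
      have e := fun x => DFunLike.congr_fun h2 x
      exact (e a).symm.trans (this.trans (e b))
    have h4 : mfderiv (𝓡 1) (𝓡 3) (fun u => K u⁻¹) u = _ := h1
    rw [h4]
    exact (K.immersion u⁻¹).comp h3
  injective := fun a b h => inv_injective (K.injective h)

/-- `K` is trivial: a smooth isotopy, that is, a smooth one-parameter family of knots, joins it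
to the great circle `u ↦ (Re u, Im u, 0, 0)`. -/
def Knot.IsTrivial (K : Knot) : Prop :=
  ∃ H : ℝ → Knot,
    ContMDiff (𝓘(ℝ, ℝ).prod (𝓡 1)) (𝓡 3) ∞ (fun p : ℝ × Circle => H p.1 p.2) ∧
    H 0 = K ∧
    ∀ u : Circle, (H 1 u : E4) = !₂[(u : ℂ).re, (u : ℂ).im, 0, 0]

/-! ### Spheres with handles and holes

A compact connected oriented surface of genus `g` with `m + 1` boundary circles is presented as
a sphere with `m + 1` holes and `g` handles: remove from the closed unit disc `2 g + m` disjoint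
round open discs, and glue `2 g` of the resulting boundary circles in pairs, by holomorphic
(hence orientation preserving) maps that are defined near the circles and exchange their sides.
-/

/-- The Möbius transformation with the given coefficient matrix. -/
def mobius (A : Matrix (Fin 2) (Fin 2) ℂ) (z : ℂ) : ℂ :=
  (A 0 0 * z + A 0 1) / (A 1 0 * z + A 1 1)

/-- A closed unit disc with `2 g + m` round holes, together with Möbius transformations that glue
the holes `inl (j, false)` and `inl (j, true)` for `j < g`. -/
structure HandleDisc (g m : ℕ) where
  center : (Fin g × Bool) ⊕ Fin m → ℂ
  radius : (Fin g × Bool) ⊕ Fin m → ℝ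
  radius_pos : ∀ i, 0 < radius i
  inside : ∀ i, ‖center i‖ + radius i < 1
  disjoint : ∀ i j, i ≠ j → radius i + radius j < dist (center i) (center j)
  glue : Fin g → Matrix (Fin 2) (Fin 2) ℂ
  glue_det : ∀ j, (glue j).det ≠ 0
  /-- The first circle goes to the second one. -/
  glue_circle : ∀ j z, dist z (center (.inl (j, false))) = radius (.inl (j, false)) →
    dist (mobius (glue j) z) (center (.inl (j, true))) = radius (.inl (j, true))
  /-- The outside of the first circle goes to the inside of the second one. -/
  glue_side : ∀ j z, radius (.inl (j, false)) < dist z (center (.inl (j, false))) →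
    dist (mobius (glue j) z) (center (.inl (j, true))) < radius (.inl (j, true))

namespace HandleDisc

variable {g m : ℕ} (D : HandleDisc g m)

/-- The compact planar domain: the closed unit disc minus the open holes. -/
def domain : Set ℂ :=
  {z | ‖z‖ ≤ 1 ∧ ∀ i, D.radius i ≤ dist z (D.center i)}

/-- The seam of the `j`-th handle: the boundary circle of its first hole. -/
def seam (j : Fin g) : Set ℂ :=
  Metric.sphere (D.center (.inl (j, false))) (D.radius (.inl (j, false)))

/-- `z` and `w` are the same point of the glued surface. -/
def Glued (z w : ℂ) : Prop :=
  z = w ∨ ∃ j, (z ∈ D.seam j ∧ w = mobius (D.glue j) z) ∨ (w ∈ D.seam j ∧ z = mobius (D.glue j) w)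

/-- `φ` induces a topological embedding of the glued surface. -/
structure IsTopEmbedding {E : Type*} [TopologicalSpace E] (φ : ℂ → E) : Prop where
  continuousOn : ContinuousOn φ D.domain
  eq_iff : ∀ z ∈ D.domain, ∀ w ∈ D.domain, φ z = φ w ↔ D.Glued z w

/-- `φ` induces a smooth embedding of the glued surface.  By `glue_near` it is compatible with
the gluing in a neighbourhood of every seam, so that the map on the glued surface is smooth and
immersive across the seams as well. -/
structure IsSmoothEmbedding {E : Type*} [NormedAddCommGroup E] [NormedSpace ℝ E]
    (φ : ℂ → E) : Prop where
  smooth : ∀ z ∈ D.domain, ContDiffAt ℝ ∞ φ z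
  immersion : ∀ z ∈ D.domain, Function.Injective (fderiv ℝ φ z)
  glue_near : ∀ j, ∀ᶠ z in 𝓝ˢ (D.seam j), φ (mobius (D.glue j) z) = φ z
  eq_iff : ∀ z ∈ D.domain, ∀ w ∈ D.domain, φ z = φ w ↔ D.Glued z w

end HandleDisc

/-! ### Seifert surfaces and the three-genus -/

/-- `K` bounds a Seifert surface of genus `g`: a smoothly embedded compact connected oriented
surface in `S³` of genus `g` with oriented boundary `K`. -/
def Knot.HasSeifertSurface (K : Knot) (g : ℕ) : Prop :=
  ∃ (D : HandleDisc g 0) (φ : ℂ → E4),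
    D.IsSmoothEmbedding φ ∧
    (∀ z ∈ D.domain, φ z ∈ Metric.sphere (0 : E4) 1) ∧
    ∀ u : Circle, φ u = K u

/-- The three-genus `g₃(K)`: the minimal genus of a Seifert surface (`⊤` if there were none). -/
def Knot.threeGenus (K : Knot) : ℕ∞ := ⨅ (g : ℕ) (_ : K.HasSeifertSurface g), (g : ℕ∞)

/-! ### Cobordisms -/

/-- `φ` maps the surface properly to `S³ × [0,1]`, with oriented boundary `K₀ × 0 - K₁ × 1`:
the outer circle parametrizes `K₀ × 0`, the boundary circle of the unglued hole (which runs
against the boundary orientation) parametrizes `K₁ × 1`, and all else lies in `S³ × (0,1)`. -/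
structure IsProperBetween {g : ℕ} (D : HandleDisc g 1) (φ : ℂ → E4 × ℝ) (K₀ K₁ : Knot) :
    Prop where
  mem_sphere : ∀ z ∈ D.domain, (φ z).1 ∈ Metric.sphere (0 : E4) 1
  bottom : ∀ u : Circle, φ u = ((K₀ u : E4), 0)
  top : ∀ u : Circle, φ (D.center (.inr 0) + D.radius (.inr 0) * u) = ((K₁ u : E4), 1)
  interior : ∀ z ∈ D.domain, ‖z‖ < 1 → D.radius (.inr 0) < dist z (D.center (.inr 0)) →
    (φ z).2 ∈ Set.Ioo (0 : ℝ) 1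

/-- There is a smooth cobordism of genus `g` from `K₀` to `K₁`: a compact connected oriented
surface, smoothly and neatly embedded in `S³ × [0,1]`.  Neatness at the ends is transversality
to `S³ × {0,1}`, expressed by the height function. -/
def HasSmoothCobordism (K₀ K₁ : Knot) (g : ℕ) : Prop :=
  ∃ (D : HandleDisc g 1) (φ : ℂ → E4 × ℝ),
    D.IsSmoothEmbedding φ ∧ IsProperBetween D φ K₀ K₁ ∧
    ∀ z ∈ D.domain, (φ z).2 = 0 ∨ (φ z).2 = 1 → fderiv ℝ (fun w => (φ w).2) z ≠ 0

/-- `F ⊆ S³ × [0,1]` is a properly embedded locally flat surface: near each of its points there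
is a chart of `S³ × [0,1]` in the half-space `{x₀ ≥ 0}` of `ℝ⁴` that carries `F` to the
half-plane `{x₂ = x₃ = 0}`. -/
def IsLocallyFlat (F : Set (S3 × unitInterval)) : Prop :=
  ∀ p ∈ F, ∃ e : OpenPartialHomeomorph (S3 × unitInterval) (EuclideanHalfSpace 4),
    p ∈ e.source ∧ ∀ q ∈ e.source, q ∈ F ↔ (e q).val 2 = 0 ∧ (e q).val 3 = 0

/-- There is a locally flat cobordism of genus `g` from `K₀` to `K₁`. -/
def HasLocallyFlatCobordism (K₀ K₁ : Knot) (g : ℕ) : Prop :=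
  ∃ (D : HandleDisc g 1) (φ : ℂ → E4 × ℝ),
    D.IsTopEmbedding φ ∧ IsProperBetween D φ K₀ K₁ ∧
    IsLocallyFlat {p | ((p.1 : E4), (p.2 : ℝ)) ∈ φ '' D.domain}

/-- The cobordism distance in the smooth category: the minimal genus of a smooth cobordism. -/
def smoothDist (K₀ K₁ : Knot) : ℕ∞ := ⨅ (g : ℕ) (_ : HasSmoothCobordism K₀ K₁ g), (g : ℕ∞)

/-- The cobordism distance in the topological category: the minimal genus of a locally flat
cobordism. -/
def topDist (K₀ K₁ : Knot) : ℕ∞ := ⨅ (g : ℕ) (_ : HasLocallyFlatCobordism K₀ K₁ g), (g : ℕ∞)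

end KnotCobordism

end

/-! Let F be a Seifert surface of minimal genus g. If g = 0 the knot bounds a disc and is trivial,
so g = k + 1 and F has a handle. Cut two copies of F along the seam of that handle, a non-separating
curve, and glue crosswise: each side of the cut in one copy is glued to the opposite side in the
other copy. The result is connected with two boundary circles and Euler characteristic 2(1 - 2g),
hence it has genus 2g - 1, one less than two copies of F joined by a tube.

To embed it in S³ × [0,1], place the first copy over F at height h and the second at height 1 - h,
where h vanishes on K and equals 1/4 along one side of the cut and 3/4 along the other. Since 1 -
1/4 = 3/4, the heights match under the crosswise gluing. Two points of the two copies over the same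
point off the cut can only collide where h = 1/2, inside an annulus beside the cut, and there the
first copy is pushed off along the normal of F in S³. Both copies carry the orientation of F, so
both ends are K with its boundary orientation; read as a cobordism, the surface runs from K to its
reverse.

In the planar model, `HandleDisc.double` puts the second copy into the first hole of the handle by
the inverse of the gluing map; as this is a Möbius map, all holes stay round. `exists_push` supplies
the normal push, `nonempty_height` the function h, and `nonempty_sheets` both sheets, with a collar
reparametrization that makes the upper end exactly u ↦ K(u⁻¹). `Sheets.isSmoothEmbedding_map` and
`Sheets.isProperBetween_map` assemble the smooth cobordism. The same surface is the topological
cobordism: `exists_flat_chart` builds flat charts by the inverse function theorem, and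
`isLocallyFlat_imageSet` applies them at every point.

For g = 0, `Knot.isTrivial_of_hasSeifertSurface_zero` shrinks the disc towards its center, projects
centrally to the affine hyperplane tangent to the sphere at that point, straightens the small curve
to an ellipse, slides its plane to the origin and moves the resulting great circle to the standard
one. -/

open scoped Manifold ContDiff Topology

noncomputable section

namespace KnotCobordism

/-! ### Immersions -/

section Immersions

variable {E F : Type*} [NormedAddCommGroup E] [NormedSpace ℝ E] [FiniteDimensional ℝ E]
  [NormedAddCommGroup F] [NormedSpace ℝ F]

/-- A map with injective strict derivative is locally injective. -/
theorem exists_injOn_of_hasStrictFDerivAt {f : E → F} {f' : E →L[ℝ] F} {x : E}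
    (hf : HasStrictFDerivAt f f' x) (hinj : Function.Injective f') :
    ∃ U ∈ 𝓝 x, Set.InjOn f U := by
  obtain ⟨K, hK, hanti⟩ := (f' : E →ₗ[ℝ] F).injective_iff_antilipschitz.mp hinj
  -- The derivative expands by at least K⁻¹; an error of half that size cannot cancel it.
  obtain ⟨U, hU, happ⟩ := hf.approximates_deriv_on_nhds (c := K⁻¹ / 2) (Or.inr (by positivity))
  refine ⟨U, hU, fun y hy z hz hyz => ?_⟩
  have h1 := happ y hy z hz
  rw [hyz, sub_self, zero_sub, norm_neg] at h1
  have h2 := hanti.le_mul_dist y z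
  simp only [ContinuousLinearMap.coe_coe, dist_eq_norm, ← map_sub] at h2
  have hK' : (0 : ℝ) < K := hK
  have h3 : ‖y - z‖ ≤ K * ((K : ℝ)⁻¹ / 2 * ‖y - z‖) :=
    h2.trans (mul_le_mul_of_nonneg_left (by simpa using h1) hK'.le)
  have h4 : (K : ℝ) * ((K : ℝ)⁻¹ / 2 * ‖y - z‖) = ‖y - z‖ / 2 := by field_simp
  rw [h4] at h3
  have : ‖y - z‖ = 0 := by linarith [norm_nonneg (y - z)]
  exact sub_eq_zero.mp (norm_eq_zero.mp this)

/-- Injective linear maps on a finite-dimensional space form an open set, and the derivative is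
continuous. -/
theorem eventually_injective_fderiv {f : E → F} {x : E} (hf : ContDiffAt ℝ ∞ f x)
    (hinj : Function.Injective (fderiv ℝ f x)) :
    ∀ᶠ y in 𝓝 x, Function.Injective (fderiv ℝ f y) := by
  have hc : ContinuousAt (fderiv ℝ f) x :=
    (hf.fderiv_right (m := 0) (by norm_num)).continuousAt
  exact hc.eventually (ContinuousLinearMap.isOpen_injective.mem_nhds hinj)

end Immersions

/-! ### The triple cross product -/

/-- The vector of `3 × 3` minors of `a`, `b`, `c`. -/
def cross (a b c : E4) : E4 :=
  WithLp.toLp 2 fun i => Matrix.det (Matrix.of ![Pi.single i 1, a.ofLp, b.ofLp, c.ofLp])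

/-- Laplace expansion along the first row. All orthogonality relations follow from it, as
determinants with a repeated row vanish. -/
theorem inner_cross (a b c w : E4) :
    inner ℝ (cross a b c) w = Matrix.det (Matrix.of ![w.ofLp, a.ofLp, b.ofLp, c.ofLp]) := by
  simp [cross, PiLp.inner_apply, Fin.sum_univ_succ, Matrix.det_succ_row_zero, Fin.succAbove]
  ring

theorem inner_cross_left (a b c : E4) : inner ℝ (cross a b c) a = 0 := by
  rw [inner_cross]
  exact Matrix.det_zero_of_row_eq (i := 0) (j := 1) (by decide) rfl

theorem inner_cross_mid (a b c : E4) : inner ℝ (cross a b c) b = 0 := by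
  rw [inner_cross]
  exact Matrix.det_zero_of_row_eq (i := 0) (j := 2) (by decide) rfl

theorem inner_cross_right (a b c : E4) : inner ℝ (cross a b c) c = 0 := by
  rw [inner_cross]
  exact Matrix.det_zero_of_row_eq (i := 0) (j := 3) (by decide) rfl

/-- A fourth vector completing the three to a basis has a nonzero determinant with them, which is
its inner product with the cross product. -/
theorem cross_ne_zero {a b c : E4} (h : LinearIndependent ℝ ![a, b, c]) : cross a b c ≠ 0 := by
  intro h0
  have hspan : Submodule.span ℝ (Set.range ![a, b, c]) ≠ ⊤ := by
    intro htop
    have := finrank_range_le_card (R := ℝ) ![a, b, c]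
    rw [Set.finrank, htop, finrank_top] at this
    simp at this
  obtain ⟨w, hw⟩ : ∃ w, w ∉ Submodule.span ℝ (Set.range ![a, b, c]) := by
    by_contra! hcon
    exact hspan (Submodule.eq_top_iff'.mpr hcon)
  have hli : LinearIndependent ℝ (Fin.cons w ![a, b, c] : Fin 4 → E4) :=
    linearIndependent_finCons.mpr ⟨h, hw⟩
  have hli' := hli.map' (WithLp.linearEquiv 2 ℝ (Fin 4 → ℝ)).toLinearMap (LinearEquiv.ker _)
  have hrows : (⇑(WithLp.linearEquiv 2 ℝ (Fin 4 → ℝ)).toLinearMap ∘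
      (Fin.cons w ![a, b, c] : Fin 4 → E4)) =
      (Matrix.of ![w.ofLp, a.ofLp, b.ofLp, c.ofLp]).row := by
    funext i
    fin_cases i <;> rfl
  rw [hrows, Matrix.linearIndependent_rows_iff_isUnit, Matrix.isUnit_iff_isUnit_det] at hli'
  rw [← inner_cross, h0, inner_zero_left] at hli'
  simp at hli'

theorem contDiff_cross : ContDiff ℝ ∞ fun p : E4 × E4 × E4 => cross p.1 p.2.1 p.2.2 := by
  rw [contDiff_piLp]
  intro i
  simp only [cross, Matrix.det_apply]
  refine ContDiff.sum fun σ _ => ContDiff.const_smul _ (contDiff_prod fun j _ => ?_)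
  generalize σ j = l
  fin_cases l <;> simp <;> fun_prop

attribute [irreducible] cross

/-! ### The planar domain -/

namespace HandleDisc

variable {g m : ℕ} (D : HandleDisc g m)

theorem isClosed_domain : IsClosed D.domain := by
  have : D.domain = {z | ‖z‖ ≤ 1} ∩ ⋂ i, {z | D.radius i ≤ dist z (D.center i)} := by
    ext z; simp [domain]
  rw [this]
  exact (isClosed_le (by fun_prop) (by fun_prop)).inter
    (isClosed_iInter fun i => isClosed_le (by fun_prop) (by fun_prop))

theorem isCompact_domain : IsCompact D.domain :=
  (isCompact_closedBall (0 : ℂ) 1).of_isClosed_subset D.isClosed_domain fun z hz => by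
    simpa using hz.1

/-- The points of the domain that lie on none of its boundary circles. -/
def core : Set ℂ := {z | ‖z‖ < 1 ∧ ∀ i, D.radius i < dist z (D.center i)}

theorem isOpen_core : IsOpen D.core := by
  have : D.core = {z | ‖z‖ < 1} ∩ ⋂ i, {z | D.radius i < dist z (D.center i)} := by
    ext z; simp [core]
  rw [this]
  exact (isOpen_lt (by fun_prop) (by fun_prop)).inter
    (isOpen_iInter_of_finite fun i => isOpen_lt (by fun_prop) (by fun_prop))

theorem core_subset_domain : D.core ⊆ D.domain := fun _ hz => ⟨hz.1.le, fun i => (hz.2 i).le⟩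

theorem domain_mem_nhds {z : ℂ} (hz : z ∈ D.core) : D.domain ∈ 𝓝 z :=
  Filter.mem_of_superset (D.isOpen_core.mem_nhds hz) D.core_subset_domain

theorem norm_lt_one_of_mem_closedBall {i} {z : ℂ} (hz : dist z (D.center i) ≤ D.radius i) :
    ‖z‖ < 1 := by
  have h1 : ‖z‖ ≤ dist z (D.center i) + ‖D.center i‖ := by
    rw [dist_eq_norm]; simpa using norm_add_le (z - D.center i) (D.center i)
  linarith [D.inside i]

theorem radius_lt_dist_of_mem_closedBall {i j} (hij : i ≠ j) {z : ℂ}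
    (hz : dist z (D.center i) ≤ D.radius i) : D.radius j < dist z (D.center j) := by
  have h1 := dist_triangle_left (D.center i) (D.center j) z
  linarith [D.disjoint i j hij]

/-- Near a point of the unit circle the domain is the unit disc. -/
theorem eventually_mem_domain_iff_norm {z : ℂ} (hz : ‖z‖ = 1) :
    ∀ᶠ w in 𝓝 z, w ∈ D.domain ↔ ‖w‖ ≤ 1 := by
  have h : ∀ᶠ w in 𝓝 z, ∀ i, D.radius i < dist w (D.center i) := by
    rw [Filter.eventually_all]
    intro i
    have hlt : D.radius i < dist z (D.center i) := by
      by_contra! hcon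
      exact absurd hz (D.norm_lt_one_of_mem_closedBall hcon).ne
    exact (isOpen_lt continuous_const (by fun_prop)).mem_nhds hlt
  filter_upwards [h] with w hw
  exact ⟨fun h => h.1, fun h => ⟨h, fun i => (hw i).le⟩⟩

/-- Near a point of the boundary circle of a hole, the domain is the outside of that hole. -/
theorem eventually_mem_domain_iff_dist {i} {z : ℂ} (hz : dist z (D.center i) = D.radius i) :
    ∀ᶠ w in 𝓝 z, w ∈ D.domain ↔ D.radius i ≤ dist w (D.center i) := by
  have h : ∀ᶠ w in 𝓝 z, ∀ j, i ≠ j → D.radius j < dist w (D.center j) := by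
    rw [Filter.eventually_all]
    intro j
    by_cases hij : i = j
    · simp [hij]
    · have := continuousAt_const.eventually_lt (f := fun _ => D.radius j)
        (continuous_id.dist continuous_const).continuousAt
        (D.radius_lt_dist_of_mem_closedBall hij hz.le)
      filter_upwards [this] with w hw _ using hw
  have h' : ∀ᶠ w in 𝓝 z, ‖w‖ < 1 := (isOpen_lt (by fun_prop) continuous_const).mem_nhds
    (D.norm_lt_one_of_mem_closedBall hz.le)
  filter_upwards [h, h'] with w hw hw'
  refine ⟨fun h => h.2 i, fun h => ⟨hw'.le, fun j => ?_⟩⟩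
  by_cases hij : i = j
  · exact hij ▸ h
  · exact (hw j hij).le

theorem mem_core_or {z : ℂ} (hz : z ∈ D.domain) :
    z ∈ D.core ∨ ‖z‖ = 1 ∨ ∃ i, dist z (D.center i) = D.radius i := by
  by_cases h1 : ‖z‖ = 1
  · exact Or.inr (Or.inl h1)
  by_cases h2 : ∃ i, dist z (D.center i) = D.radius i
  · exact Or.inr (Or.inr h2)
  push Not at h2
  exact Or.inl ⟨lt_of_le_of_ne hz.1 h1, fun i => lt_of_le_of_ne (hz.2 i) (h2 i).symm⟩

theorem uniqueDiffWithinAt_closedBall {c z : ℂ} {r : ℝ} (hr : 0 < r) (hz : dist z c ≤ r) :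
    UniqueDiffWithinAt ℝ (Metric.closedBall c r) z := by
  refine uniqueDiffWithinAt_convex (convex_closedBall c r) ?_ (subset_closure hz)
  rw [interior_closedBall c hr.ne']
  exact ⟨c, by simpa using hr⟩

/-- The domain contains, near each of its points, part of a round disc having that point in its
closure. This lets identities that hold only on the domain be differentiated at its boundary. -/
theorem uniqueDiffWithinAt_domain {z : ℂ} (hz : z ∈ D.domain) :
    UniqueDiffWithinAt ℝ D.domain z := by
  rcases D.mem_core_or hz with h | h | ⟨i, h⟩
  · exact uniqueDiffWithinAt_of_mem_nhds (D.domain_mem_nhds h)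
  · have h1 := uniqueDiffWithinAt_closedBall (c := 0) (z := z) zero_lt_one (by simp [h])
    refine (h1.inter (D.eventually_mem_domain_iff_norm h)).mono ?_
    rintro w ⟨hw, hw'⟩
    exact hw'.mpr (by simpa using hw)
  · set c := D.center i
    -- This disc is the reflection of the hole in the boundary point z; it touches the hole from
    -- outside.
    have h1 := uniqueDiffWithinAt_closedBall (c := z + (z - c)) (z := z) (D.radius_pos i)
      (by rw [dist_eq_norm, ← h, dist_eq_norm, ← norm_neg]; simp)
    refine (h1.inter (D.eventually_mem_domain_iff_dist h)).mono ?_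
    rintro w ⟨hw, hw'⟩
    refine hw'.mpr ?_
    have h2 : dist (z + (z - c)) c = 2 * D.radius i := by
      rw [dist_eq_norm, ← h, dist_eq_norm]
      have : z + (z - c) - c = (2 : ℝ) • (z - c) := by simp [two_mul]; ring
      rw [this, norm_smul]; norm_num
    have h3 := dist_triangle_left (z + (z - c)) c w
    have h4 : dist w (z + (z - c)) ≤ D.radius i := hw
    linarith

/-- A map to the unit sphere is orthogonal to its derivative. -/
theorem inner_fderiv_eq_zero {ψ : ℂ → E4} {z : ℂ} (hz : z ∈ D.domain)
    (hψ : DifferentiableAt ℝ ψ z) (hs : ∀ w ∈ D.domain, ψ w ∈ Metric.sphere (0 : E4) 1) (ζ : ℂ) :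
    inner ℝ (ψ z) (fderiv ℝ ψ z ζ) = 0 := by
  have h1 := (hψ.hasFDerivAt.inner ℝ hψ.hasFDerivAt).hasFDerivWithinAt (s := D.domain)
  have h2 : HasFDerivWithinAt (fun w => inner ℝ (ψ w) (ψ w)) (0 : ℂ →L[ℝ] ℝ) D.domain z := by
    refine (hasFDerivWithinAt_const (1 : ℝ) z D.domain).congr (fun w hw => ?_) ?_
    · have := hs w hw
      simp at this; simp [this]
    · have := hs z hz
      simp at this; simp [this]
  have h3 := (D.uniqueDiffWithinAt_domain hz).eq h1 h2
  have h4 := DFunLike.congr_fun h3 ζ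
  simp [fderivInnerCLM_apply] at h4
  rw [real_inner_comm] at h4
  linarith [real_inner_comm (ψ z) (fderiv ℝ ψ z ζ)]

end HandleDisc

/-- The normal vector of an immersed surface in the sphere. -/
theorem cross_fderiv_ne_zero {p : E4} {L : ℂ →L[ℝ] E4} (hp : p ≠ 0) (hL : Function.Injective L)
    (h : ∀ ζ, inner ℝ p (L ζ) = 0) : cross p (L 1) (L Complex.I) ≠ 0 := by
  apply cross_ne_zero
  rw [Fintype.linearIndependent_iff]
  intro c hc
  simp only [Fin.sum_univ_three, Matrix.cons_val] at hc
  have h1 : c 1 • L 1 + c 2 • L Complex.I = L (c 1 • 1 + c 2 • Complex.I) := by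
    rw [map_add, map_smul, map_smul]
  rw [add_assoc, h1] at hc
  have h2 := congrArg (inner ℝ p) hc
  rw [inner_add_right, h, inner_smul_right, inner_zero_right, add_zero,
    real_inner_self_eq_norm_sq] at h2
  have h3 : c 0 = 0 := by
    rcases mul_eq_zero.mp h2 with h | h
    · exact h
    · exact absurd (norm_eq_zero.mp (pow_eq_zero_iff (two_ne_zero) |>.mp h)) hp
  rw [h3, zero_smul, zero_add] at hc
  have h4 := hL (hc.trans (map_zero L).symm)
  have h5 := congrArg Complex.re h4
  have h6 := congrArg Complex.im h4
  simp at h5 h6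
  intro i
  fin_cases i <;> assumption

theorem inner_cross_fderiv (p : E4) (L : ℂ →L[ℝ] E4) (ζ : ℂ) :
    inner ℝ (cross p (L 1) (L Complex.I)) (L ζ) = 0 := by
  have : ζ = ζ.re • (1 : ℂ) + ζ.im • Complex.I := by
    simp [Complex.re_add_im]
  rw [this, map_add, map_smul, map_smul, inner_add_right, inner_smul_right, inner_smul_right,
    inner_cross_mid, inner_cross_right]
  simp

end KnotCobordism

end

open scoped Manifold ContDiff Topology ComplexConjugate

noncomputable section

namespace KnotCobordism

/-! ### Möbius transformations -/

theorem mobius_mul (A B : Matrix (Fin 2) (Fin 2) ℂ) {z : ℂ} (hz : B 1 0 * z + B 1 1 ≠ 0) :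
    mobius (A * B) z = mobius A (mobius B z) := by
  simp only [mobius, Matrix.mul_apply, Fin.sum_univ_two]
  set d := B 1 0 * z + B 1 1
  have h1 : ((A 0 0 * B 0 0 + A 0 1 * B 1 0) * z + (A 0 0 * B 0 1 + A 0 1 * B 1 1)) =
      d * (A 0 0 * ((B 0 0 * z + B 0 1) / d) + A 0 1) := by
    rw [mul_add, mul_left_comm, mul_div_cancel₀ _ hz]; simp only [d]; ring
  have h2 : ((A 1 0 * B 0 0 + A 1 1 * B 1 0) * z + (A 1 0 * B 0 1 + A 1 1 * B 1 1)) =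
      d * (A 1 0 * ((B 0 0 * z + B 0 1) / d) + A 1 1) := by
    rw [mul_add, mul_left_comm, mul_div_cancel₀ _ hz]; simp only [d]; ring
  rw [h1, h2, mul_div_mul_left _ _ hz]

theorem numerator_ne_zero_of_pole {B : Matrix (Fin 2) (Fin 2) ℂ} (hB : B.det ≠ 0) {z : ℂ}
    (hz : B 1 0 * z + B 1 1 = 0) : B 0 0 * z + B 0 1 ≠ 0 := by
  intro h
  rw [Matrix.det_fin_two] at hB
  by_cases h10 : B 1 0 = 0
  · have h11 : B 1 1 = 0 := by simpa [h10] using hz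
    simp [h10, h11] at hB
  · apply hB
    have : B 1 0 * (B 0 0 * B 1 1 - B 0 1 * B 1 0) = 0 := by
      linear_combination (B 0 0 * B 1 0) * hz - (B 1 0) ^ 2 * h
    exact (mul_eq_zero.mp this).resolve_left h10

/-- The value of a composition of Möbius transformations at a pole of the first one. -/
theorem mobius_mul_of_pole (A B : Matrix (Fin 2) (Fin 2) ℂ) (hB : B.det ≠ 0) {z : ℂ}
    (hz : B 1 0 * z + B 1 1 = 0) : mobius (A * B) z = A 0 0 / A 1 0 := by
  simp only [mobius, Matrix.mul_apply, Fin.sum_univ_two]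
  set n := B 0 0 * z + B 0 1 with hn
  have hn0 : n ≠ 0 := numerator_ne_zero_of_pole hB hz
  have h1 : ((A 0 0 * B 0 0 + A 0 1 * B 1 0) * z + (A 0 0 * B 0 1 + A 0 1 * B 1 1)) =
      A 0 0 * n := by
    linear_combination A 0 1 * hz - A 0 0 * hn
  have h2 : ((A 1 0 * B 0 0 + A 1 1 * B 1 0) * z + (A 1 0 * B 0 1 + A 1 1 * B 1 1)) =
      A 1 0 * n := by
    linear_combination A 1 1 * hz - A 1 0 * hn
  rw [h1, h2, mul_div_mul_right _ _ hn0]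

/-- The center of the preimage of the circle with center `c` and radius `r` under the map
`z ↦ q + β / (z - p)`. -/
def pullCenter (p q β c : ℂ) (r : ℝ) : ℂ :=
  p + β * conj (c - q) / ((‖c - q‖ ^ 2 - r ^ 2 : ℝ) : ℂ)

/-- The radius of the preimage of the circle with center `c` and radius `r` under the map
`z ↦ q + β / (z - p)`. -/
def pullRadius (q β c : ℂ) (r : ℝ) : ℝ := ‖β‖ * r / |‖c - q‖ ^ 2 - r ^ 2|

theorem pullRadius_pos {q β c : ℂ} {r : ℝ} (hβ : β ≠ 0) (hr : 0 < r)
    (hΔ : ‖c - q‖ ^ 2 - r ^ 2 ≠ 0) : 0 < pullRadius q β c r := by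
  have := norm_pos_iff.mpr hβ
  have := abs_pos.mpr hΔ
  unfold pullRadius
  positivity

/-- The effect of inversion on the power of a point with respect to a circle. Up to scaling and
translation this is the computation behind all preimages of circles. -/
theorem norm_inv_sub_sq {y d : ℂ} (hy : y ≠ 0) {r : ℝ} (hΔ : ‖d‖ ^ 2 - r ^ 2 ≠ 0) :
    ‖y⁻¹ - conj d / ((‖d‖ ^ 2 - r ^ 2 : ℝ) : ℂ)‖ ^ 2 - r ^ 2 / (‖d‖ ^ 2 - r ^ 2) ^ 2 =
      (‖y - d‖ ^ 2 - r ^ 2) / ((‖d‖ ^ 2 - r ^ 2) * ‖y‖ ^ 2) := by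
  set Δ := ‖d‖ ^ 2 - r ^ 2 with hΔ'
  have hΔc : (Δ : ℂ) ≠ 0 := by exact_mod_cast hΔ
  have hyn : ‖y‖ ^ 2 ≠ 0 := by simpa using hy
  have h1 : y⁻¹ - conj d / (Δ : ℂ) = ((Δ : ℂ) - conj d * y) / (y * Δ) := by
    field_simp
  have h2 : ‖y⁻¹ - conj d / (Δ : ℂ)‖ ^ 2 = ‖(Δ : ℂ) - conj d * y‖ ^ 2 / (‖y‖ ^ 2 * Δ ^ 2) := by
    rw [h1, norm_div, norm_mul, div_pow, mul_pow, Complex.norm_real, Real.norm_eq_abs, sq_abs]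
  have h3 : ‖(Δ : ℂ) - conj d * y‖ ^ 2 = Δ * (‖y - d‖ ^ 2 - r ^ 2) + r ^ 2 * ‖y‖ ^ 2 := by
    have hd : r ^ 2 = ‖d‖ ^ 2 - Δ := by rw [hΔ']; ring
    rw [hd]
    simp only [Complex.sq_norm, Complex.normSq_apply, Complex.sub_re, Complex.sub_im,
      Complex.mul_re, Complex.mul_im, Complex.conj_re, Complex.conj_im, Complex.ofReal_re,
      Complex.ofReal_im]
    ring
  rw [h2, h3]
  field_simp
  ring

/-- The power of z with respect to the pulled-back circle is the power of its image times a factor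
with the sign of `‖c - q‖ ^ 2 - r ^ 2`. Hence sides are preserved if the image q of infinity lies
outside the circle, and exchanged if it lies inside. -/
theorem dist_pullCenter_sq {p q β c z : ℂ} {r : ℝ} (hβ : β ≠ 0) (hz : z ≠ p)
    (hΔ : ‖c - q‖ ^ 2 - r ^ 2 ≠ 0) :
    dist z (pullCenter p q β c r) ^ 2 - pullRadius q β c r ^ 2 =
      (dist (q + β / (z - p)) c ^ 2 - r ^ 2) * (dist z p ^ 2 / (‖c - q‖ ^ 2 - r ^ 2)) := by
  have hzp : z - p ≠ 0 := sub_ne_zero.mpr hz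
  have hy : β / (z - p) ≠ 0 := div_ne_zero hβ hzp
  have hβn : ‖β‖ ^ 2 ≠ 0 := by simpa using hβ
  have hzn : ‖z - p‖ ^ 2 ≠ 0 := by simpa using hzp
  have key := norm_inv_sub_sq hy hΔ
  have h1 : z - pullCenter p q β c r =
      β * ((β / (z - p))⁻¹ - conj (c - q) / ((‖c - q‖ ^ 2 - r ^ 2 : ℝ) : ℂ)) := by
    simp only [pullCenter]
    rw [mul_sub, inv_div, mul_div_cancel₀ _ hβ]
    ring
  have h2 : q + β / (z - p) - c = β / (z - p) - (c - q) := by ring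
  rw [dist_eq_norm, dist_eq_norm, dist_eq_norm, h1, h2, norm_mul, mul_pow, pullRadius, div_pow,
    mul_pow, sq_abs, mul_div_assoc, ← mul_sub, key, norm_div, div_pow]
  field_simp

/-- The pole needs its own formula: division by zero gives the map the value q there instead of
infinity. -/
theorem dist_pole_pullCenter_sq {p q β c : ℂ} {r : ℝ} (hΔ : ‖c - q‖ ^ 2 - r ^ 2 ≠ 0) :
    dist p (pullCenter p q β c r) ^ 2 - pullRadius q β c r ^ 2 =
      ‖β‖ ^ 2 / (‖c - q‖ ^ 2 - r ^ 2) := by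
  rw [dist_eq_norm, pullCenter, pullRadius, sub_add_cancel_left, norm_neg, norm_div, norm_mul,
    RCLike.norm_conj, Complex.norm_real, Real.norm_eq_abs, div_pow, div_pow, sq_abs, mul_pow,
    mul_pow]
  field_simp

theorem lt_iff_sq_sub_neg {x r : ℝ} (hx : 0 ≤ x) (hr : 0 ≤ r) : x < r ↔ x ^ 2 - r ^ 2 < 0 := by
  rw [sub_neg, sq_lt_sq₀ hx hr]

theorem eq_iff_sq_sub_eq {x r : ℝ} (hx : 0 ≤ x) (hr : 0 ≤ r) : x = r ↔ x ^ 2 - r ^ 2 = 0 := by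
  rw [sub_eq_zero, sq_eq_sq₀ hx hr]

section Pull

variable {p q β c z : ℂ} {r : ℝ}

theorem dist_pullCenter_eq_iff (hβ : β ≠ 0) (hr : 0 < r) (hz : z ≠ p)
    (hΔ : ‖c - q‖ ^ 2 - r ^ 2 ≠ 0) :
    dist z (pullCenter p q β c r) = pullRadius q β c r ↔ dist (q + β / (z - p)) c = r := by
  have hzp : dist z p ^ 2 ≠ 0 := by simpa using hz
  rw [eq_iff_sq_sub_eq dist_nonneg (pullRadius_pos hβ hr hΔ).le, dist_pullCenter_sq hβ hz hΔ,
    eq_iff_sq_sub_eq dist_nonneg hr.le, mul_eq_zero]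
  simp [hzp, hΔ]

/-- The preimage of a disc that does not contain the image of infinity. -/
theorem dist_pullCenter_lt_iff (hβ : β ≠ 0) (hr : 0 < r) (hz : z ≠ p) (hq : r < dist q c) :
    dist z (pullCenter p q β c r) < pullRadius q β c r ↔ dist (q + β / (z - p)) c < r := by
  have hΔ : 0 < ‖c - q‖ ^ 2 - r ^ 2 := by
    rw [dist_comm, dist_eq_norm] at hq
    nlinarith [norm_nonneg (c - q)]
  have hzp : 0 < dist z p ^ 2 := pow_pos (dist_pos.mpr hz) 2
  rw [lt_iff_sq_sub_neg dist_nonneg (pullRadius_pos hβ hr hΔ.ne').le,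
    dist_pullCenter_sq hβ hz hΔ.ne', lt_iff_sq_sub_neg dist_nonneg hr.le]
  have hd := div_pos hzp hΔ
  exact ⟨fun h => neg_of_mul_neg_left h hd.le, fun h => mul_neg_of_neg_of_pos h hd⟩

theorem pullRadius_lt_dist_pole (hβ : β ≠ 0) (hr : 0 < r) (hq : r < dist q c) :
    pullRadius q β c r < dist p (pullCenter p q β c r) := by
  have hΔ : 0 < ‖c - q‖ ^ 2 - r ^ 2 := by
    rw [dist_comm, dist_eq_norm] at hq
    nlinarith [norm_nonneg (c - q)]
  have h := dist_pole_pullCenter_sq (p := p) (β := β) hΔ.ne'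
  have hβ' : 0 < ‖β‖ := norm_pos_iff.mpr hβ
  have h' : 0 < ‖β‖ ^ 2 / (‖c - q‖ ^ 2 - r ^ 2) := by positivity
  by_contra! hcon
  have := pow_le_pow_left₀ dist_nonneg hcon 2
  linarith

/-- The preimage of the outside of a disc that contains the image of infinity. -/
theorem dist_pullCenter_lt_iff' (hβ : β ≠ 0) (hr : 0 < r) (hz : z ≠ p) (hq : dist q c < r) :
    dist z (pullCenter p q β c r) < pullRadius q β c r ↔ r < dist (q + β / (z - p)) c := by
  have hΔ : ‖c - q‖ ^ 2 - r ^ 2 < 0 := by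
    rw [dist_comm, dist_eq_norm] at hq
    nlinarith [norm_nonneg (c - q)]
  have hzp : 0 < dist z p ^ 2 := pow_pos (dist_pos.mpr hz) 2
  rw [lt_iff_sq_sub_neg dist_nonneg (pullRadius_pos hβ hr hΔ.ne).le,
    dist_pullCenter_sq hβ hz hΔ.ne, lt_iff_sq_sub_neg hr.le dist_nonneg]
  have hn : dist z p ^ 2 / (‖c - q‖ ^ 2 - r ^ 2) < 0 := div_neg_of_pos_of_neg hzp hΔ
  constructor
  · intro h
    by_contra! hcon
    exact absurd h (not_lt.mpr (mul_nonneg_of_nonpos_of_nonpos (by linarith) hn.le))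
  · intro h
    exact mul_neg_of_pos_of_neg (by linarith) hn

theorem dist_pole_lt_pullRadius (hβ : β ≠ 0) (hr : 0 < r) (hq : dist q c < r) :
    dist p (pullCenter p q β c r) < pullRadius q β c r := by
  have hΔ : ‖c - q‖ ^ 2 - r ^ 2 < 0 := by
    rw [dist_comm, dist_eq_norm] at hq
    nlinarith [norm_nonneg (c - q)]
  have h := dist_pole_pullCenter_sq (p := p) (β := β) hΔ.ne
  have hβ' : 0 < ‖β‖ := norm_pos_iff.mpr hβ
  have h' : ‖β‖ ^ 2 / (‖c - q‖ ^ 2 - r ^ 2) < 0 := div_neg_of_pos_of_neg (by positivity) hΔ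
  rw [lt_iff_sq_sub_neg dist_nonneg (pullRadius_pos hβ hr hΔ.ne).le, h]
  exact h'

end Pull

/-- Comparing squared distances at the opposite points ±1 and ±i of the smaller set kills both
coordinates of the offset of the centers. -/
theorem eq_of_sphere_subset_sphere {c c' : ℂ} {r r' : ℝ} (hr : 0 < r) (hr' : 0 < r')
    (h : Metric.sphere c' r' ⊆ Metric.sphere c r) : c' = c ∧ r' = r := by
  have key : ∀ u : ℂ, ‖u‖ = 1 → ‖(c' - c) + r' * u‖ ^ 2 = r ^ 2 := by
    intro u hu
    have : c' + r' * u ∈ Metric.sphere c r := h (by simp [hu, hr'.le])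
    rw [mem_sphere_iff_norm] at this
    rw [← this]; congr 2; ring
  have h1 := key 1 (by simp)
  have h2 := key (-1) (by simp)
  have h3 := key Complex.I (by simp)
  have h4 := key (-Complex.I) (by simp)
  set d := c' - c with hd
  simp only [Complex.sq_norm, Complex.normSq_apply, Complex.add_re, Complex.add_im, Complex.mul_re,
    Complex.mul_im, Complex.neg_re, Complex.neg_im, Complex.I_re, Complex.I_im, Complex.one_re,
    Complex.one_im, Complex.ofReal_re, Complex.ofReal_im] at h1 h2 h3 h4
  have hre : d.re = 0 := by
    have : r' * d.re = 0 := by linear_combination (h1 - h2) / 4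
    exact (mul_eq_zero.mp this).resolve_left hr'.ne'
  have him : d.im = 0 := by
    have : r' * d.im = 0 := by linear_combination (h3 - h4) / 4
    exact (mul_eq_zero.mp this).resolve_left hr'.ne'
  refine ⟨sub_eq_zero.mp (Complex.ext hre him), ?_⟩
  rw [hre, him] at h1
  have : r' ^ 2 = r ^ 2 := by linear_combination h1
  exact (sq_eq_sq₀ hr'.le hr.le).mp this

/-! ### Normal form of the gluing map of a handle. -/

namespace HandleDisc

variable {g m : ℕ} (D : HandleDisc g m) (j : Fin g)

/-- The pole of the gluing map of a handle. -/
def pole : ℂ := -D.glue j 1 1 / D.glue j 1 0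

/-- The image of infinity under the gluing map of a handle. -/
def apex : ℂ := D.glue j 0 0 / D.glue j 1 0

/-- The coefficient `β` of the gluing map `z ↦ q + β / (z - p)` of a handle. -/
def coef : ℂ := -(D.glue j).det / D.glue j 1 0 ^ 2

/-- Otherwise the gluing map is affine, hence unbounded on the outside of the first circle, which it
must send into a bounded disc. -/
theorem glue_one_zero_ne_zero : D.glue j 1 0 ≠ 0 := by
  intro h
  have hdet := D.glue_det j
  rw [Matrix.det_fin_two, h, mul_zero, sub_zero] at hdet
  have h00 := left_ne_zero_of_mul hdet
  have h11 := right_ne_zero_of_mul hdet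
  set ca := D.center (.inl (j, false))
  set ra := D.radius (.inl (j, false)) with hra
  have hrap : 0 < ra := D.radius_pos _
  set cb := D.center (.inl (j, true))
  set rb := D.radius (.inl (j, true)) with hrb
  have hrbp : 0 < rb := D.radius_pos _
  set k := D.glue j 0 0 / D.glue j 1 1 with hk
  have hk0 : 0 < ‖k‖ := norm_pos_iff.mpr (div_ne_zero h00 h11)
  have hm : ∀ z, mobius (D.glue j) z = k * z + D.glue j 0 1 / D.glue j 1 1 := by
    intro z
    simp only [mobius, h, zero_mul, zero_add, hk]
    field_simp
  have hside : ∀ t : ℝ, ra < t → dist (mobius (D.glue j) (ca + t)) cb < rb := by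
    intro t ht
    apply D.glue_side j
    rw [dist_eq_norm, add_sub_cancel_left, Complex.norm_real, Real.norm_eq_abs]
    exact lt_of_lt_of_le ht (le_abs_self t)
  have h1 := hside (ra + 1) (by linarith)
  -- The map scales by ‖k‖, so this point and the previous one have images a full diameter 2 rb
  -- apart, too far for an open disc of radius rb.
  have h2 := hside (ra + 1 + 2 * rb / ‖k‖) (by have : 0 < 2 * rb / ‖k‖ := by positivity
                                               linarith)
  have h3 := dist_triangle_right (mobius (D.glue j) (ca + (ra + 1 : ℝ)))
    (mobius (D.glue j) (ca + (ra + 1 + 2 * rb / ‖k‖ : ℝ))) cb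
  have h4 : dist (mobius (D.glue j) (ca + (ra + 1 : ℝ)))
    (mobius (D.glue j) (ca + (ra + 1 + 2 * rb / ‖k‖ : ℝ))) = 2 * rb := by
    rw [dist_comm, dist_eq_norm, hm, hm]
    have : k * (ca + (ra + 1 + 2 * rb / ‖k‖ : ℝ)) + D.glue j 0 1 / D.glue j 1 1 -
        (k * (ca + (ra + 1 : ℝ)) + D.glue j 0 1 / D.glue j 1 1) = k * ((2 * rb / ‖k‖ : ℝ) : ℂ) := by
      push_cast; ring
    rw [this, norm_mul, Complex.norm_real, Real.norm_eq_abs, abs_of_pos (by positivity)]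
    field_simp
  linarith

theorem coef_ne_zero : D.coef j ≠ 0 :=
  div_ne_zero (neg_ne_zero.mpr (D.glue_det j)) (pow_ne_zero 2 (D.glue_one_zero_ne_zero j))

theorem glue_denom (z : ℂ) :
    D.glue j 1 0 * z + D.glue j 1 1 = D.glue j 1 0 * (z - D.pole j) := by
  have := D.glue_one_zero_ne_zero j
  simp only [pole]
  field_simp
  ring

theorem glue_denom_ne_zero {z : ℂ} (hz : z ≠ D.pole j) :
    D.glue j 1 0 * z + D.glue j 1 1 ≠ 0 := by
  rw [glue_denom]
  exact mul_ne_zero (D.glue_one_zero_ne_zero j) (sub_ne_zero.mpr hz)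

theorem glue_denom_pole : D.glue j 1 0 * D.pole j + D.glue j 1 1 = 0 := by
  rw [glue_denom, sub_self, mul_zero]

theorem mobius_glue {z : ℂ} (hz : z ≠ D.pole j) :
    mobius (D.glue j) z = D.apex j + D.coef j / (z - D.pole j) := by
  have h10 := D.glue_one_zero_ne_zero j
  have hz' : z - D.pole j ≠ 0 := sub_ne_zero.mpr hz
  rw [mobius, glue_denom, coef, apex, Matrix.det_fin_two]
  have hz'' : D.glue j 1 1 = D.glue j 1 0 * (z - D.pole j) - D.glue j 1 0 * z := by
    rw [← glue_denom]; ring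
  rw [hz'']
  field_simp
  ring

/-- Near the pole the values are arbitrarily large, so the pole cannot be approached from outside
the first circle. -/
theorem dist_pole_lt : dist (D.pole j) (D.center (.inl (j, false))) <
    D.radius (.inl (j, false)) := by
  by_contra! hcon
  set p := D.pole j
  set q := D.apex j
  set β := D.coef j
  set ca := D.center (.inl (j, false))
  set cb := D.center (.inl (j, true))
  set rb := D.radius (.inl (j, true))
  have hra := D.radius_pos (.inl (j, false))
  have hrb := D.radius_pos (.inl (j, true))
  have hdp : 0 < dist p ca := by linarith
  have he : p - ca ≠ 0 := by
    rw [dist_eq_norm] at hdp; exact norm_pos_iff.mp hdp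
  have hen : 0 < ‖p - ca‖ := norm_pos_iff.mpr he
  have hβ : 0 < ‖β‖ := norm_pos_iff.mpr (D.coef_ne_zero j)
  set R := rb + ‖q - cb‖
  have hR : 0 < R := by positivity
  -- Chosen so that the point a little beyond the pole has image at distance exactly R from q, hence
  -- at distance at least rb from cb.
  set t : ℝ := ‖β‖ / (‖p - ca‖ * R) with ht
  have htp : 0 < t := by positivity
  have h1 : dist (p + t * (p - ca)) ca = (1 + t) * dist p ca := by
    rw [dist_eq_norm, dist_eq_norm]
    have : p + t * (p - ca) - ca = ((1 + t : ℝ) : ℂ) * (p - ca) := by push_cast; ring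
    rw [this, norm_mul, Complex.norm_real, Real.norm_eq_abs, abs_of_pos (by positivity)]
  have h2 := D.glue_side j (p + t * (p - ca)) (by rw [h1]; nlinarith)
  have htc : (t : ℂ) ≠ 0 := by exact_mod_cast htp.ne'
  have hne : p + t * (p - ca) ≠ p := by
    intro h
    have : (t : ℂ) * (p - ca) = 0 := by linear_combination h
    exact mul_ne_zero htc he this
  rw [D.mobius_glue j hne, dist_eq_norm, add_sub_cancel_left] at h2
  have h3 : ‖β / (t * (p - ca))‖ = R := by
    rw [norm_div, norm_mul, Complex.norm_real, Real.norm_eq_abs, abs_of_pos htp, ht]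
    field_simp
  have h4 : ‖β / (t * (p - ca))‖ ≤ ‖q + β / (t * (p - ca)) - cb‖ + ‖q - cb‖ := by
    have := norm_sub_le (q + β / (t * (p - ca)) - cb) (q - cb)
    rwa [show q + β / (t * (p - ca)) - cb - (q - cb) = β / (t * (p - ca)) by ring] at this
  linarith

/-- The second circle of a handle is the preimage of the first one under the inverse gluing
map. -/
theorem pull_first_eq_second :
    pullCenter (D.apex j) (D.pole j) (D.coef j) (D.center (.inl (j, false)))
      (D.radius (.inl (j, false))) = D.center (.inl (j, true)) ∧
    pullRadius (D.pole j) (D.coef j) (D.center (.inl (j, false)))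
      (D.radius (.inl (j, false))) = D.radius (.inl (j, true)) := by
  have hp := D.dist_pole_lt j
  have hra := D.radius_pos (.inl (j, false))
  have hβ := D.coef_ne_zero j
  have hΔ : ‖D.center (.inl (j, false)) - D.pole j‖ ^ 2 - D.radius (.inl (j, false)) ^ 2 ≠ 0 := by
    rw [dist_comm, dist_eq_norm] at hp
    nlinarith [norm_nonneg (D.center (.inl (j, false)) - D.pole j)]
  -- The inverse gluing map is w ↦ p + β / (w - q), with pole and apex interchanged, so the same
  -- pullback formulas apply to it.
  refine eq_of_sphere_subset_sphere (D.radius_pos _) (pullRadius_pos hβ hra hΔ) ?_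
  intro w hw
  have hwq : w ≠ D.apex j := by
    rintro rfl
    exact absurd hw (dist_pole_lt_pullRadius hβ hra hp).ne
  rw [Metric.mem_sphere, dist_pullCenter_eq_iff hβ hra hwq hΔ] at hw
  have hwq' : w - D.apex j ≠ 0 := sub_ne_zero.mpr hwq
  have hzp : D.pole j + D.coef j / (w - D.apex j) ≠ D.pole j := by
    simpa using ⟨hβ, hwq'⟩
  have := D.glue_circle j _ hw
  rw [D.mobius_glue j hzp, add_sub_cancel_left, div_div_cancel₀ hβ, add_sub_cancel] at this
  exact this

/-- The apex is the pole of the inverse map, whose pullback of the first circle is the second one.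
-/
theorem dist_apex_lt : dist (D.apex j) (D.center (.inl (j, true))) <
    D.radius (.inl (j, true)) := by
  obtain ⟨h1, h2⟩ := D.pull_first_eq_second j
  rw [← h1, ← h2]
  exact dist_pole_lt_pullRadius (D.coef_ne_zero j) (D.radius_pos _) (D.dist_pole_lt j)

theorem mobius_ne_apex {z : ℂ} (hz : z ≠ D.pole j) : mobius (D.glue j) z ≠ D.apex j := by
  rw [D.mobius_glue j hz]
  simpa using ⟨D.coef_ne_zero j, sub_ne_zero.mpr hz⟩

theorem pole_add_eq {z : ℂ} (hz : z ≠ D.pole j) :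
    D.pole j + D.coef j / (mobius (D.glue j) z - D.apex j) = z := by
  rw [D.mobius_glue j hz, add_sub_cancel_left, div_div_cancel₀ (D.coef_ne_zero j), add_sub_cancel]

theorem mobius_pole_add {w : ℂ} (hw : w ≠ D.apex j) :
    mobius (D.glue j) (D.pole j + D.coef j / (w - D.apex j)) = w := by
  have hzp : D.pole j + D.coef j / (w - D.apex j) ≠ D.pole j := by
    simpa using ⟨D.coef_ne_zero j, sub_ne_zero.mpr hw⟩
  rw [D.mobius_glue j hzp, add_sub_cancel_left, div_div_cancel₀ (D.coef_ne_zero j), add_sub_cancel]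

theorem pole_add_ne_pole {w : ℂ} (hw : w ≠ D.apex j) :
    D.pole j + D.coef j / (w - D.apex j) ≠ D.pole j := by
  simpa using ⟨D.coef_ne_zero j, sub_ne_zero.mpr hw⟩

/-- The gluing map exchanges the sides of the two circles. -/
theorem dist_mobius_lt_iff {z : ℂ} (hz : z ≠ D.pole j) :
    dist (mobius (D.glue j) z) (D.center (.inl (j, true))) < D.radius (.inl (j, true)) ↔
      D.radius (.inl (j, false)) < dist z (D.center (.inl (j, false))) := by
  obtain ⟨h1, h2⟩ := D.pull_first_eq_second j
  rw [← h1, ← h2, dist_pullCenter_lt_iff' (D.coef_ne_zero j) (D.radius_pos _)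
    (D.mobius_ne_apex j hz) (D.dist_pole_lt j), D.pole_add_eq j hz]

theorem dist_mobius_eq_iff {z : ℂ} (hz : z ≠ D.pole j) :
    dist (mobius (D.glue j) z) (D.center (.inl (j, true))) = D.radius (.inl (j, true)) ↔
      dist z (D.center (.inl (j, false))) = D.radius (.inl (j, false)) := by
  have hΔ : ‖D.center (.inl (j, false)) - D.pole j‖ ^ 2 - D.radius (.inl (j, false)) ^ 2 ≠ 0 := by
    have hp := D.dist_pole_lt j
    rw [dist_comm, dist_eq_norm] at hp
    nlinarith [norm_nonneg (D.center (.inl (j, false)) - D.pole j)]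
  obtain ⟨h1, h2⟩ := D.pull_first_eq_second j
  rw [← h1, ← h2, dist_pullCenter_eq_iff (D.coef_ne_zero j) (D.radius_pos _)
    (D.mobius_ne_apex j hz) hΔ, D.pole_add_eq j hz]

theorem ne_pole_of_radius_le {z : ℂ}
    (hz : D.radius (.inl (j, false)) ≤ dist z (D.center (.inl (j, false)))) : z ≠ D.pole j := by
  rintro rfl
  exact absurd (D.dist_pole_lt j) (not_lt.mpr hz)

theorem ne_apex_of_radius_le {z : ℂ}
    (hz : D.radius (.inl (j, true)) ≤ dist z (D.center (.inl (j, true)))) : z ≠ D.apex j := by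
  rintro rfl
  exact absurd (D.dist_apex_lt j) (not_lt.mpr hz)

theorem contDiffAt_mobius {z : ℂ} (hz : z ≠ D.pole j) :
    ContDiffAt ℝ ∞ (mobius (D.glue j)) z := by
  have h1 : ContDiffAt ℝ ∞ (fun z : ℂ => D.glue j 0 0 * z + D.glue j 0 1) z := by fun_prop
  have h2 : ContDiffAt ℝ ∞ (fun z : ℂ => D.glue j 1 0 * z + D.glue j 1 1) z := by fun_prop
  exact (h1.mul (h2.inv (D.glue_denom_ne_zero j hz))).congr_of_eventuallyEq
    (.of_forall fun z => div_eq_mul_inv _ _)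

theorem continuousAt_mobius {z : ℂ} (hz : z ≠ D.pole j) :
    ContinuousAt (mobius (D.glue j)) z :=
  (D.contDiffAt_mobius j hz).continuousAt

theorem injective_fderiv_mobius {z : ℂ} (hz : z ≠ D.pole j) :
    Function.Injective (fderiv ℝ (mobius (D.glue j)) z) := by
  have hw := D.mobius_ne_apex j hz
  set inv : ℂ → ℂ := fun w => D.pole j + D.coef j / (w - D.apex j)
  have h1 : (inv ∘ mobius (D.glue j)) =ᶠ[𝓝 z] id := by
    filter_upwards [isOpen_ne.mem_nhds hz] with y hy using D.pole_add_eq j hy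
  have h2 : DifferentiableAt ℝ inv (mobius (D.glue j) z) := by
    have : DifferentiableAt ℝ (fun w => w - D.apex j) (mobius (D.glue j) z) := by fun_prop
    simp only [inv, div_eq_mul_inv]
    exact (((this.inv (sub_ne_zero.mpr hw)).const_mul _).const_add _)
  have h3 := fderiv_comp z h2 ((D.contDiffAt_mobius j hz).differentiableAt (by simp))
  rw [h1.fderiv_eq, fderiv_id] at h3
  intro x y hxy
  have := congrArg (fderiv ℝ inv (mobius (D.glue j) z)) hxy
  have e := fun x => DFunLike.congr_fun h3 x
  exact (e x).trans (this.trans (e y).symm)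

/-- Points on the second circle of a handle are glued to points on its seam. -/
theorem exists_mem_seam {w : ℂ}
    (hw : dist w (D.center (.inl (j, true))) = D.radius (.inl (j, true))) :
    ∃ z ∈ D.seam j, mobius (D.glue j) z = w := by
  have hwq := D.ne_apex_of_radius_le j hw.ge
  refine ⟨D.pole j + D.coef j / (w - D.apex j), ?_, D.mobius_pole_add j hwq⟩
  have := (D.dist_mobius_eq_iff j (D.pole_add_ne_pole j hwq)).mp
    (by rw [D.mobius_pole_add j hwq]; exact hw)
  exact this

end HandleDisc

end KnotCobordism

end

open scoped Manifold ContDiff Topology ComplexConjugate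

noncomputable section

namespace KnotCobordism

/-- Apply the hypothesis to the point of the disc farthest from the origin. -/
theorem norm_add_lt_one_of_closedBall {c : ℂ} {r : ℝ} (hr : 0 < r)
    (h : ∀ z, dist z c ≤ r → ‖z‖ < 1) : ‖c‖ + r < 1 := by
  by_cases hc : c = 0
  · have := h r (by simp [hc, abs_of_pos hr])
    simpa [hc, abs_of_pos hr] using this
  · have hcn : 0 < ‖c‖ := norm_pos_iff.mpr hc
    have h1 := h (((1 + r / ‖c‖ : ℝ) : ℂ) * c) (by
      rw [dist_eq_norm]
      have : ((1 + r / ‖c‖ : ℝ) : ℂ) * c - c = ((r / ‖c‖ : ℝ) : ℂ) * c := by push_cast; ring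
      rw [this, norm_mul, Complex.norm_real, Real.norm_eq_abs, abs_of_pos (by positivity)]
      field_simp; rfl)
    rw [norm_mul, Complex.norm_real, Real.norm_eq_abs, abs_of_pos (by positivity)] at h1
    field_simp at h1
    linarith

theorem mobius_one (z : ℂ) : mobius 1 z = z := by simp [mobius]

namespace HandleDisc

variable {k : ℕ} (D : HandleDisc (k + 1) 0)

/-! ### Doubling along the first handle

Two copies of the surface, cut along the seam of the first handle and glued crosswise.  The first
copy is the domain of `D` itself; the second one is put into the first hole by the inverse of the
gluing map. -/

/-- The centers of the preimages of the holes, and of the exterior of the unit disc. -/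
def pullC : Option (Fin (k + 1) × Bool) → ℂ
  | some i => pullCenter (D.pole 0) (D.apex 0) (D.coef 0) (D.center (.inl i)) (D.radius (.inl i))
  | none => pullCenter (D.pole 0) (D.apex 0) (D.coef 0) 0 1

/-- The radii of the preimages of the holes, and of the exterior of the unit disc. -/
def pullR : Option (Fin (k + 1) × Bool) → ℝ
  | some i => pullRadius (D.apex 0) (D.coef 0) (D.center (.inl i)) (D.radius (.inl i))
  | none => pullRadius (D.apex 0) (D.coef 0) 0 1

theorem norm_apex_lt_one (j : Fin (k + 1)) : ‖D.apex j‖ < 1 :=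
  D.norm_lt_one_of_mem_closedBall (D.dist_apex_lt j).le

/-- Infinity is sent into the second hole of the handle, hence off every other hole and into the
unit disc. So every other hole pulls back to a disc missing the pole, and the exterior of the unit
circle to a disc containing it. -/
theorem radius_lt_dist_apex {i : Fin (k + 1) × Bool} (hi : i ≠ (0, true)) :
    D.radius (.inl i) < dist (D.apex 0) (D.center (.inl i)) :=
  D.radius_lt_dist_of_mem_closedBall (i := .inl (0, true)) (by simpa using hi.symm)
    (D.dist_apex_lt 0).le

theorem pull_discr_pos {i : Fin (k + 1) × Bool} (hi : i ≠ (0, true)) :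
    0 < ‖D.center (.inl i) - D.apex 0‖ ^ 2 - D.radius (.inl i) ^ 2 := by
  have h := D.radius_lt_dist_apex hi
  have h' := D.radius_pos (.inl i)
  rw [dist_comm, dist_eq_norm] at h
  nlinarith

theorem exterior_discr_neg : ‖(0 : ℂ) - D.apex 0‖ ^ 2 - (1 : ℝ) ^ 2 < 0 := by
  have := D.norm_apex_lt_one 0
  rw [zero_sub, norm_neg]
  nlinarith [norm_nonneg (D.apex 0)]

theorem pullR_pos {i : Option (Fin (k + 1) × Bool)} (hi : i ≠ some (0, true)) :
    0 < D.pullR i := by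
  cases i with
  | none => exact pullRadius_pos (D.coef_ne_zero 0) one_pos D.exterior_discr_neg.ne
  | some i =>
    exact pullRadius_pos (D.coef_ne_zero 0) (D.radius_pos _)
      (D.pull_discr_pos (by simpa using hi)).ne'

theorem dist_pullC_some_lt_iff {i : Fin (k + 1) × Bool} (hi : i ≠ (0, true)) {z : ℂ}
    (hz : z ≠ D.pole 0) : dist z (D.pullC (some i)) < D.pullR (some i) ↔
      dist (mobius (D.glue 0) z) (D.center (.inl i)) < D.radius (.inl i) := by
  rw [D.mobius_glue 0 hz]
  exact dist_pullCenter_lt_iff (D.coef_ne_zero 0) (D.radius_pos _) hz (D.radius_lt_dist_apex hi)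

theorem dist_pullC_some_eq_iff {i : Fin (k + 1) × Bool} (hi : i ≠ (0, true)) {z : ℂ}
    (hz : z ≠ D.pole 0) : dist z (D.pullC (some i)) = D.pullR (some i) ↔
      dist (mobius (D.glue 0) z) (D.center (.inl i)) = D.radius (.inl i) := by
  rw [D.mobius_glue 0 hz]
  exact dist_pullCenter_eq_iff (D.coef_ne_zero 0) (D.radius_pos _) hz (D.pull_discr_pos hi).ne'

theorem dist_pullC_some_le_iff {i : Fin (k + 1) × Bool} (hi : i ≠ (0, true)) {z : ℂ}
    (hz : z ≠ D.pole 0) : dist z (D.pullC (some i)) ≤ D.pullR (some i) ↔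
      dist (mobius (D.glue 0) z) (D.center (.inl i)) ≤ D.radius (.inl i) := by
  rw [le_iff_lt_or_eq, le_iff_lt_or_eq, D.dist_pullC_some_lt_iff hi hz,
    D.dist_pullC_some_eq_iff hi hz]

theorem pullR_some_lt_dist_pole {i : Fin (k + 1) × Bool} (hi : i ≠ (0, true)) :
    D.pullR (some i) < dist (D.pole 0) (D.pullC (some i)) :=
  pullRadius_lt_dist_pole (D.coef_ne_zero 0) (D.radius_pos _) (D.radius_lt_dist_apex hi)

theorem dist_pullC_none_lt_iff {z : ℂ} (hz : z ≠ D.pole 0) :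
    dist z (D.pullC none) < D.pullR none ↔ 1 < ‖mobius (D.glue 0) z‖ := by
  rw [D.mobius_glue 0 hz, ← dist_zero_right]
  exact dist_pullCenter_lt_iff' (D.coef_ne_zero 0) one_pos hz (by simpa using D.norm_apex_lt_one 0)

theorem dist_pullC_none_eq_iff {z : ℂ} (hz : z ≠ D.pole 0) :
    dist z (D.pullC none) = D.pullR none ↔ ‖mobius (D.glue 0) z‖ = 1 := by
  rw [D.mobius_glue 0 hz, ← dist_zero_right]
  exact dist_pullCenter_eq_iff (D.coef_ne_zero 0) one_pos hz D.exterior_discr_neg.ne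

theorem dist_pullC_none_le_iff {z : ℂ} (hz : z ≠ D.pole 0) :
    dist z (D.pullC none) ≤ D.pullR none ↔ 1 ≤ ‖mobius (D.glue 0) z‖ := by
  rw [le_iff_lt_or_eq, le_iff_lt_or_eq, D.dist_pullC_none_lt_iff hz, D.dist_pullC_none_eq_iff hz,
    eq_comm (a := (1 : ℝ))]

theorem dist_pole_pullC_none_lt : dist (D.pole 0) (D.pullC none) < D.pullR none :=
  dist_pole_lt_pullRadius (D.coef_ne_zero 0) one_pos (by simpa using D.norm_apex_lt_one 0)

/-- The preimages lie inside of the first hole. -/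
theorem dist_center_lt_of_pull {i : Option (Fin (k + 1) × Bool)} (hi : i ≠ some (0, true)) {z : ℂ}
    (hz : dist z (D.pullC i) ≤ D.pullR i) :
    dist z (D.center (.inl (0, false))) < D.radius (.inl (0, false)) := by
  by_cases hzp : z = D.pole 0
  · rw [hzp]; exact D.dist_pole_lt 0
  have key : D.radius (.inl (0, true)) <
      dist (mobius (D.glue 0) z) (D.center (.inl (0, true))) := by
    cases i with
    | none =>
      rw [D.dist_pullC_none_le_iff hzp] at hz
      by_contra! hcon
      exact absurd (D.norm_lt_one_of_mem_closedBall hcon) (not_lt.mpr hz)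
    | some i =>
      have hi' : i ≠ (0, true) := by simpa using hi
      rw [D.dist_pullC_some_le_iff hi' hzp] at hz
      exact D.radius_lt_dist_of_mem_closedBall (by simpa using hi') hz
  have h1 := D.dist_mobius_lt_iff 0 hzp
  have h2 := D.dist_mobius_eq_iff 0 hzp
  by_contra! hcon
  rcases hcon.lt_or_eq with h | h
  · exact absurd (h1.mpr h) (not_lt.mpr key.le)
  · exact absurd (h2.mpr h.symm) key.ne'

/-- The hole of the doubled disc belonging to an end of a handle: a hole of the first copy or a
preimage of a hole. -/
def doubleHole : Option (Fin k × Bool) → Bool →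
    (Fin (k + 1) × Bool) ⊕ Option (Fin (k + 1) × Bool)
  -- The handle along which the surfaces are cut contributes only one handle: its first circle in
  -- the second copy is paired with its second circle in the first copy. Its two remaining circles
  -- coincide in the plane and are no longer holes.
  | none, false => .inr (some (0, false))
  | none, true => .inl (0, true)
  | some (j, false), s => .inl (j.succ, s)
  | some (j, true), s => .inr (some (j.succ, s))

/-- The numbering of the handles of the doubled disc. -/
def doubleIndex (k : ℕ) : Fin (2 * k + 1) ≃ Option (Fin k × Bool) :=
  (Fintype.equivFinOfCardEq (by simp [mul_comm])).symm

/-- The holes of the doubled disc. -/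
def doubleSource : (Fin (2 * k + 1) × Bool) ⊕ Fin 1 →
    (Fin (k + 1) × Bool) ⊕ Option (Fin (k + 1) × Bool)
  | .inl (j, s) => doubleHole (doubleIndex k j) s
  | .inr _ => .inr none

theorem doubleHole_injective : ∀ j s j' s', doubleHole (k := k) j s = doubleHole j' s' →
    j = j' ∧ s = s' := by
  rintro (_ | ⟨j, _ | _⟩) (_ | _) (_ | ⟨j', _ | _⟩) (_ | _) h <;>
    simp_all [doubleHole, Fin.succ_ne_zero, (Fin.succ_ne_zero _).symm]

theorem doubleHole_ne_none : ∀ j s, doubleHole (k := k) j s ≠ .inr none := by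
  rintro (_ | ⟨j, _ | _⟩) (_ | _) <;> simp [doubleHole]

theorem doubleSource_injective : Function.Injective (doubleSource (k := k)) := by
  rintro (⟨j, s⟩ | i) (⟨j', s'⟩ | i') h
  · obtain ⟨h1, h2⟩ := doubleHole_injective _ _ _ _ h
    rw [(doubleIndex k).injective h1, h2]
  · exact absurd h (doubleHole_ne_none _ _)
  · exact absurd h.symm (doubleHole_ne_none _ _)
  · rw [Subsingleton.elim i i']

theorem doubleHole_ne_first : ∀ j s, doubleHole (k := k) j s ≠ .inl (0, false) := by
  rintro (_ | ⟨j, _ | _⟩) (_ | _) <;> simp [doubleHole, Fin.succ_ne_zero]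

theorem doubleHole_ne_second : ∀ j s, doubleHole (k := k) j s ≠ .inr (some (0, true)) := by
  rintro (_ | ⟨j, _ | _⟩) (_ | _) <;> simp [doubleHole, Fin.succ_ne_zero]

theorem doubleSource_ne_first (i) : doubleSource (k := k) i ≠ .inl (0, false) := by
  rcases i with ⟨j, s⟩ | i
  · exact doubleHole_ne_first _ _
  · simp [doubleSource]

theorem doubleSource_ne_second (i) : doubleSource (k := k) i ≠ .inr (some (0, true)) := by
  rcases i with ⟨j, s⟩ | i
  · exact doubleHole_ne_second _ _
  · simp [doubleSource]

/-- Every hole of `D`, apart from the first one, is a hole of the first copy. -/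
theorem exists_doubleSource_inl {i : Fin (k + 1) × Bool} (hi : i ≠ (0, false)) :
    ∃ i', doubleSource (k := k) i' = .inl i := by
  obtain ⟨j, s⟩ := i
  induction j using Fin.cases with
  | zero =>
    have hs : s = true := by cases s <;> simp_all
    exact ⟨.inl ((doubleIndex k).symm none, true), by simp [doubleSource, doubleHole, hs]⟩
  | succ j =>
    exact ⟨.inl ((doubleIndex k).symm (some (j, false)), s), by simp [doubleSource, doubleHole]⟩

theorem exists_doubleSource_inr {i : Fin (k + 1) × Bool} (hi : i ≠ (0, true)) :
    ∃ i', doubleSource (k := k) i' = .inr (some i) := by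
  obtain ⟨j, s⟩ := i
  induction j using Fin.cases with
  | zero =>
    have hs : s = false := by cases s <;> simp_all
    exact ⟨.inl ((doubleIndex k).symm none, false), by simp [doubleSource, doubleHole, hs]⟩
  | succ j =>
    exact ⟨.inl ((doubleIndex k).symm (some (j, true)), s), by simp [doubleSource, doubleHole]⟩

/-- The centers of the holes of both copies. -/
def sheetC : (Fin (k + 1) × Bool) ⊕ Option (Fin (k + 1) × Bool) → ℂ :=
  Sum.elim (fun i => D.center (.inl i)) D.pullC

/-- The radii of the holes of both copies. -/
def sheetR : (Fin (k + 1) × Bool) ⊕ Option (Fin (k + 1) × Bool) → ℝ :=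
  Sum.elim (fun i => D.radius (.inl i)) D.pullR

theorem sheetR_pos {i} (hi : i ≠ .inr (some (0, true))) : 0 < D.sheetR i := by
  rcases i with i | i
  · exact D.radius_pos _
  · exact D.pullR_pos (by simpa using hi)

theorem sheet_inside {i} (hi : i ≠ .inr (some (0, true))) :
    ‖D.sheetC i‖ + D.sheetR i < 1 := by
  refine norm_add_lt_one_of_closedBall (D.sheetR_pos hi) fun z hz => ?_
  rcases i with i | i
  · exact D.norm_lt_one_of_mem_closedBall hz
  · exact D.norm_lt_one_of_mem_closedBall (D.dist_center_lt_of_pull (by simpa using hi) hz).le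

/-- Away from the pole a common point would map to a common point of two disjoint holes, or of a
hole and the exterior. The pole lies only in the pullback of the exterior. -/
theorem pull_disjoint {i i' : Option (Fin (k + 1) × Bool)} (hi : i ≠ some (0, true))
    (hi' : i' ≠ some (0, true)) (hne : i ≠ i') {z : ℂ} (hz : dist z (D.pullC i) ≤ D.pullR i)
    (hz' : dist z (D.pullC i') ≤ D.pullR i') : False := by
  by_cases hzp : z = D.pole 0
  · subst hzp
    rcases i with _ | i
    · rcases i' with _ | i'
      · exact hne rfl
      · exact absurd hz' (not_le.mpr (D.pullR_some_lt_dist_pole (by simpa using hi')))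
    · exact absurd hz (not_le.mpr (D.pullR_some_lt_dist_pole (by simpa using hi)))
  · rcases i with _ | i <;> rcases i' with _ | i'
    · exact hne rfl
    · rw [D.dist_pullC_none_le_iff hzp] at hz
      rw [D.dist_pullC_some_le_iff (by simpa using hi') hzp] at hz'
      exact absurd (D.norm_lt_one_of_mem_closedBall hz') (not_lt.mpr hz)
    · rw [D.dist_pullC_none_le_iff hzp] at hz'
      rw [D.dist_pullC_some_le_iff (by simpa using hi) hzp] at hz
      exact absurd (D.norm_lt_one_of_mem_closedBall hz) (not_lt.mpr hz')
    · rw [D.dist_pullC_some_le_iff (by simpa using hi) hzp] at hz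
      rw [D.dist_pullC_some_le_iff (by simpa using hi') hzp] at hz'
      exact absurd (D.radius_lt_dist_of_mem_closedBall
        (i := .inl i) (j := .inl i') (by simpa using hne) hz) (not_lt.mpr hz')

/-- Holes of the second copy lie inside the first hole, which the remaining holes of the first copy
avoid; within one copy disjointness is inherited. -/
theorem sheet_disjoint {i i'} (hi : i ≠ .inl (0, false)) (hi' : i' ≠ .inl (0, false))
    (hj : i ≠ .inr (some (0, true))) (hj' : i' ≠ .inr (some (0, true))) (hne : i ≠ i') :
    D.sheetR i + D.sheetR i' < dist (D.sheetC i) (D.sheetC i') := by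
  rw [← disjoint_closedBall_closedBall_iff (D.sheetR_pos hj).le (D.sheetR_pos hj').le,
    Set.disjoint_left]
  intro z hz hz'
  rw [Metric.mem_closedBall] at hz hz'
  rcases i with i | i <;> rcases i' with i' | i'
  · exact absurd (D.radius_lt_dist_of_mem_closedBall
      (i := .inl i) (j := .inl i') (by simpa using hne) hz) (not_lt.mpr hz')
  · exact absurd (D.radius_lt_dist_of_mem_closedBall (i := .inl (0, false)) (j := .inl i)
      (by simpa using Ne.symm hi) (D.dist_center_lt_of_pull (by simpa using hj') hz').le)
      (not_lt.mpr hz)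
  · exact absurd (D.radius_lt_dist_of_mem_closedBall (i := .inl (0, false)) (j := .inl i')
      (by simpa using Ne.symm hi') (D.dist_center_lt_of_pull (by simpa using hj) hz).le)
      (not_lt.mpr hz')
  · exact D.pull_disjoint (by simpa using hj) (by simpa using hj') (by simpa using hne) hz hz'

/-- The gluing maps of the doubled disc. -/
def doubleGlue : Option (Fin k × Bool) → Matrix (Fin 2) (Fin 2) ℂ
  -- One application of the gluing map reads off the original position of a point of the second
  -- copy; the other crosses the handle into the first copy.
  | none => D.glue 0 * D.glue 0
  | some (j, false) => D.glue j.succ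
  -- In the second copy the gluing is conjugated by the coordinate `D.glue 0` of that copy.
  | some (j, true) => (D.glue 0)⁻¹ * (D.glue j.succ * D.glue 0)

theorem doubleGlue_det (j) : (D.doubleGlue j).det ≠ 0 := by
  have h0 := D.glue_det 0
  rcases j with _ | ⟨j, _ | _⟩
  · simpa [doubleGlue] using h0
  · exact D.glue_det _
  · simp [doubleGlue, h0, D.glue_det j.succ]

theorem mobius_inv_mobius {z : ℂ} (hz : z ≠ D.pole 0) :
    mobius (D.glue 0)⁻¹ (mobius (D.glue 0) z) = z := by
  rw [← mobius_mul _ _ (D.glue_denom_ne_zero 0 hz),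
    Matrix.nonsing_inv_mul _ (Ne.isUnit (D.glue_det 0)), mobius_one]

theorem mobius_inv {w : ℂ} (hw : w ≠ D.apex 0) :
    mobius (D.glue 0)⁻¹ w = D.pole 0 + D.coef 0 / (w - D.apex 0) := by
  conv_lhs => rw [← D.mobius_pole_add 0 hw]
  exact D.mobius_inv_mobius (D.pole_add_ne_pole 0 hw)

theorem mobius_inv_ne_pole {w : ℂ} (hw : w ≠ D.apex 0) : mobius (D.glue 0)⁻¹ w ≠ D.pole 0 := by
  rw [D.mobius_inv hw]; exact D.pole_add_ne_pole 0 hw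

theorem mobius_mobius_inv {w : ℂ} (hw : w ≠ D.apex 0) :
    mobius (D.glue 0) (mobius (D.glue 0)⁻¹ w) = w := by
  rw [D.mobius_inv hw, D.mobius_pole_add 0 hw]

theorem mobius_doubleGlue_none {z : ℂ} (hz : z ≠ D.pole 0) :
    mobius (D.doubleGlue none) z = mobius (D.glue 0) (mobius (D.glue 0) z) :=
  mobius_mul _ _ (D.glue_denom_ne_zero 0 hz)

theorem mobius_doubleGlue_some_true (j : Fin k) {z : ℂ} (hz : z ≠ D.pole 0)
    (hz' : mobius (D.glue 0) z ≠ D.pole j.succ) :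
    mobius (D.doubleGlue (some (j, true))) z =
      mobius (D.glue 0)⁻¹ (mobius (D.glue j.succ) (mobius (D.glue 0) z)) := by
  rw [doubleGlue, ← mul_assoc, mobius_mul _ _ (D.glue_denom_ne_zero 0 hz),
    mobius_mul _ _ (D.glue_denom_ne_zero _ hz')]

/-- The side condition concerns every point outside a hole, including the pole of `D.glue 0`. There
the composition passes through infinity, which the next gluing map sends to its apex. -/
theorem mobius_doubleGlue_some_true_pole (j : Fin k) :
    mobius (D.doubleGlue (some (j, true))) (D.pole 0) =
      mobius (D.glue 0)⁻¹ (D.apex j.succ) := by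
  have h0 := D.glue_denom_pole 0
  have hn := numerator_ne_zero_of_pole (D.glue_det 0) h0
  rw [doubleGlue, mobius_mul, mobius_mul_of_pole _ _ (D.glue_det 0) h0, apex]
  simp only [Matrix.mul_apply, Fin.sum_univ_two]
  have : (D.glue j.succ 1 0 * D.glue 0 0 0 + D.glue j.succ 1 1 * D.glue 0 1 0) * D.pole 0 +
      (D.glue j.succ 1 0 * D.glue 0 0 1 + D.glue j.succ 1 1 * D.glue 0 1 1) =
      D.glue j.succ 1 0 * (D.glue 0 0 0 * D.pole 0 + D.glue 0 0 1) := by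
    linear_combination D.glue j.succ 1 1 * h0
  rw [this]
  exact mul_ne_zero (D.glue_one_zero_ne_zero _) hn

theorem ne_apex_zero_of_mem {i : Fin (k + 1) × Bool} (hi : i ≠ (0, true)) {w : ℂ}
    (hw : dist w (D.center (.inl i)) ≤ D.radius (.inl i)) : w ≠ D.apex 0 := by
  rintro rfl
  exact absurd (D.radius_lt_dist_apex hi) (not_lt.mpr hw)

theorem doubleGlue_circle (j) (z : ℂ)
    (hz : dist z (D.sheetC (doubleHole j false)) = D.sheetR (doubleHole j false)) :
    dist (mobius (D.doubleGlue j) z) (D.sheetC (doubleHole j true)) =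
      D.sheetR (doubleHole j true) := by
  rcases j with _ | ⟨j, _ | _⟩
  · have hzp : z ≠ D.pole 0 := by
      rintro rfl
      exact absurd hz (D.pullR_some_lt_dist_pole (by simp)).ne'
    rw [D.mobius_doubleGlue_none hzp]
    exact D.glue_circle 0 _ ((D.dist_pullC_some_eq_iff (by simp) hzp).mp hz)
  · exact D.glue_circle j.succ z hz
  · have hzp : z ≠ D.pole 0 := by
      rintro rfl
      exact absurd hz (D.pullR_some_lt_dist_pole (by simp)).ne'
    have h1 := (D.dist_pullC_some_eq_iff (by simp) hzp).mp hz
    have h2 := D.glue_circle j.succ _ h1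
    have h3 := D.ne_apex_zero_of_mem (by simp) h2.le
    rw [D.mobius_doubleGlue_some_true j hzp (D.ne_pole_of_radius_le _ h1.ge)]
    refine (D.dist_pullC_some_eq_iff (by simp) (D.mobius_inv_ne_pole h3)).mpr ?_
    rw [D.mobius_mobius_inv h3, h2]

theorem doubleGlue_side (j) (z : ℂ)
    (hz : D.sheetR (doubleHole j false) < dist z (D.sheetC (doubleHole j false))) :
    dist (mobius (D.doubleGlue j) z) (D.sheetC (doubleHole j true)) <
      D.sheetR (doubleHole j true) := by
  rcases j with _ | ⟨j, _ | _⟩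
  · by_cases hzp : z = D.pole 0
    · rw [hzp, doubleGlue, mobius_mul_of_pole _ _ (D.glue_det 0) (D.glue_denom_pole 0)]
      exact D.dist_apex_lt 0
    · rw [D.mobius_doubleGlue_none hzp]
      refine D.glue_side 0 _ ?_
      by_contra! hcon
      exact absurd ((D.dist_pullC_some_le_iff (by simp) hzp).mpr hcon) (not_le.mpr hz)
  · exact D.glue_side j.succ z hz
  · by_cases hzp : z = D.pole 0
    · have h2 := D.dist_apex_lt j.succ
      have h3 := D.ne_apex_zero_of_mem (by simp) h2.le
      rw [hzp, D.mobius_doubleGlue_some_true_pole]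
      refine (D.dist_pullC_some_lt_iff (by simp) (D.mobius_inv_ne_pole h3)).mpr ?_
      rw [D.mobius_mobius_inv h3]
      exact h2
    · have h1 : D.radius (.inl (j.succ, false)) <
          dist (mobius (D.glue 0) z) (D.center (.inl (j.succ, false))) := by
        by_contra! hcon
        exact absurd ((D.dist_pullC_some_le_iff (by simp) hzp).mpr hcon) (not_le.mpr hz)
      have h2 := D.glue_side j.succ _ h1
      have h3 := D.ne_apex_zero_of_mem (by simp) h2.le
      rw [D.mobius_doubleGlue_some_true j hzp (D.ne_pole_of_radius_le _ h1.le)]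
      refine (D.dist_pullC_some_lt_iff (by simp) (D.mobius_inv_ne_pole h3)).mpr ?_
      rw [D.mobius_mobius_inv h3]
      exact h2

/-- The doubled disc: two copies of the surface, cut along the seam of the first handle and glued
crosswise. -/
def double : HandleDisc (2 * k + 1) 1 where
  center i := D.sheetC (doubleSource i)
  radius i := D.sheetR (doubleSource i)
  radius_pos i := D.sheetR_pos (doubleSource_ne_second i)
  inside i := D.sheet_inside (doubleSource_ne_second i)
  disjoint i i' h := D.sheet_disjoint (doubleSource_ne_first i) (doubleSource_ne_first i')
    (doubleSource_ne_second i) (doubleSource_ne_second i') (doubleSource_injective.ne h)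
  glue j := D.doubleGlue (doubleIndex k j)
  glue_det _ := D.doubleGlue_det _
  glue_circle _ := D.doubleGlue_circle _
  glue_side _ := D.doubleGlue_side _

theorem double_domain_radius_le {z : ℂ} (hz : z ∈ D.double.domain) {i}
    (hi : i ≠ (0, false)) : D.radius (.inl i) ≤ dist z (D.center (.inl i)) := by
  obtain ⟨i', h⟩ := exists_doubleSource_inl hi
  have := hz.2 i'
  simp only [double, h] at this
  exact this

theorem double_domain_pullR_le {z : ℂ} (hz : z ∈ D.double.domain) {i}
    (hi : i ≠ (0, true)) : D.pullR (some i) ≤ dist z (D.pullC (some i)) := by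
  obtain ⟨i', h⟩ := exists_doubleSource_inr hi
  have := hz.2 i'
  simp only [double, h] at this
  exact this

theorem double_domain_pullR_none_le {z : ℂ} (hz : z ∈ D.double.domain) :
    D.pullR none ≤ dist z (D.pullC none) := hz.2 (.inr 0)

theorem ne_pole_of_mem_double {z : ℂ} (hz : z ∈ D.double.domain) : z ≠ D.pole 0 := by
  rintro rfl
  exact absurd (D.double_domain_pullR_none_le hz) (not_le.mpr D.dist_pole_pullC_none_lt)

/-- Outside of the first hole the doubled disc is the first copy. -/
theorem mem_domain_of_mem_double {z : ℂ} (hz : z ∈ D.double.domain)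
    (ha : D.radius (.inl (0, false)) ≤ dist z (D.center (.inl (0, false)))) : z ∈ D.domain := by
  refine ⟨hz.1, ?_⟩
  rintro (i | i)
  · by_cases hi : i = (0, false)
    · exact hi ▸ ha
    · exact D.double_domain_radius_le hz hi
  · exact i.elim0

/-- Inside of the first hole the doubled disc is the second copy. -/
theorem mobius_mem_domain_of_mem_double {z : ℂ} (hz : z ∈ D.double.domain)
    (ha : dist z (D.center (.inl (0, false))) ≤ D.radius (.inl (0, false))) :
    mobius (D.glue 0) z ∈ D.domain := by
  have hzp := D.ne_pole_of_mem_double hz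
  refine ⟨?_, ?_⟩
  · by_contra! hcon
    exact absurd (D.double_domain_pullR_none_le hz)
      (not_le.mpr ((D.dist_pullC_none_lt_iff hzp).mpr hcon))
  · rintro (i | i)
    · by_cases hi : i = (0, true)
      · by_contra! hcon
        rw [hi, D.dist_mobius_lt_iff 0 hzp] at hcon
        exact absurd ha (not_le.mpr hcon)
      · by_contra! hcon
        exact absurd (D.double_domain_pullR_le hz hi)
          (not_le.mpr ((D.dist_pullC_some_lt_iff hi hzp).mpr hcon))
    · exact i.elim0

end HandleDisc

end KnotCobordism

end

open scoped Manifold ContDiff Topology ComplexConjugate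

noncomputable section

namespace KnotCobordism

/-! ### Pushing a surface off itself -/

namespace HandleDisc

variable {g m : ℕ} (D : HandleDisc g m)

theorem Glued.eq_of_mem_core {D : HandleDisc g m} {z w : ℂ} (h : D.Glued z w) (hz : z ∈ D.core) :
    z = w := by
  rcases h with h | ⟨j, ⟨h, -⟩ | ⟨h, rfl⟩⟩
  · exact h
  · exact absurd h (hz.2 _).ne'
  · exact absurd (D.glue_circle j w h) (hz.2 _).ne'

theorem Glued.symm {D : HandleDisc g m} {z w : ℂ} (h : D.Glued z w) : D.Glued w z := by
  rcases h with h | ⟨j, h | h⟩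
  · exact Or.inl h.symm
  · exact Or.inr ⟨j, Or.inr h⟩
  · exact Or.inr ⟨j, Or.inl h⟩

/-- The unit normal of a surface in the sphere. -/
def unitNormal (φ : ℂ → E4) (z : ℂ) : E4 :=
  ‖cross (φ z) (fderiv ℝ φ z 1) (fderiv ℝ φ z Complex.I)‖⁻¹ •
    cross (φ z) (fderiv ℝ φ z 1) (fderiv ℝ φ z Complex.I)

theorem norm_unitNormal_le (φ : ℂ → E4) (z : ℂ) : ‖unitNormal φ z‖ ≤ 1 := by
  rw [unitNormal, norm_smul, norm_inv, norm_norm]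
  exact inv_mul_le_one

/-- The normal flow of a surface in the sphere. -/
def normalFlow (φ : ℂ → E4) (p : ℂ × ℝ) : E4 :=
  Real.cos p.2 • φ p.1 + Real.sin p.2 • unitNormal φ p.1

theorem normalFlow_zero (φ : ℂ → E4) (z : ℂ) : normalFlow φ (z, 0) = φ z := by
  simp [normalFlow]

section Flow

variable {D} {φ : ℂ → E4} (hφ : D.IsSmoothEmbedding φ)
  (hs : ∀ z ∈ D.domain, φ z ∈ Metric.sphere (0 : E4) 1)

include hφ hs

theorem cross_ne_zero_of_isSmoothEmbedding {z : ℂ} (hz : z ∈ D.domain) :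
    cross (φ z) (fderiv ℝ φ z 1) (fderiv ℝ φ z Complex.I) ≠ 0 := by
  refine cross_fderiv_ne_zero ?_ (hφ.immersion z hz)
    (D.inner_fderiv_eq_zero hz ((hφ.smooth z hz).differentiableAt (by simp)) hs)
  have := hs z hz
  intro h
  simp [h] at this

theorem contDiffAt_unitNormal {z : ℂ} (hz : z ∈ D.domain) :
    ContDiffAt ℝ ∞ (unitNormal φ) z := by
  have h1 := hφ.smooth z hz
  have h2 : ContDiffAt ℝ ∞ (fderiv ℝ φ) z := h1.fderiv_right (by simp)
  have h3 : ContDiffAt ℝ ∞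
      (fun z => cross (φ z) (fderiv ℝ φ z 1) (fderiv ℝ φ z Complex.I)) z :=
    contDiff_cross.contDiffAt.comp z (h1.prodMk
      ((h2.clm_apply contDiffAt_const).prodMk (h2.clm_apply contDiffAt_const)))
  have h0 := cross_ne_zero_of_isSmoothEmbedding hφ hs hz
  exact ((h3.norm ℝ h0).inv (norm_ne_zero_iff.mpr h0)).smul h3

theorem contDiffAt_normalFlow {z : ℂ} (hz : z ∈ D.domain) (s : ℝ) :
    ContDiffAt ℝ ∞ (normalFlow φ) (z, s) := by
  have h1 : ContDiffAt ℝ ∞ (fun p : ℂ × ℝ => φ p.1) (z, s) :=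
    (hφ.smooth z hz).comp (z, s) contDiffAt_fst
  have h2 : ContDiffAt ℝ ∞ (fun p : ℂ × ℝ => unitNormal φ p.1) (z, s) :=
    ContDiffAt.comp (g := unitNormal φ) (f := Prod.fst) (z, s)
      (contDiffAt_unitNormal hφ hs hz) contDiffAt_fst
  exact ((Real.contDiff_cos.contDiffAt.comp (z, s) contDiffAt_snd).smul h1).add
    ((Real.contDiff_sin.contDiffAt.comp (z, s) contDiffAt_snd).smul h2)

theorem norm_unitNormal {z : ℂ} (hz : z ∈ D.domain) : ‖unitNormal φ z‖ = 1 := by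
  rw [unitNormal, norm_smul, norm_inv, norm_norm]
  exact inv_mul_cancel₀ (norm_ne_zero_iff.mpr (cross_ne_zero_of_isSmoothEmbedding hφ hs hz))

/-- Position and normal are orthonormal, so the flow follows a great circle. -/
theorem norm_normalFlow {z : ℂ} (hz : z ∈ D.domain) (s : ℝ) : ‖normalFlow φ (z, s)‖ = 1 := by
  have h1 : ‖φ z‖ = 1 := by simpa using hs z hz
  have h2 := norm_unitNormal hφ hs hz
  have h3 : inner ℝ (φ z) (unitNormal φ z) = 0 := by
    rw [unitNormal, inner_smul_right, real_inner_comm, inner_cross_left, mul_zero]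
  have : ‖normalFlow φ (z, s)‖ ^ 2 = 1 := by
    simp only [normalFlow]
    rw [norm_add_sq_real, inner_smul_left, inner_smul_right, h3, norm_smul, norm_smul, h1, h2]
    simp
  exact (pow_eq_one_iff_of_nonneg (norm_nonneg _) two_ne_zero).mp this

omit hφ in
theorem dist_normalFlow_le {z : ℂ} (hz : z ∈ D.domain) (s : ℝ) :
    dist (normalFlow φ (z, s)) (φ z) ≤ |Real.cos s - 1| + |Real.sin s| := by
  have h1 : ‖φ z‖ = 1 := by simpa using hs z hz
  have h2 : normalFlow φ (z, s) - φ z =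
      (Real.cos s - 1) • φ z + Real.sin s • unitNormal φ z := by
    simp only [normalFlow, sub_smul, one_smul]; abel
  rw [dist_eq_norm, h2]
  refine (norm_add_le _ _).trans (add_le_add ?_ ?_)
  · rw [norm_smul, h1, mul_one, Real.norm_eq_abs]
  · rw [norm_smul, Real.norm_eq_abs]
    exact mul_le_of_le_one_right (abs_nonneg _) (norm_unitNormal_le φ z)

/-- At time zero the derivative is (ζ, σ) ↦ dφ(ζ) + σ n, with n a unit vector orthogonal to the
image of dφ. -/
theorem injective_fderiv_normalFlow {z : ℂ} (hz : z ∈ D.domain) :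
    Function.Injective (fderiv ℝ (normalFlow φ) (z, 0)) := by
  have h1 : HasFDerivAt (fun p : ℂ × ℝ => φ p.1)
      ((fderiv ℝ φ z).comp (ContinuousLinearMap.fst ℝ ℂ ℝ)) (z, (0 : ℝ)) :=
    HasFDerivAt.comp (z, (0 : ℝ)) ((hφ.smooth z hz).differentiableAt (by simp)).hasFDerivAt
      hasFDerivAt_fst
  have h2 : HasFDerivAt (fun p : ℂ × ℝ => unitNormal φ p.1)
      ((fderiv ℝ (unitNormal φ) z).comp (ContinuousLinearMap.fst ℝ ℂ ℝ)) (z, (0 : ℝ)) :=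
    HasFDerivAt.comp (g := unitNormal φ) (f := Prod.fst) (z, (0 : ℝ))
      ((contDiffAt_unitNormal hφ hs hz).differentiableAt (by simp)).hasFDerivAt hasFDerivAt_fst
  have h3 := (hasFDerivAt_snd (𝕜 := ℝ) (E := ℂ) (F := ℝ) (p := (z, (0 : ℝ)))).cos
  have h4 := (hasFDerivAt_snd (𝕜 := ℝ) (E := ℂ) (F := ℝ) (p := (z, (0 : ℝ)))).sin
  have h5 := (h3.smul h1).add (h4.smul h2)
  have h6 : ∀ v, fderiv ℝ (normalFlow φ) (z, 0) v =
      fderiv ℝ φ z v.1 + v.2 • unitNormal φ z := by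
    intro v
    have : fderiv ℝ (normalFlow φ) (z, 0) = _ := h5.fderiv
    rw [this]
    simp
  rw [injective_iff_map_eq_zero]
  rintro ⟨ζ, σ⟩ h
  rw [h6] at h
  simp only at h
  have h7 : inner ℝ (unitNormal φ z) (fderiv ℝ φ z ζ) = 0 := by
    rw [unitNormal, inner_smul_left, inner_cross_fderiv, mul_zero]
  have h8 := congrArg (inner ℝ (unitNormal φ z)) h
  rw [inner_add_right, h7, inner_smul_right, real_inner_self_eq_norm_sq,
    norm_unitNormal hφ hs hz] at h8
  have h9 : σ = 0 := by simpa using h8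
  rw [h9, zero_smul, add_zero] at h
  have h10 := hφ.immersion z hz (h.trans (map_zero _).symm)
  rw [h9, h10]; rfl

theorem eventually_immersion_normalFlow {B : Set ℂ} (hB : IsCompact B) (hBD : B ⊆ D.core) :
    ∀ᶠ s in 𝓝 (0 : ℝ), ∀ z ∈ B, Function.Injective (fderiv ℝ (normalFlow φ) (z, s)) := by
  refine hB.eventually_forall_of_forall_eventually fun z hz => ?_
  have hz' := D.core_subset_domain (hBD hz)
  have h := eventually_injective_fderiv (contDiffAt_normalFlow hφ hs hz' 0)
    (injective_fderiv_normalFlow hφ hs hz')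
  exact (continuous_swap.tendsto ((0 : ℝ), z)).eventually h

/-- By compactness it suffices to work near one pair of points. If their images differ, small times
keep them apart. If they coincide in B, the normal flow is locally injective there. If they are
glued and off B, the times vanish nearby and the original embedding decides. Two independent times
allow both self-intersections of the pushed surface and its intersections with the original to be
treated. -/
theorem eventually_injective_normalFlow {B : Set ℂ} (hB : IsCompact B) (hBD : B ⊆ D.core) :
    ∀ᶠ s in 𝓝 ((0 : ℝ), (0 : ℝ)), ∀ z ∈ D.domain ×ˢ D.domain, z.1 ∈ D.domain →
      z.2 ∈ D.domain → (s.1 ≠ 0 → z.1 ∈ B) → (s.2 ≠ 0 → z.2 ∈ B) → normalFlow φ (z.1, s.1) = normalFlow φ (z.2, s.2) →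
      D.Glued z.1 z.2 ∧ s.1 = s.2 := by
  refine (D.isCompact_domain.prod D.isCompact_domain).eventually_forall_of_forall_eventually ?_
  rintro ⟨z₀, w₀⟩ ⟨hz₀, hw₀⟩
  simp only at hz₀ hw₀
  by_cases heq : φ z₀ = φ w₀
  · have hgl := (hφ.eq_iff z₀ hz₀ w₀ hw₀).mp heq
    by_cases hB0 : z₀ ∈ B
    · obtain rfl := hgl.eq_of_mem_core (hBD hB0)
      obtain ⟨U, hU, hinj⟩ := exists_injOn_of_hasStrictFDerivAt
        ((contDiffAt_normalFlow hφ hs hz₀ 0).hasStrictFDerivAt (by simp))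
        (injective_fderiv_normalFlow hφ hs hz₀)
      have h1 : ∀ᶠ p : (ℝ × ℝ) × (ℂ × ℂ) in 𝓝 (((0 : ℝ), (0 : ℝ)), (z₀, z₀)),
          (p.2.1, p.1.1) ∈ U :=
        (Continuous.tendsto (by fun_prop : Continuous
          fun p : (ℝ × ℝ) × (ℂ × ℂ) => (p.2.1, p.1.1)) _).eventually hU
      have h2 : ∀ᶠ p : (ℝ × ℝ) × (ℂ × ℂ) in 𝓝 (((0 : ℝ), (0 : ℝ)), (z₀, z₀)),
          (p.2.2, p.1.2) ∈ U :=
        (Continuous.tendsto (by fun_prop : Continuous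
          fun p : (ℝ × ℝ) × (ℂ × ℂ) => (p.2.2, p.1.2)) _).eventually hU
      filter_upwards [h1, h2] with p hp1 hp2 _ _ _ _ h
      have := hinj hp1 hp2 h
      rw [Prod.mk.injEq] at this
      exact ⟨Or.inl this.1, this.2⟩
    · have hB1 : w₀ ∉ B := by
        intro h
        obtain rfl := hgl.symm.eq_of_mem_core (hBD h)
        exact hB0 h
      have h0 : ∀ᶠ p : (ℝ × ℝ) × (ℂ × ℂ) in 𝓝 (((0 : ℝ), (0 : ℝ)), (z₀, w₀)), p.2.1 ∉ B :=
        (Continuous.tendsto (by fun_prop : Continuous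
          fun p : (ℝ × ℝ) × (ℂ × ℂ) => p.2.1) (((0 : ℝ), (0 : ℝ)), (z₀, w₀))).eventually 
            (hB.isClosed.isOpen_compl.mem_nhds (show z₀ ∈ Bᶜ from hB0))
      have h1 : ∀ᶠ p : (ℝ × ℝ) × (ℂ × ℂ) in 𝓝 (((0 : ℝ), (0 : ℝ)), (z₀, w₀)), p.2.2 ∉ B :=
        (Continuous.tendsto (by fun_prop : Continuous
          fun p : (ℝ × ℝ) × (ℂ × ℂ) => p.2.2) (((0 : ℝ), (0 : ℝ)), (z₀, w₀))).eventually 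
            (hB.isClosed.isOpen_compl.mem_nhds (show w₀ ∈ Bᶜ from hB1))
      filter_upwards [h0, h1] with p hp0 hp1 hd1 hd2 hs1 hs2 h
      have e1 : p.1.1 = 0 := by by_contra hne; exact hp0 (hs1 hne)
      have e2 : p.1.2 = 0 := by by_contra hne; exact hp1 (hs2 hne)
      rw [e1, e2, normalFlow_zero, normalFlow_zero] at h
      exact ⟨(hφ.eq_iff _ hd1 _ hd2).mp h, e1.trans e2.symm⟩
  · set η := dist (φ z₀) (φ w₀) with hη
    have hηp : 0 < η := dist_pos.mpr heq
    have hc : ContinuousAt (fun p : (ℝ × ℝ) × (ℂ × ℂ) => dist (φ p.2.1) (φ p.2.2))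
        (((0 : ℝ), (0 : ℝ)), (z₀, w₀)) := by
      refine Filter.Tendsto.dist ?_ ?_
      · exact ContinuousAt.comp (g := φ) (f := fun p : (ℝ × ℝ) × (ℂ × ℂ) => p.2.1)
          (hφ.smooth z₀ hz₀).continuousAt (by fun_prop)
      · exact ContinuousAt.comp (g := φ) (f := fun p : (ℝ × ℝ) × (ℂ × ℂ) => p.2.2)
          (hφ.smooth w₀ hw₀).continuousAt (by fun_prop)
    have h1 : ∀ᶠ p : (ℝ × ℝ) × (ℂ × ℂ) in 𝓝 (((0 : ℝ), (0 : ℝ)), (z₀, w₀)),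
        η / 2 < dist (φ p.2.1) (φ p.2.2) := hc.eventually (lt_mem_nhds (by simp [← hη]; linarith))
    have hc2 : Continuous fun p : (ℝ × ℝ) × (ℂ × ℂ) =>
        |Real.cos p.1.1 - 1| + |Real.sin p.1.1| + (|Real.cos p.1.2 - 1| + |Real.sin p.1.2|) := by
      fun_prop
    have h2 : ∀ᶠ p : (ℝ × ℝ) × (ℂ × ℂ) in 𝓝 (((0 : ℝ), (0 : ℝ)), (z₀, w₀)),
        |Real.cos p.1.1 - 1| + |Real.sin p.1.1| + (|Real.cos p.1.2 - 1| + |Real.sin p.1.2|) <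
          η / 2 := hc2.continuousAt.eventually (gt_mem_nhds (by simpa using hηp))
    filter_upwards [h1, h2] with p hp1 hp2 hd1 hd2 _ _ h
    exfalso
    have e1 := dist_normalFlow_le hs hd1 p.1.1
    have e2 := dist_normalFlow_le hs hd2 p.1.2
    rw [h] at e1
    have := dist_triangle_left (φ p.2.1) (φ p.2.2) (normalFlow φ (p.2.2, p.1.2))
    linarith

/-- A surface in the sphere can be pushed off itself in the normal direction, near a compact set of
interior points. -/
theorem exists_push {B : Set ℂ} (hB : IsCompact B) (hBD : B ⊆ D.core) {b : ℂ → ℝ}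
    (hb : ContDiff ℝ ∞ b) (hb1 : ∀ z, |b z| ≤ 1) (hb0 : ∀ z, z ∉ B → b z = 0) :
    ∃ φ₁ : ℂ → E4, (∀ z ∈ D.domain, ContDiffAt ℝ ∞ φ₁ z) ∧
      (∀ z ∈ D.domain, Function.Injective (fderiv ℝ φ₁ z)) ∧
      (∀ z ∈ D.domain, φ₁ z ∈ Metric.sphere (0 : E4) 1) ∧
      (∀ z, z ∉ B → φ₁ z = φ z) ∧
      (∀ z ∈ D.domain, ∀ w ∈ D.domain, φ₁ z = φ₁ w → D.Glued z w) ∧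
      (∀ z ∈ D.domain, ∀ w ∈ D.domain, φ₁ z = φ w → D.Glued z w ∧ b z = 0) := by
  obtain ⟨ε₁, hε₁, h1⟩ := Metric.eventually_nhds_iff.mp
    (eventually_immersion_normalFlow hφ hs hB hBD)
  obtain ⟨ε₂, hε₂, h2⟩ := Metric.eventually_nhds_iff.mp
    (eventually_injective_normalFlow hφ hs hB hBD)
  set ε := min ε₁ ε₂ / 2 with hε
  have hεp : 0 < ε := half_pos (lt_min hε₁ hε₂)
  have hεl : ε < min ε₁ ε₂ := half_lt_self (lt_min hε₁ hε₂)
  have hsmall : ∀ z, |ε * b z| < min ε₁ ε₂ := by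
    intro z
    rw [abs_mul, abs_of_pos hεp]
    exact lt_of_le_of_lt (mul_le_of_le_one_right hεp.le (hb1 z)) hεl
  have hoff : ∀ z, z ∉ B → normalFlow φ (z, ε * b z) = φ z := by
    intro z hz
    rw [hb0 z hz, mul_zero, normalFlow_zero]
  have hmem : ∀ z, ε * b z ≠ 0 → z ∈ B := by
    intro z hz
    by_contra hcon
    exact hz (by rw [hb0 z hcon, mul_zero])
  have hgraph : ContDiff ℝ ∞ fun z => (z, ε * b z) := contDiff_id.prodMk (contDiff_const.mul hb)
  refine ⟨fun z => normalFlow φ (z, ε * b z), fun z hz => ?_, fun z hz => ?_, fun z hz => ?_,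
    hoff, fun z hz w hw h => ?_, fun z hz w hw h => ?_⟩
  · exact ContDiffAt.comp (g := normalFlow φ) (f := fun z => (z, ε * b z)) z
      (contDiffAt_normalFlow hφ hs hz _) hgraph.contDiffAt
  · by_cases hzB : z ∈ B
    · have h3 : DifferentiableAt ℝ (normalFlow φ) (z, ε * b z) :=
        (contDiffAt_normalFlow hφ hs hz _).differentiableAt (by simp)
      have hbd : HasFDerivAt (fun z => ε * b z) (fderiv ℝ (fun z => ε * b z) z) z :=
        ((contDiff_const.mul hb).differentiable (by simp) z).hasFDerivAt
      have h4 := h3.hasFDerivAt.comp z ((hasFDerivAt_id z).prodMk hbd)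
      have h5 : fderiv ℝ (fun z => normalFlow φ (z, ε * b z)) z = _ := h4.fderiv
      rw [h5]
      have h6 := h1 (y := ε * b z)
        (by simpa using (hsmall z).trans_le (min_le_left _ _)) z hzB
      intro x y hxy
      have := h6 hxy
      simpa using congrArg Prod.fst this
    · have : (fun z => normalFlow φ (z, ε * b z)) =ᶠ[𝓝 z] φ := by
        filter_upwards [hB.isClosed.isOpen_compl.mem_nhds (show z ∈ Bᶜ from hzB)] with y hy
          using hoff y hy
      rw [this.fderiv_eq]
      exact hφ.immersion z hz
  · simpa using norm_normalFlow hφ hs hz _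
  · refine (h2 (y := (ε * b z, ε * b w)) ?_ (z, w) ⟨hz, hw⟩ hz hw (hmem z) (hmem w) h).1
    rw [Prod.dist_eq]
    exact max_lt (by simpa using (hsmall z).trans_le (min_le_right _ _))
      (by simpa using (hsmall w).trans_le (min_le_right _ _))
  -- Second time zero means the unpushed surface; equality of the two times then forces the push at
  -- z to vanish.
  · have h3 := h2 (y := (ε * b z, 0)) (by
      rw [Prod.dist_eq]
      exact max_lt (by simpa using (hsmall z).trans_le (min_le_right _ _)) (by simpa using hε₂))
      (z, w) ⟨hz, hw⟩ hz hw (hmem z) (by simp) (by simpa [normalFlow_zero] using h)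
    exact ⟨h3.1, (mul_eq_zero.mp h3.2).resolve_left hεp.ne'⟩

end Flow

end HandleDisc

end KnotCobordism

end

open scoped Manifold ContDiff Topology ComplexConjugate

noncomputable section

namespace KnotCobordism

/-! ### Reparametrizing a collar of the unit circle -/

/-- The automorphism of the unit disc that moves `0` to `a`. -/
def discMap (a u : ℂ) : ℂ := (u + a) / (1 + conj a * u)

theorem discMap_denom_ne_zero {a u : ℂ} (ha : ‖a‖ < 1) (hu : ‖u‖ = 1) : 1 + conj a * u ≠ 0 := by
  intro h
  have : ‖conj a * u‖ = 1 := by rw [← norm_neg, ← eq_neg_of_add_eq_zero_left h, norm_one]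
  rw [norm_mul, RCLike.norm_conj, hu, mul_one] at this
  exact ha.ne this

/-- On the unit circle the denominator equals conj(u + a) u, so it has the same modulus as the
numerator. -/
theorem norm_discMap {a u : ℂ} (ha : ‖a‖ < 1) (hu : ‖u‖ = 1) : ‖discMap a u‖ = 1 := by
  have hd := discMap_denom_ne_zero ha hu
  have hu' : conj u * u = 1 := by rw [mul_comm, Complex.mul_conj, Complex.normSq_eq_norm_sq, hu]; simp
  have h : 1 + conj a * u = conj (u + a) * u := by rw [map_add, add_mul, hu']
  rw [discMap, norm_div]
  have h2 : ‖1 + conj a * u‖ = ‖u + a‖ := by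
    rw [h, norm_mul, RCLike.norm_conj, hu, mul_one]
  rw [h2]
  exact div_self (by rw [← h2]; exact norm_ne_zero_iff.mpr hd)

theorem discMap_neg_discMap {a u : ℂ} (ha : ‖a‖ < 1) (hu : ‖u‖ = 1) :
    discMap a (discMap (-a) u) = u := by
  have hd := discMap_denom_ne_zero (a := -a) (by simpa using ha) hu
  have hd2 := discMap_denom_ne_zero (u := discMap (-a) u) ha (norm_discMap (by simpa using ha) hu)
  have ha2 : 1 - conj a * a ≠ 0 := by
    rw [mul_comm, Complex.mul_conj, Complex.normSq_eq_norm_sq]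
    intro h
    have : (1 : ℝ) - ‖a‖ ^ 2 = 0 := by exact_mod_cast h
    nlinarith [norm_nonneg a]
  rw [map_neg] at hd
  rw [discMap, div_eq_iff hd2, discMap, map_neg, mul_add, mul_one, mul_div_assoc', mul_div_assoc',
    div_add' _ _ _ hd, add_div' _ _ _ hd]
  congr 1
  ring

theorem contDiffAt_discMap {a u : ℂ → ℂ} {w : ℂ} (ha : ContDiffAt ℝ ∞ a w)
    (hu : ContDiffAt ℝ ∞ u w) (h : 1 + conj (a w) * u w ≠ 0) :
    ContDiffAt ℝ ∞ (fun w => discMap (a w) (u w)) w := by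
  have hc : ContDiffAt ℝ ∞ (fun w => conj (a w)) w :=
    Complex.conjCLE.contDiff.contDiffAt.comp w ha
  have h1 := (hu.add ha).mul ((contDiffAt_const (c := (1 : ℂ)).add (hc.mul hu)).inv h)
  exact h1.congr_of_eventuallyEq (.of_forall fun w => div_eq_mul_inv _ _)

/-- The smooth function of `‖w‖` that grows from `0` for `‖w‖ ^ 2 ≤ 1 - x` to `1` for
`‖w‖ = 1`. -/
def collar (x : ℝ) (w : ℂ) : ℝ := Real.smoothTransition ((‖w‖ ^ 2 - (1 - x)) / x)

theorem contDiff_collar (x : ℝ) : ContDiff ℝ ∞ (collar x) :=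
  Real.smoothTransition.contDiff.comp
    (((contDiff_norm_sq ℝ).sub contDiff_const).div_const x)

theorem collar_eq_zero {x : ℝ} (hx : 0 < x) {w : ℂ} (hw : ‖w‖ ^ 2 ≤ 1 - x) : collar x w = 0 :=
  Real.smoothTransition.zero_of_nonpos (div_nonpos_of_nonpos_of_nonneg (by linarith) hx.le)

theorem collar_eq_one {x : ℝ} (hx : 0 < x) {w : ℂ} (hw : ‖w‖ = 1) : collar x w = 1 :=
  Real.smoothTransition.one_of_one_le (by rw [hw, one_pow, sub_sub_cancel, div_self hx.ne'])

theorem norm_collar_mul_lt (x : ℝ) {q : ℂ} (hq : ‖q‖ < 1) (w : ℂ) :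
    ‖(collar x w : ℂ) * q‖ < 1 := by
  rw [norm_mul, Complex.norm_real, Real.norm_eq_abs,
    abs_of_nonneg (show 0 ≤ collar x w from Real.smoothTransition.nonneg _)]
  exact lt_of_le_of_lt (mul_le_of_le_one_left (norm_nonneg _) (Real.smoothTransition.le_one _)) hq

/-- A map that preserves the norm, is the identity away from the unit circle and the rotated disc
automorphism `e ^ (iθ) discMap (-q)` on it. -/
def collarMap (x : ℝ) (q : ℂ) (θ : ℝ) (w : ℂ) : ℂ :=
  ‖w‖ * (Complex.exp ((collar x w * θ : ℝ) * Complex.I) *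
    discMap (-(collar x w * q)) (w / ‖w‖))

/-- The inverse of `collarMap`. -/
def collarInv (x : ℝ) (q : ℂ) (θ : ℝ) (w : ℂ) : ℂ :=
  ‖w‖ * discMap (collar x w * q) (Complex.exp ((-(collar x w * θ) : ℝ) * Complex.I) * (w / ‖w‖))

section Collar

variable {x : ℝ} {q : ℂ} {θ : ℝ}

theorem norm_div_norm {w : ℂ} (hw : w ≠ 0) : ‖w / (‖w‖ : ℂ)‖ = 1 := by
  rw [norm_div, Complex.norm_real, norm_norm, div_self (norm_ne_zero_iff.mpr hw)]

theorem discMap_zero (u : ℂ) : discMap 0 u = u := by simp [discMap]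

theorem mul_div_norm (w : ℂ) : (‖w‖ : ℂ) * (w / ‖w‖) = w := by
  by_cases hw : w = 0
  · simp [hw]
  · exact mul_div_cancel₀ _ (by simpa using hw)

theorem norm_collarMap (hq : ‖q‖ < 1) (w : ℂ) : ‖collarMap x q θ w‖ = ‖w‖ := by
  by_cases hw : w = 0
  · simp [collarMap, hw]
  · rw [collarMap, norm_mul, norm_mul, Complex.norm_exp_ofReal_mul_I,
      norm_discMap (by rw [norm_neg]; exact norm_collar_mul_lt x hq w) (norm_div_norm hw),
      Complex.norm_real, norm_norm, mul_one, mul_one]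

theorem collarMap_eq_self (hx : 0 < x) {w : ℂ} (hw : ‖w‖ ^ 2 ≤ 1 - x) :
    collarMap x q θ w = w := by
  simp [collarMap, collar_eq_zero hx hw, discMap_zero, mul_div_norm]

theorem collarInv_eq_self (hx : 0 < x) {w : ℂ} (hw : ‖w‖ ^ 2 ≤ 1 - x) :
    collarInv x q θ w = w := by
  simp [collarInv, collar_eq_zero hx hw, discMap_zero, mul_div_norm]

theorem collarMap_of_norm_eq_one (hx : 0 < x) {w : ℂ} (hw : ‖w‖ = 1) :
    collarMap x q θ w = Complex.exp (θ * Complex.I) * discMap (-q) w := by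
  simp [collarMap, collar_eq_one hx hw, hw]

/-- The collar function depends only on the norm, which the map preserves. On each circle about the
origin its parameters are therefore constant, and a rotated disc automorphism is inverted there. -/
theorem collarInv_collarMap (hq : ‖q‖ < 1) (w : ℂ) :
    collarInv x q θ (collarMap x q θ w) = w := by
  have hn := norm_collarMap (x := x) (θ := θ) hq w
  have hc : collar x (collarMap x q θ w) = collar x w := by simp only [collar, hn]
  by_cases hw : w = 0
  · simp [collarInv, collarMap, hw]
  have hw' : (‖w‖ : ℂ) ≠ 0 := by simpa using hw
  rw [collarInv, hc, hn]
  conv_lhs => rw [collarMap]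
  rw [mul_div_cancel_left₀ _ hw', ← mul_assoc, ← Complex.exp_add]
  have : ((-(collar x w * θ) : ℝ) : ℂ) * Complex.I + ((collar x w * θ : ℝ) : ℂ) * Complex.I = 0 := by
    push_cast; ring
  rw [this, Complex.exp_zero, one_mul,
    discMap_neg_discMap (norm_collar_mul_lt x hq w) (norm_div_norm hw), mul_div_norm]

theorem contDiffAt_ofReal_norm {w : ℂ} (hw : w ≠ 0) :
    ContDiffAt ℝ ∞ (fun w : ℂ => (‖w‖ : ℂ)) w :=
  Complex.ofRealCLM.contDiff.contDiffAt.comp w (contDiffAt_norm ℝ hw)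

theorem contDiffAt_div_norm {w : ℂ} (hw : w ≠ 0) :
    ContDiffAt ℝ ∞ (fun w : ℂ => w / (‖w‖ : ℂ)) w := by
  have h := contDiffAt_id.mul ((contDiffAt_ofReal_norm hw).inv (by simpa using hw))
  exact h.congr_of_eventuallyEq (.of_forall fun w => div_eq_mul_inv _ _)

theorem contDiff_ofReal_comp {f : ℂ → ℝ} (hf : ContDiff ℝ ∞ f) :
    ContDiff ℝ ∞ fun w => (f w : ℂ) :=
  Complex.ofRealCLM.contDiff.comp hf

theorem contDiff_exp_mul_I {f : ℂ → ℝ} (hf : ContDiff ℝ ∞ f) :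
    ContDiff ℝ ∞ fun w => Complex.exp (f w * Complex.I) :=
  (Complex.contDiff_exp (𝕜 := ℝ)).comp ((contDiff_ofReal_comp hf).mul contDiff_const)

theorem eventually_norm_sq_le (hx1 : x < 1) : ∀ᶠ w : ℂ in 𝓝 0, ‖w‖ ^ 2 ≤ 1 - x := by
  have : Continuous fun w : ℂ => ‖w‖ ^ 2 := by fun_prop
  exact (this.tendsto 0).eventually (Iic_mem_nhds (by simpa using hx1))

/-- The norm is not smooth at the origin, but the map is the identity near it. -/
theorem contDiff_collarMap (hx : 0 < x) (hx1 : x < 1) (hq : ‖q‖ < 1) :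
    ContDiff ℝ ∞ (collarMap x q θ) := by
  rw [contDiff_iff_contDiffAt]
  intro w
  by_cases hw : w = 0
  · subst hw
    refine contDiffAt_id.congr_of_eventuallyEq ?_
    filter_upwards [eventually_norm_sq_le hx1] with y hy using collarMap_eq_self hx hy
  · have h1 := contDiff_collar x
    have h2 : ContDiff ℝ ∞ fun w => -((collar x w : ℂ) * q) :=
      ((contDiff_ofReal_comp h1).mul contDiff_const).neg
    exact (contDiffAt_ofReal_norm hw).mul
      ((contDiff_exp_mul_I (h1.mul contDiff_const)).contDiffAt.mul
        (contDiffAt_discMap h2.contDiffAt (contDiffAt_div_norm hw)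
          (discMap_denom_ne_zero (by rw [norm_neg]; exact norm_collar_mul_lt x hq w)
            (norm_div_norm hw))))

theorem contDiff_collarInv (hx : 0 < x) (hx1 : x < 1) (hq : ‖q‖ < 1) :
    ContDiff ℝ ∞ (collarInv x q θ) := by
  rw [contDiff_iff_contDiffAt]
  intro w
  by_cases hw : w = 0
  · subst hw
    refine contDiffAt_id.congr_of_eventuallyEq ?_
    filter_upwards [eventually_norm_sq_le hx1] with y hy using collarInv_eq_self hx hy
  · have h1 := contDiff_collar x
    have h2 : ContDiff ℝ ∞ fun w => (collar x w : ℂ) * q :=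
      (contDiff_ofReal_comp h1).mul contDiff_const
    exact (contDiffAt_ofReal_norm hw).mul
      (contDiffAt_discMap h2.contDiffAt
        ((contDiff_exp_mul_I (h1.mul contDiff_const).neg).contDiffAt.mul (contDiffAt_div_norm hw))
          (discMap_denom_ne_zero (norm_collar_mul_lt x hq w)
            (by rw [norm_mul, Complex.norm_exp_ofReal_mul_I, one_mul, norm_div_norm hw])))

theorem injective_collarMap (hq : ‖q‖ < 1) : Function.Injective (collarMap x q θ) :=
  Function.LeftInverse.injective (collarInv_collarMap hq)

theorem injective_fderiv_of_leftInverse {f f' : ℂ → ℂ} (hf : Differentiable ℝ f)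
    (hf' : Differentiable ℝ f') (h : ∀ w, f' (f w) = w) (w : ℂ) :
    Function.Injective (fderiv ℝ f w) := by
  have h1 : f' ∘ f = id := funext h
  have h3 := fderiv_comp w (hf' (f w)) (hf w)
  rw [h1, fderiv_id] at h3
  intro x y hxy
  have e := fun x => DFunLike.congr_fun h3 x
  exact (e x).trans ((congrArg (fderiv ℝ f' (f w)) hxy).trans (e y).symm)

theorem injective_fderiv_collarMap (hx : 0 < x) (hx1 : x < 1) (hq : ‖q‖ < 1) (w : ℂ) :
    Function.Injective (fderiv ℝ (collarMap x q θ) w) :=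
  injective_fderiv_of_leftInverse ((contDiff_collarMap hx hx1 hq).differentiable (by simp))
    ((contDiff_collarInv hx hx1 hq).differentiable (by simp)) (collarInv_collarMap hq) w

end Collar

/-! ### The height function -/

/-- `1 - ‖z‖ ^ 2` near the unit circle and outside of it, and `1 / 4` well inside of it. -/
def baseHeight (x : ℝ) (z : ℂ) : ℝ :=
  (1 - ‖z‖ ^ 2) + Real.smoothTransition ((1 - ‖z‖ ^ 2) / x) * (1 / 4 - (1 - ‖z‖ ^ 2))

theorem contDiff_baseHeight (x : ℝ) : ContDiff ℝ ∞ (baseHeight x) := by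
  have h : ContDiff ℝ ∞ fun z : ℂ => 1 - ‖z‖ ^ 2 := contDiff_const.sub (contDiff_norm_sq ℝ)
  exact h.add ((Real.smoothTransition.contDiff.comp (h.div_const x)).mul (contDiff_const.sub h))

theorem baseHeight_of_one_le {x : ℝ} (hx : 0 < x) {z : ℂ} (hz : 1 ≤ ‖z‖) :
    baseHeight x z = 1 - ‖z‖ ^ 2 := by
  rw [baseHeight, Real.smoothTransition.zero_of_nonpos, zero_mul, add_zero]
  exact div_nonpos_of_nonpos_of_nonneg (by nlinarith) hx.le

theorem baseHeight_of_le {x : ℝ} (hx : 0 < x) {z : ℂ} (hz : ‖z‖ ^ 2 ≤ 1 - x) :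
    baseHeight x z = 1 / 4 := by
  rw [baseHeight, Real.smoothTransition.one_of_one_le]
  · ring
  · rw [le_div_iff₀ hx]; linarith

/-- In the collar the value is a convex combination of `1 - ‖z‖ ^ 2`, which is less than x ≤ 1/4,
and of 1/4. -/
theorem baseHeight_mem {x : ℝ} (hx : 0 < x) (hx1 : x ≤ 1 / 4) {z : ℂ} (hz : ‖z‖ < 1) :
    0 < baseHeight x z ∧ baseHeight x z ≤ 1 / 4 := by
  by_cases h : ‖z‖ ^ 2 ≤ 1 - x
  · rw [baseHeight_of_le hx h]; norm_num
  · push Not at h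
    have h0 : 0 < 1 - ‖z‖ ^ 2 := by nlinarith [norm_nonneg z]
    have h1 := Real.smoothTransition.nonneg ((1 - ‖z‖ ^ 2) / x)
    have h2 := Real.smoothTransition.le_one ((1 - ‖z‖ ^ 2) / x)
    rw [baseHeight]
    constructor
    · nlinarith
    · nlinarith

namespace HandleDisc

variable {k : ℕ} (D : HandleDisc (k + 1) 0)

/-- The data of a height function on a Seifert surface, and of a bump function that is positive
where the height is `1 / 2`. -/
structure Height where
  x : ℝ
  x_pos : 0 < x
  x_lt_one : x < 1
  hole_lt : ∀ i z, dist z (D.center i) ≤ D.radius i → ‖z‖ ^ 2 < 1 - x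
  h : ℂ → ℝ
  smooth : ContDiff ℝ ∞ h
  -- The values beyond the unit circle give transversality at the end and show that the extended
  -- surface leaves the slab there.
  outside : ∀ z, 1 ≤ ‖z‖ → h z = 1 - ‖z‖ ^ 2
  mem_Ioo : ∀ z, ‖z‖ < 1 → h z ∈ Set.Ioo 0 1
  -- The height is thereby unchanged by the norm-preserving reparametrization of the collar.
  radial : ∀ z w, ‖z‖ = ‖w‖ → 1 - x ≤ ‖z‖ ^ 2 → h z = h w
  -- The values 1/4 and 3/4 are exchanged by t ↦ 1 - t, as the crosswise gluing demands. Constancy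
  -- near the circles makes the two sheets agree on a neighbourhood of each seam.
  near_hole : ∀ i, i ≠ .inl (0, true) → ∀ z, dist z (D.center i) = D.radius i →
    ∀ᶠ w in 𝓝 z, h w = 1 / 4
  near_last : ∀ z, dist z (D.center (.inl (0, true))) = D.radius (.inl (0, true)) →
    ∀ᶠ w in 𝓝 z, h w = 3 / 4
  B : Set ℂ
  isCompact_B : IsCompact B
  B_subset : B ⊆ D.core
  b : ℂ → ℝ
  smooth_b : ContDiff ℝ ∞ b
  abs_b_le : ∀ z, |b z| ≤ 1
  b_off : ∀ z, z ∉ B → b z = 0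
  -- The heights h and 1 - h agree exactly where h = 1/2, so this is where the sheets have to be
  -- separated.
  b_ne_zero : ∀ z, ‖z‖ ≤ 1 → h z = 1 / 2 → b z ≠ 0

/-- The annulus around the second hole of the first handle is where the height climbs from 1/4 to
3/4. -/
theorem exists_annulus : ∃ η > 0, (∀ i, i ≠ .inl (0, true) →
      D.radius i + (D.radius (.inl (0, true)) + η) < dist (D.center i) (D.center (.inl (0, true))))
      ∧ ‖D.center (.inl (0, true))‖ + (D.radius (.inl (0, true)) + η) < 1 := by
  set i₀ : (Fin (k + 1) × Bool) ⊕ Fin 0 := .inl (0, true)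
  have h1 : ∀ᶠ η in 𝓝[>] (0 : ℝ), ∀ i, i ≠ i₀ →
      D.radius i + (D.radius i₀ + η) < dist (D.center i) (D.center i₀) := by
    rw [Filter.eventually_all]
    intro i
    by_cases hi : i = i₀
    · simp [hi]
    · have hc : Continuous fun η : ℝ => D.radius i + (D.radius i₀ + η) := by fun_prop
      have := (hc.tendsto 0).eventually (gt_mem_nhds
        (by rw [add_zero]; exact D.disjoint i i₀ hi))
      filter_upwards [nhdsWithin_le_nhds this] with η hη _ using hη
  have h2 : ∀ᶠ η in 𝓝[>] (0 : ℝ), ‖D.center i₀‖ + (D.radius i₀ + η) < 1 := by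
    have hc : Continuous fun η : ℝ => ‖D.center i₀‖ + (D.radius i₀ + η) := by fun_prop
    have := (hc.tendsto 0).eventually (gt_mem_nhds
        (by rw [add_zero]; exact D.inside i₀))
    exact nhdsWithin_le_nhds this
  obtain ⟨η, h3, h4, h5⟩ := (eventually_mem_nhdsWithin.and (h1.and h2)).exists
  exact ⟨η, h3, h4, h5⟩

theorem exists_collar_width {ι : Type*} [Finite ι] {R : ι → ℝ} (hR0 : ∀ i, 0 ≤ R i)
    (hR : ∀ i, R i < 1) : ∃ x > 0, x ≤ 1 / 4 ∧ ∀ i, R i ^ 2 < 1 - x := by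
  have h1 : ∀ᶠ x in 𝓝[>] (0 : ℝ), ∀ i, R i ^ 2 < 1 - x := by
    rw [Filter.eventually_all]
    intro i
    have hc : Continuous fun x : ℝ => 1 - x := by fun_prop
    refine nhdsWithin_le_nhds ((hc.tendsto 0).eventually (lt_mem_nhds ?_))
    nlinarith [hR i, hR0 i]
  have h2 : ∀ᶠ x in 𝓝[>] (0 : ℝ), x ≤ 1 / 4 :=
    nhdsWithin_le_nhds (Iic_mem_nhds (by norm_num))
  obtain ⟨x, h3, h4, h5⟩ := (eventually_mem_nhdsWithin.and (h1.and h2)).exists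
  exact ⟨x, h3, h5, h4⟩

/-- Take h = `baseHeight` + χ / 2, with χ a radial cutoff that equals one near the second hole of
the first handle and vanishes outside the annulus. The annulus lies well inside the unit circle,
where the base height is 1/4, so χ does not disturb the collar. -/
theorem nonempty_height : Nonempty D.Height := by
  obtain ⟨η, hη, hdisj, hin⟩ := D.exists_annulus
  set c := D.center (.inl (0, true)) with hc
  set r := D.radius (.inl (0, true)) with hr
  have hrp : 0 < r := D.radius_pos _
  obtain ⟨x, hx, hx4, hxR⟩ := exists_collar_width
    (R := fun i : Option ((Fin (k + 1) × Bool) ⊕ Fin 0) =>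
      i.elim (‖c‖ + (r + η)) fun i => ‖D.center i‖ + D.radius i)
    (by rintro (_ | i)
        · have := norm_nonneg c
          simp only [Option.elim]; linarith
        · have := norm_nonneg (D.center i)
          have := D.radius_pos i
          simp only [Option.elim]; linarith)
    (by rintro (_ | i)
        · exact hin
        · exact D.inside i)
  have hnorm : ∀ z : ℂ, ‖z‖ ≤ dist z c + ‖c‖ := fun z => by
    rw [dist_eq_norm]; simpa using norm_add_le (z - c) c
  have hann : ∀ z, dist z c ≤ r + η → ‖z‖ ^ 2 < 1 - x := by
    intro z hz
    refine lt_of_le_of_lt (pow_le_pow_left₀ (norm_nonneg z) ?_ 2) (hxR none)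
    simp only [Option.elim]; linarith [hnorm z]
  have hann1 : ∀ z, dist z c ≤ r + η → ‖z‖ < 1 := by
    intro z hz
    linarith [hnorm z]
  have hhole : ∀ i z, dist z (D.center i) ≤ D.radius i → ‖z‖ ^ 2 < 1 - x := by
    intro i z hz
    refine lt_of_le_of_lt (pow_le_pow_left₀ (norm_nonneg z) ?_ 2) (hxR (some i))
    have : ‖z‖ ≤ dist z (D.center i) + ‖D.center i‖ := by
      rw [dist_eq_norm]; simpa using norm_add_le (z - D.center i) (D.center i)
    simp only [Option.elim]; linarith
  have hfar : ∀ i, i ≠ .inl (0, true) → ∀ z, dist z (D.center i) ≤ D.radius i →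
      r + η < dist z c := by
    intro i hi z hz
    have := dist_triangle_left (D.center i) c z
    linarith [hdisj i hi]
  -- The cutoff χ falls between R₁ and R₂, so h = 1/2 occurs only there; b is supported between R₀
  -- and R₃, with a margin on both sides.
  set R₀ := r + η / 5 with hR₀
  set R₁ := r + 2 * η / 5 with hR₁
  set R₂ := r + 3 * η / 5 with hR₂
  set R₃ := r + 4 * η / 5 with hR₃
  have hgap : 0 < R₂ ^ 2 - R₁ ^ 2 := by nlinarith
  have hsq : ContDiff ℝ ∞ fun z : ℂ => ‖z - c‖ ^ 2 := (contDiff_id.sub contDiff_const).norm_sq ℝ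
  set χ : ℂ → ℝ := fun z => Real.smoothTransition ((R₂ ^ 2 - ‖z - c‖ ^ 2) / (R₂ ^ 2 - R₁ ^ 2))
    with hχ
  have hχs : ContDiff ℝ ∞ χ :=
    Real.smoothTransition.contDiff.comp ((contDiff_const.sub hsq).div_const _)
  have hχ1 : ∀ z, dist z c ≤ R₁ → χ z = 1 := by
    intro z hz
    apply Real.smoothTransition.one_of_one_le
    rw [dist_eq_norm] at hz
    rw [one_le_div hgap]
    nlinarith [norm_nonneg (z - c)]
  have hχ0 : ∀ z, R₂ ≤ dist z c → χ z = 0 := by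
    intro z hz
    apply Real.smoothTransition.zero_of_nonpos
    rw [dist_eq_norm] at hz
    exact div_nonpos_of_nonpos_of_nonneg (by nlinarith [norm_nonneg (z - c)]) hgap.le
  have hχn : ∀ z, 0 ≤ χ z := fun z => Real.smoothTransition.nonneg _
  have hχl : ∀ z, χ z ≤ 1 := fun z => Real.smoothTransition.le_one _
  have hχfar : ∀ z, 1 - x ≤ ‖z‖ ^ 2 → χ z = 0 := by
    intro z hz
    apply hχ0
    by_contra! hcon
    linarith [hann z (by linarith)]
  set b : ℂ → ℝ := fun z => Real.smoothTransition (‖z - c‖ ^ 2 - R₀ ^ 2) *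
    Real.smoothTransition (R₃ ^ 2 - ‖z - c‖ ^ 2) with hb
  exact ⟨{
    x := x
    x_pos := hx
    x_lt_one := by linarith
    hole_lt := hhole
    h := fun z => baseHeight x z + χ z / 2
    smooth := (contDiff_baseHeight x).add (hχs.div_const 2)
    outside := by
      intro z hz
      have : χ z = 0 := hχfar z (by nlinarith)
      rw [this, baseHeight_of_one_le hx hz]; simp
    mem_Ioo := by
      intro z hz
      have := baseHeight_mem hx hx4 hz
      constructor <;> linarith [hχn z, hχl z, this.1, this.2]
    radial := by
      intro z w hzw hz
      have h1 := hχfar z hz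
      have h2 := hχfar w (hzw ▸ hz)
      simp only [h1, h2, baseHeight, hzw]
    near_hole := by
      intro i hi z hz
      have h1 : ∀ᶠ w in 𝓝 z, ‖w‖ ^ 2 < 1 - x :=
        ((by fun_prop : Continuous fun w : ℂ => ‖w‖ ^ 2).continuousAt).eventually
          (gt_mem_nhds (hhole i z hz.le))
      have h2 : ∀ᶠ w in 𝓝 z, r + η < dist w c :=
        ((by fun_prop : Continuous fun w : ℂ => dist w c).continuousAt).eventually
          (lt_mem_nhds (hfar i hi z hz.le))
      filter_upwards [h1, h2] with w hw1 hw2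
      rw [baseHeight_of_le hx hw1.le, hχ0 w (by linarith)]; norm_num
    near_last := by
      intro z hz
      have h2 : ∀ᶠ w in 𝓝 z, dist w c < R₁ :=
        ((by fun_prop : Continuous fun w : ℂ => dist w c).continuousAt).eventually
          (gt_mem_nhds (show dist z c < R₁ by rw [hz]; linarith))
      filter_upwards [h2] with w hw2
      rw [baseHeight_of_le hx (hann w (by linarith)).le, hχ1 w hw2.le]; norm_num
    B := Metric.closedBall c R₃ \ Metric.ball c R₀
    isCompact_B := (isCompact_closedBall c R₃).diff Metric.isOpen_ball
    B_subset := by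
      rintro z ⟨hz, hz'⟩
      rw [Metric.mem_closedBall] at hz
      rw [Metric.mem_ball, not_lt] at hz'
      refine ⟨hann1 z (by linarith), fun i => ?_⟩
      by_cases hi : i = .inl (0, true)
      · rw [hi]; show r < dist z c; linarith
      · by_contra! hcon
        linarith [hfar i hi z hcon]
    b := b
    smooth_b := (Real.smoothTransition.contDiff.comp (hsq.sub contDiff_const)).mul
      (Real.smoothTransition.contDiff.comp (contDiff_const.sub hsq))
    abs_b_le := by
      intro z
      rw [hb, abs_of_nonneg (mul_nonneg (Real.smoothTransition.nonneg _)
        (Real.smoothTransition.nonneg _))]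
      exact mul_le_one₀ (Real.smoothTransition.le_one _) (Real.smoothTransition.nonneg _)
        (Real.smoothTransition.le_one _)
    b_off := by
      intro z hz
      rw [Set.mem_sdiff, not_and_or, not_not, Metric.mem_closedBall, Metric.mem_ball, not_le,
        dist_eq_norm] at hz
      rcases hz with hz | hz
      · simp only [hb, Real.smoothTransition.zero_of_nonpos
          (show R₃ ^ 2 - ‖z - c‖ ^ 2 ≤ 0 by nlinarith), mul_zero]
      · simp only [hb, Real.smoothTransition.zero_of_nonpos
          (show ‖z - c‖ ^ 2 - R₀ ^ 2 ≤ 0 by nlinarith [norm_nonneg (z - c)]), zero_mul]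
    b_ne_zero := by
      intro z hz hh
      have h1 : R₁ < dist z c := by
        by_contra! hcon
        rw [baseHeight_of_le hx (hann z (by linarith)).le, hχ1 z hcon] at hh
        norm_num at hh
      have h2 : dist z c < R₂ := by
        by_contra! hcon
        rw [hχ0 z hcon] at hh
        rcases hz.lt_or_eq with hz | hz
        · linarith [(baseHeight_mem hx hx4 hz).2]
        · rw [baseHeight_of_one_le hx hz.ge, hz] at hh
          norm_num at hh
      rw [dist_eq_norm] at h1 h2
      exact mul_ne_zero (Real.smoothTransition.pos_of_pos (by nlinarith)).ne'
        (Real.smoothTransition.pos_of_pos (by nlinarith)).ne' }⟩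

end HandleDisc

end KnotCobordism

end

/-! ### The two sheets and the cobordism they form. -/

open scoped Manifold ContDiff Topology ComplexConjugate

noncomputable section

namespace KnotCobordism

namespace HandleDisc

variable {k : ℕ} {D : HandleDisc (k + 1) 0}

/-- Along the outward ray h is 1 - t², with slope -2 at t = 1. The formula is known only for t ≥ 1,
so one-sided derivatives are compared. -/
theorem Height.fderiv_ne_zero (H : D.Height) {z : ℂ} (hz : ‖z‖ = 1) : fderiv ℝ H.h z ≠ 0 := by
  intro h0
  have h1 : HasFDerivAt H.h (fderiv ℝ H.h z) z :=
    (H.smooth.differentiable (by simp) z).hasFDerivAt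
  rw [h0] at h1
  have h2 : HasDerivAt (fun t : ℝ => (t : ℂ) * z) z 1 := by
    simpa using ((hasDerivAt_id (1 : ℝ)).ofReal_comp).mul_const z
  have h3 : HasDerivAt (fun t : ℝ => H.h ((t : ℂ) * z)) 0 1 := by
    have h1' : HasFDerivAt H.h (0 : ℂ →L[ℝ] ℝ) (((1 : ℝ) : ℂ) * z) := by simpa using h1
    exact h1'.comp_hasDerivAt (1 : ℝ) h2
  have h4 : HasDerivWithinAt (fun t : ℝ => H.h ((t : ℂ) * z)) (-2) (Set.Ici 1) 1 := by
    have h5 : HasDerivAt (fun t : ℝ => 1 - t ^ 2) (-2) 1 := by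
      simpa using (hasDerivAt_pow 2 (1 : ℝ)).const_sub 1
    refine h5.hasDerivWithinAt.congr (fun t ht => ?_) ?_
    · have ht' : (1 : ℝ) ≤ t := ht
      have hn : ‖(t : ℂ) * z‖ = t := by
        rw [norm_mul, hz, mul_one, Complex.norm_real, Real.norm_eq_abs, abs_of_pos (by linarith)]
      rw [H.outside _ (by rw [hn]; exact ht'), hn]
    · rw [H.outside _ (by simp [hz])]; simp [hz]
  have := (uniqueDiffOn_Ici (1 : ℝ)).uniqueDiffWithinAt Set.self_mem_Ici |>.eq_deriv _
    h3.hasDerivWithinAt h4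
  norm_num at this

/-- The two sheets of the cobordism over a Seifert surface: the surface pushed off itself in the
normal direction, and the surface reparametrized near its boundary. -/
structure Sheets (D : HandleDisc (k + 1) 0) (φ : ℂ → E4) extends D.Height where
  φ₁ : ℂ → E4
  φ₂ : ℂ → E4
  smooth₁ : ∀ z ∈ D.domain, ContDiffAt ℝ ∞ φ₁ z
  smooth₂ : ∀ z ∈ D.domain, ContDiffAt ℝ ∞ φ₂ z
  immersion₁ : ∀ z ∈ D.domain, Function.Injective (fderiv ℝ φ₁ z)
  immersion₂ : ∀ z ∈ D.domain, Function.Injective (fderiv ℝ φ₂ z)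
  sphere₁ : ∀ z ∈ D.domain, φ₁ z ∈ Metric.sphere (0 : E4) 1
  sphere₂ : ∀ z ∈ D.domain, φ₂ z ∈ Metric.sphere (0 : E4) 1
  eq₁ : ∀ z, z ∉ B → φ₁ z = φ z
  eq₂ : ∀ z, ‖z‖ ^ 2 ≤ 1 - x → φ₂ z = φ z
  glued₁ : ∀ z ∈ D.domain, ∀ w ∈ D.domain, φ₁ z = φ₁ w → D.Glued z w
  glued₂ : ∀ z ∈ D.domain, ∀ w ∈ D.domain, φ₂ z = φ₂ w → D.Glued z w
  -- As the second sheet is reparametrized near the boundary, coinciding values need not come from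
  -- equal parameters; equality of heights is what survives.
  glued₁₂ : ∀ z ∈ D.domain, ∀ w ∈ D.domain, φ₁ z = φ₂ w → b z = 0 ∧ (h z = h w ∨ D.Glued z w)
  top₂ : ∀ u : Circle, φ₂ (mobius (D.glue 0) (D.pullC none + D.pullR none * u)) = φ (u⁻¹ : Circle)

/-- The gluing map runs the boundary circle of the unglued hole backwards over the unit circle, up
to a rotation and a disc automorphism. The inverse u⁻¹ is the source of the reversal of the knot;
the other two factors have to be undone. -/
theorem mobius_pull_none (D : HandleDisc (k + 1) 0) (u : Circle) :
    mobius (D.glue 0) (D.pullC none + D.pullR none * u) =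
      discMap (D.apex 0) (D.coef 0 / ‖D.coef 0‖ * (u⁻¹ : Circle)) := by
  have hzp : D.pullC none + D.pullR none * u ≠ D.pole 0 := by
    intro h
    have h1 := D.dist_pole_pullC_none_lt
    rw [← h, dist_eq_norm, add_sub_cancel_left, norm_mul, Circle.norm_coe, mul_one,
      Complex.norm_real, Real.norm_eq_abs] at h1
    exact absurd (le_abs_self _) (not_le.mpr h1)
  rw [D.mobius_glue 0 hzp]
  have hβ := D.coef_ne_zero 0
  have hq := D.norm_apex_lt_one 0
  set q := D.apex 0
  set β := D.coef 0
  have hδ : 0 < 1 - ‖q‖ ^ 2 := by nlinarith [norm_nonneg q]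
  have hβn : (‖β‖ : ℂ) ≠ 0 := by simpa using hβ
  have hδc : ((1 - ‖q‖ ^ 2 : ℝ) : ℂ) ≠ 0 := by exact_mod_cast hδ.ne'
  have hqq : conj q * q = ((‖q‖ ^ 2 : ℝ) : ℂ) := by
    rw [mul_comm, Complex.mul_conj, Complex.normSq_eq_norm_sq]
  have hu : (u : ℂ) ≠ 0 := Circle.coe_ne_zero u
  have h1 : D.pullC none + D.pullR none * u - D.pole 0 =
      (β * conj q + ‖β‖ * u) / ((1 - ‖q‖ ^ 2 : ℝ) : ℂ) := by
    have e1 : ‖(0 : ℂ) - q‖ ^ 2 - (1 : ℝ) ^ 2 = -(1 - ‖q‖ ^ 2) := by simp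
    simp only [pullC, pullR, pullCenter, pullRadius]
    rw [e1, abs_neg, abs_of_pos hδ]
    push_cast at hδc ⊢
    rw [zero_sub, map_neg]
    field_simp
    ring
  have hne : β * conj q + ‖β‖ * u ≠ 0 := by
    intro h
    rw [h, zero_div] at h1
    exact hzp (sub_eq_zero.mp h1)
  have hne2 : ‖β‖ * (u : ℂ) + conj q * β ≠ 0 := by
    intro h; exact hne (by rw [← h]; ring)
  rw [h1, discMap, Circle.coe_inv]
  have hden : 1 + conj q * (β / ‖β‖ * (u : ℂ)⁻¹) = (‖β‖ * u + conj q * β) / (‖β‖ * u) := by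
    field_simp
  rw [hden]
  have hnum : β / ‖β‖ * (u : ℂ)⁻¹ + q = (β + q * (‖β‖ * u)) / (‖β‖ * u) := by
    field_simp
  rw [hnum, div_div_div_cancel_right₀ (mul_ne_zero hβn hu), div_div_eq_mul_div,
    eq_div_iff hne2, add_mul, show β * conj q + ‖β‖ * (u : ℂ) = ‖β‖ * u + conj q * β by ring,
    div_mul_cancel₀ _ hne2]
  push_cast at hqq ⊢
  linear_combination β * hqq

/-- The first sheet is φ pushed along its normal, the second is φ ∘ f with f a collar map. As f
preserves norms and is the identity where the holes are, it respects the domain, the gluing and the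
height. -/
theorem nonempty_sheets {φ : ℂ → E4} (hφ : D.IsSmoothEmbedding φ)
    (hs : ∀ z ∈ D.domain, φ z ∈ Metric.sphere (0 : E4) 1) : Nonempty (D.Sheets φ) := by
  obtain ⟨H⟩ := D.nonempty_height
  obtain ⟨φ₁, h1, h2, h3, h4, h5, h6⟩ := exists_push hφ hs H.isCompact_B H.B_subset H.smooth_b
    H.abs_b_le H.b_off
  have hq := D.norm_apex_lt_one 0
  have hβ := D.coef_ne_zero 0
  have hβn : (‖D.coef 0‖ : ℂ) ≠ 0 := by simpa using hβ
  -- The inverse of the rotation β / ‖β‖ in `mobius_pull_none`; its argument is the angle of the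
  -- collar map.
  set κ : ℂ := ‖D.coef 0‖ / D.coef 0 with hκ
  have hκ1 : ‖κ‖ = 1 := by
    rw [hκ, norm_div, Complex.norm_real, norm_norm, div_self (norm_ne_zero_iff.mpr hβ)]
  have hexp : Complex.exp (κ.arg * Complex.I) = κ := by
    have := Complex.norm_mul_exp_arg_mul_I κ
    rwa [hκ1, Complex.ofReal_one, one_mul] at this
  set f := collarMap H.x (D.apex 0) κ.arg with hf
  have hfn : ∀ w, ‖f w‖ = ‖w‖ := norm_collarMap hq
  have hfid : ∀ w, ‖w‖ ^ 2 ≤ 1 - H.x → f w = w := fun w hw => collarMap_eq_self H.x_pos hw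
  have hfs : ContDiff ℝ ∞ f := contDiff_collarMap H.x_pos H.x_lt_one hq
  have hfD : ∀ z ∈ D.domain, f z ∈ D.domain := by
    intro z hz
    by_cases hzx : ‖z‖ ^ 2 ≤ 1 - H.x
    · rwa [hfid z hzx]
    · refine ⟨(hfn z).trans_le hz.1, fun i => ?_⟩
      by_contra! hcon
      have := H.hole_lt i _ hcon.le
      rw [hfn] at this
      exact hzx this.le
  have hhole : ∀ i w, dist (f w) (D.center i) = D.radius i → f w = w := by
    intro i w hw
    have := H.hole_lt i _ hw.le
    rw [hfn] at this
    exact hfid w this.le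
  have hhf : ∀ w, H.h (f w) = H.h w := by
    intro w
    by_cases hw : ‖w‖ ^ 2 ≤ 1 - H.x
    · rw [hfid w hw]
    · exact H.radial _ _ (hfn w) (by rw [hfn]; linarith)
  exact ⟨{
    toHeight := H
    φ₁ := φ₁
    φ₂ := fun z => φ (f z)
    smooth₁ := h1
    smooth₂ := fun z hz => (hφ.smooth _ (hfD z hz)).comp z hfs.contDiffAt
    immersion₁ := h2
    immersion₂ := by
      intro z hz
      have e : fderiv ℝ (fun z => φ (f z)) z = _ :=
        fderiv_comp z ((hφ.smooth _ (hfD z hz)).differentiableAt (by simp))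
          (hfs.differentiable (by simp) z)
      rw [e]
      exact (hφ.immersion _ (hfD z hz)).comp
        (injective_fderiv_collarMap H.x_pos H.x_lt_one hq z)
    sphere₁ := h3
    sphere₂ := fun z hz => hs _ (hfD z hz)
    eq₁ := h4
    eq₂ := fun z hz => by rw [hfid z hz]
    glued₁ := h5
    glued₂ := by
      intro z hz w hw h
      rcases (hφ.eq_iff _ (hfD z hz) _ (hfD w hw)).mp h with h | ⟨j, ⟨h, h'⟩ | ⟨h, h'⟩⟩
      · exact Or.inl (injective_collarMap hq h)
      · have e1 := hhole _ z h
        have e2 := hhole _ w (by rw [h']; exact D.glue_circle j _ h)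
        rw [e1] at h h'
        rw [e2] at h'
        exact Or.inr ⟨j, Or.inl ⟨h, h'⟩⟩
      · have e1 := hhole _ w h
        have e2 := hhole _ z (by rw [h']; exact D.glue_circle j _ h)
        rw [e1] at h h'
        rw [e2] at h'
        exact Or.inr ⟨j, Or.inr ⟨h, h'⟩⟩
    glued₁₂ := by
      intro z hz w hw h
      obtain ⟨hg, hb⟩ := h6 z hz _ (hfD w hw) h
      refine ⟨hb, ?_⟩
      rcases hg with h | ⟨j, ⟨h, h'⟩ | ⟨h, h'⟩⟩
      · left; rw [h, hhf]
      · right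
        have e2 := hhole _ w (by rw [h']; exact D.glue_circle j _ h)
        rw [e2] at h'
        exact Or.inr ⟨j, Or.inl ⟨h, h'⟩⟩
      · right
        have e1 := hhole _ w h
        rw [e1] at h h'
        exact Or.inr ⟨j, Or.inr ⟨h, h'⟩⟩
    top₂ := by
      intro u
      have hv : ‖D.coef 0 / ‖D.coef 0‖ * (u⁻¹ : Circle)‖ = 1 := by
        rw [norm_mul, Circle.norm_coe, mul_one, norm_div_norm hβ]
      rw [D.mobius_pull_none u]
      have e := discMap_neg_discMap (a := -D.apex 0) (by simpa using hq) hv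
      rw [neg_neg] at e
      rw [hf, collarMap_of_norm_eq_one H.x_pos (norm_discMap hq hv), e, hexp, hκ]
      congr 1
      field_simp }⟩

namespace Sheets

variable {φ : ℂ → E4} (S : D.Sheets φ)

/-- The lower half of the cobordism. -/
def lower (z : ℂ) : E4 × ℝ := (S.φ₁ z, S.h z)

/-- The upper half of the cobordism. -/
def upper (z : ℂ) : E4 × ℝ := (S.φ₂ (mobius (D.glue 0) z), 1 - S.h (mobius (D.glue 0) z))

/-- The cobordism, parametrized by the doubled disc. -/
def map (z : ℂ) : E4 × ℝ :=
  if D.radius (.inl (0, false)) ≤ dist z (D.center (.inl (0, false))) then S.lower z else S.upper z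

theorem notMem_B_of_hole {i} {z : ℂ} (hz : dist z (D.center i) = D.radius i) : z ∉ S.B :=
  fun h => ((S.B_subset h).2 i).ne' hz

theorem h_seam {j : Fin (k + 1)} {z : ℂ} (hz : z ∈ D.seam j) : S.h z = 1 / 4 :=
  (S.near_hole _ (by simp) z hz).self_of_nhds

theorem h_second_succ {j : Fin k} {z : ℂ} (hz : z ∈ D.seam j.succ) :
    S.h (mobius (D.glue j.succ) z) = 1 / 4 :=
  (S.near_hole _ (by simp) _ (D.glue_circle j.succ z hz)).self_of_nhds

theorem h_second_zero {z : ℂ} (hz : z ∈ D.seam 0) : S.h (mobius (D.glue 0) z) = 3 / 4 :=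
  (S.near_last _ (D.glue_circle 0 z hz)).self_of_nhds

theorem eventually_notMem_B {i} {z : ℂ} (hz : dist z (D.center i) = D.radius i) :
    ∀ᶠ w in 𝓝 z, w ∉ S.B :=
  S.isCompact_B.isClosed.isOpen_compl.mem_nhds (show z ∈ S.Bᶜ from S.notMem_B_of_hole hz)

theorem eventually_φ₁_eq {i} {z : ℂ} (hz : dist z (D.center i) = D.radius i) :
    ∀ᶠ w in 𝓝 z, S.φ₁ w = φ w :=
  (S.eventually_notMem_B hz).mono S.eq₁

theorem eventually_φ₂_eq {i} {z : ℂ} (hz : dist z (D.center i) = D.radius i) :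
    ∀ᶠ w in 𝓝 z, S.φ₂ w = φ w := by
  have h1 : ∀ᶠ w in 𝓝 z, ‖w‖ ^ 2 < 1 - S.x :=
    ((by fun_prop : Continuous fun w : ℂ => ‖w‖ ^ 2).continuousAt).eventually
      (gt_mem_nhds (S.hole_lt i z hz.le))
  exact h1.mono fun w hw => S.eq₂ w hw.le

theorem ne_pole_of_mem_seam {j : Fin (k + 1)} {z : ℂ} (hz : z ∈ D.seam j) : z ≠ D.pole j :=
  D.ne_pole_of_radius_le j (Eq.ge hz)

theorem tendsto_mobius {j : Fin (k + 1)} {z : ℂ} (hz : z ∈ D.seam j) :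
    Filter.Tendsto (mobius (D.glue j)) (𝓝 z) (𝓝 (mobius (D.glue j) z)) :=
  D.continuousAt_mobius j (ne_pole_of_mem_seam hz)

theorem eventually_glue (hφ : D.IsSmoothEmbedding φ) {j : Fin (k + 1)} {z : ℂ}
    (hz : z ∈ D.seam j) : ∀ᶠ w in 𝓝 z, φ (mobius (D.glue j) w) = φ w :=
  eventually_nhdsSet_iff_forall.mp (hφ.glue_near j) z hz

/-- The two halves agree near the first seam. -/
theorem lower_eq_upper (hφ : D.IsSmoothEmbedding φ) {z : ℂ} (hz : z ∈ D.seam 0) :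
    ∀ᶠ w in 𝓝 z, S.lower w = S.upper w := by
  have hz' := D.glue_circle 0 z hz
  have ht := tendsto_mobius hz
  -- The lower sheet has height 1/4 here and the upper one 1 - 3/4.
  filter_upwards [eventually_glue hφ hz, S.eventually_φ₁_eq hz,
    ht.eventually (S.eventually_φ₂_eq hz'), S.near_hole _ (by simp) z hz,
    ht.eventually (S.near_last _ hz')] with w h1 h2 h3 h4 h5
  rw [lower, upper, h2, h3, h1, h4, h5]
  norm_num

/-- On the first seam both formulas agree on a full neighbourhood, so the case distinction in `map`
does not affect derivatives. -/
theorem map_eventuallyEq_lower (hφ : D.IsSmoothEmbedding φ) {z : ℂ}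
    (hz : D.radius (.inl (0, false)) ≤ dist z (D.center (.inl (0, false)))) :
    S.map =ᶠ[𝓝 z] S.lower := by
  rcases hz.lt_or_eq with hz | hz
  · have : ∀ᶠ w in 𝓝 z, D.radius (.inl (0, false)) < dist w (D.center (.inl (0, false))) :=
      ((by fun_prop : Continuous fun w : ℂ =>
        dist w (D.center (.inl (0, false)))).continuousAt).eventually (lt_mem_nhds hz)
    filter_upwards [this] with w hw
    rw [map, if_pos hw.le]
  · filter_upwards [S.lower_eq_upper hφ (z := z) hz.symm] with w hw
    rw [map]
    split_ifs
    · rfl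
    · exact hw.symm

theorem map_eventuallyEq_upper (hφ : D.IsSmoothEmbedding φ) {z : ℂ}
    (hz : dist z (D.center (.inl (0, false))) ≤ D.radius (.inl (0, false))) :
    S.map =ᶠ[𝓝 z] S.upper := by
  rcases hz.lt_or_eq with hz | hz
  · have : ∀ᶠ w in 𝓝 z, dist w (D.center (.inl (0, false))) < D.radius (.inl (0, false)) :=
      ((by fun_prop : Continuous fun w : ℂ =>
        dist w (D.center (.inl (0, false)))).continuousAt).eventually (gt_mem_nhds hz)
    filter_upwards [this] with w hw
    rw [map, if_neg (not_le.mpr hw)]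
  · filter_upwards [S.lower_eq_upper hφ (z := z) hz] with w hw
    rw [map]
    split_ifs
    · exact hw
    · rfl

theorem contDiffAt_lower {z : ℂ} (hz : z ∈ D.domain) : ContDiffAt ℝ ∞ S.lower z :=
  (S.smooth₁ z hz).prodMk S.smooth.contDiffAt

theorem contDiffAt_upper {z : ℂ} (hzp : z ≠ D.pole 0) (hz : mobius (D.glue 0) z ∈ D.domain) :
    ContDiffAt ℝ ∞ S.upper z := by
  have hm := D.contDiffAt_mobius 0 hzp
  exact ((S.smooth₂ _ hz).comp z hm).prodMk
    (contDiffAt_const.sub (S.smooth.contDiffAt.comp z hm))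

theorem injective_fderiv_upper_fst {z : ℂ} (hzp : z ≠ D.pole 0)
    (hz : mobius (D.glue 0) z ∈ D.domain) :
    Function.Injective (fderiv ℝ (fun w => (S.upper w).1) z) := by
  have e : fderiv ℝ (fun w => (S.upper w).1) z = _ :=
    fderiv_comp (g := S.φ₂) (f := mobius (D.glue 0)) z
      ((S.smooth₂ _ hz).differentiableAt (by simp)) ((D.contDiffAt_mobius 0 hzp).differentiableAt (by simp))
  rw [e]
  exact (S.immersion₂ _ hz).comp (D.injective_fderiv_mobius 0 hzp)

theorem contDiffAt_map (hφ : D.IsSmoothEmbedding φ) {z : ℂ} (hz : z ∈ D.double.domain) :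
    ContDiffAt ℝ ∞ S.map z := by
  rcases le_total (D.radius (.inl (0, false))) (dist z (D.center (.inl (0, false)))) with h | h
  · exact (S.contDiffAt_lower (D.mem_domain_of_mem_double hz h)).congr_of_eventuallyEq
      (S.map_eventuallyEq_lower hφ h)
  · exact (S.contDiffAt_upper (D.ne_pole_of_mem_double hz)
      (D.mobius_mem_domain_of_mem_double hz h)).congr_of_eventuallyEq
      (S.map_eventuallyEq_upper hφ h)

/-- Already the projection to S³ is an immersion. Besides the immersion property of `map`, this
makes the height direction transverse to the surface, which the flat charts use. -/
theorem injective_fderiv_map_fst (hφ : D.IsSmoothEmbedding φ) {z : ℂ}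
    (hz : z ∈ D.double.domain) : Function.Injective (fderiv ℝ (fun w => (S.map w).1) z) := by
  rcases le_total (D.radius (.inl (0, false))) (dist z (D.center (.inl (0, false)))) with h | h
  · have e : (fun w => (S.map w).1) =ᶠ[𝓝 z] fun w => (S.lower w).1 :=
      (S.map_eventuallyEq_lower hφ h).fun_comp Prod.fst
    rw [Filter.EventuallyEq.fderiv_eq e]
    exact S.immersion₁ z (D.mem_domain_of_mem_double hz h)
  · have e : (fun w => (S.map w).1) =ᶠ[𝓝 z] fun w => (S.upper w).1 :=
      (S.map_eventuallyEq_upper hφ h).fun_comp Prod.fst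
    rw [Filter.EventuallyEq.fderiv_eq e]
    exact S.injective_fderiv_upper_fst (D.ne_pole_of_mem_double hz)
      (D.mobius_mem_domain_of_mem_double hz h)

theorem radius_lt_of_ne_first {i} (hi : i ≠ (0, false)) {z : ℂ}
    (hz : dist z (D.center (.inl i)) ≤ D.radius (.inl i)) :
    D.radius (.inl (0, false)) < dist z (D.center (.inl (0, false))) :=
  D.radius_lt_dist_of_mem_closedBall (i := .inl i) (by simpa using hi) hz

/-- Each kind of handle reduces to the compatibility of φ with the gluing of D, since near the
circles both sheets equal φ and the heights are constant. -/
theorem map_glue_near (hφ : D.IsSmoothEmbedding φ) (j : Fin (2 * k + 1)) :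
    ∀ᶠ z in 𝓝ˢ (D.double.seam j), S.map (mobius (D.double.glue j) z) = S.map z := by
  rw [eventually_nhdsSet_iff_forall]
  intro z hz
  change dist z (D.sheetC (doubleHole (doubleIndex k j) false)) =
    D.sheetR (doubleHole (doubleIndex k j) false) at hz
  change ∀ᶠ w in 𝓝 z, S.map (mobius (D.doubleGlue (doubleIndex k j)) w) = S.map w
  generalize doubleIndex k j = j' at hz ⊢
  rcases j' with _ | ⟨j', _ | _⟩
  -- The crosswise handle joins the upper sheet at height 1 - 1/4 to the lower sheet at height 3/4.
  · have hzp : z ≠ D.pole 0 := by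
      rintro rfl
      exact absurd hz (D.pullR_some_lt_dist_pole (by simp)).ne'
    have hin := D.dist_center_lt_of_pull (i := some (0, false)) (by simp) (le_of_eq hz)
    have hmz : mobius (D.glue 0) z ∈ D.seam 0 := (D.dist_pullC_some_eq_iff (by simp) hzp).mp hz
    have hmmz := D.glue_circle 0 _ hmz
    have ht := D.continuousAt_mobius 0 hzp
    have ht2 := (tendsto_mobius hmz).comp ht
    have hout : D.radius (.inl (0, false)) < dist (mobius (D.glue 0) (mobius (D.glue 0) z))
        (D.center (.inl (0, false))) := radius_lt_of_ne_first (by simp) hmmz.le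
    filter_upwards [isOpen_ne.mem_nhds hzp, S.map_eventuallyEq_upper hφ hin.le,
      ht2.eventually (S.map_eventuallyEq_lower hφ hout.le),
      ht2.eventually (S.eventually_φ₁_eq hmmz), ht2.eventually (S.near_last _ hmmz),
      ht.eventually (S.eventually_φ₂_eq hmz), ht.eventually (S.near_hole _ (by simp) _ hmz),
      ht.eventually (eventually_glue hφ hmz)] with w h0 h1 h2 h3 h4 h5 h6 h7
    simp only [Function.comp_apply] at h2 h3 h4
    rw [D.mobius_doubleGlue_none h0, h2, h1, lower, upper, h3, h4, h5, h6, h7]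
    norm_num
  · change z ∈ D.seam j'.succ at hz
    have hmz := D.glue_circle _ _ hz
    have ht := tendsto_mobius hz
    filter_upwards [S.map_eventuallyEq_lower hφ
        (radius_lt_of_ne_first (by simp) (le_of_eq hz)).le,
      ht.eventually (S.map_eventuallyEq_lower hφ (radius_lt_of_ne_first (by simp) hmz.le).le),
      S.eventually_φ₁_eq hz, ht.eventually (S.eventually_φ₁_eq hmz),
      S.near_hole _ (by simp) _ hz, ht.eventually (S.near_hole _ (by simp) _ hmz),
      eventually_glue hφ hz] with w h1 h2 h3 h4 h5 h6 h7
    rw [doubleGlue, h1, h2, lower, lower, h3, h4, h5, h6, h7]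
  -- A handle within the second copy: both ends are on the upper sheet, and the conjugating factors
  -- cancel.
  · have hzp : z ≠ D.pole 0 := by
      rintro rfl
      exact absurd hz (D.pullR_some_lt_dist_pole (by simp)).ne'
    have hin := D.dist_center_lt_of_pull (i := some (j'.succ, false)) (by simp) (le_of_eq hz)
    have hmz : mobius (D.glue 0) z ∈ D.seam j'.succ :=
      (D.dist_pullC_some_eq_iff (by simp) hzp).mp hz
    have hmmz := D.glue_circle _ _ hmz
    have ht := D.continuousAt_mobius 0 hzp
    have ht2 := (tendsto_mobius hmz).comp ht
    have hap := D.ne_apex_zero_of_mem (by simp) hmmz.le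
    have hinv : ContinuousAt (mobius (D.glue 0)⁻¹) (mobius (D.glue j'.succ) (mobius (D.glue 0) z)) := by
      have : ContinuousAt (fun w => D.pole 0 + D.coef 0 / (w - D.apex 0))
          (mobius (D.glue j'.succ) (mobius (D.glue 0) z)) :=
        continuousAt_const.add (continuousAt_const.div (by fun_prop) (sub_ne_zero.mpr hap))
      refine this.congr ?_
      filter_upwards [isOpen_ne.mem_nhds hap] with w hw using (D.mobius_inv hw).symm
    have ht3 := Filter.Tendsto.comp hinv ht2
    have hmmm : dist (mobius (D.glue 0)⁻¹ (mobius (D.glue j'.succ) (mobius (D.glue 0) z)))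
        (D.pullC (some (j'.succ, true))) = D.pullR (some (j'.succ, true)) := by
      rw [D.dist_pullC_some_eq_iff (by simp) (D.mobius_inv_ne_pole hap), D.mobius_mobius_inv hap]
      exact hmmz
    have hin2 := D.dist_center_lt_of_pull (i := some (j'.succ, true)) (by simp) hmmm.le
    filter_upwards [isOpen_ne.mem_nhds hzp, ht.eventually (isOpen_ne.mem_nhds
        (ne_pole_of_mem_seam hmz)), ht2.eventually (isOpen_ne.mem_nhds hap),
      S.map_eventuallyEq_upper hφ hin.le, ht3.eventually (S.map_eventuallyEq_upper hφ hin2.le),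
      ht2.eventually (S.eventually_φ₂_eq hmmz), ht.eventually (S.eventually_φ₂_eq hmz),
      ht2.eventually (S.near_hole _ (by simp) _ hmmz),
      ht.eventually (S.near_hole _ (by simp) _ hmz), ht.eventually (eventually_glue hφ hmz)]
      with w h0 h0' h0'' h1 h2 h3 h4 h5 h6 h7
    simp only [Function.comp_apply] at h0'' h2 h3 h5
    rw [D.mobius_doubleGlue_some_true j' h0 h0', h2, h1, upper, upper, D.mobius_mobius_inv h0'',
      h3, h4, h5, h6, h7]

theorem doubleGlued_none {w : ℂ} (hwp : w ≠ D.pole 0) (hw : mobius (D.glue 0) w ∈ D.seam 0) :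
    D.double.Glued (mobius (D.glue 0) (mobius (D.glue 0) w)) w := by
  refine Or.inr ⟨(doubleIndex k).symm none, Or.inr ⟨?_, ?_⟩⟩
  · change dist w (D.sheetC (doubleHole (doubleIndex k ((doubleIndex k).symm none)) false)) =
      D.sheetR (doubleHole (doubleIndex k ((doubleIndex k).symm none)) false)
    rw [Equiv.apply_symm_apply]
    exact (D.dist_pullC_some_eq_iff (by simp) hwp).mpr hw
  · change _ = mobius (D.doubleGlue (doubleIndex k ((doubleIndex k).symm none))) w
    rw [Equiv.apply_symm_apply, D.mobius_doubleGlue_none hwp]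

theorem doubleGlued_lower {j : Fin k} {z : ℂ} (hz : z ∈ D.seam j.succ) :
    D.double.Glued z (mobius (D.glue j.succ) z) := by
  refine Or.inr ⟨(doubleIndex k).symm (some (j, false)), Or.inl ⟨?_, ?_⟩⟩
  · change dist z (D.sheetC (doubleHole (doubleIndex k _) false)) =
      D.sheetR (doubleHole (doubleIndex k _) false)
    rw [Equiv.apply_symm_apply]
    exact hz
  · change _ = mobius (D.doubleGlue (doubleIndex k _)) z
    rw [Equiv.apply_symm_apply, doubleGlue]

theorem doubleGlued_upper {j : Fin k} {z w : ℂ} (hzp : z ≠ D.pole 0) (hwp : w ≠ D.pole 0)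
    (hz : mobius (D.glue 0) z ∈ D.seam j.succ)
    (hw : mobius (D.glue 0) w = mobius (D.glue j.succ) (mobius (D.glue 0) z)) :
    D.double.Glued z w := by
  refine Or.inr ⟨(doubleIndex k).symm (some (j, true)), Or.inl ⟨?_, ?_⟩⟩
  · change dist z (D.sheetC (doubleHole (doubleIndex k _) false)) =
      D.sheetR (doubleHole (doubleIndex k _) false)
    rw [Equiv.apply_symm_apply]
    exact (D.dist_pullC_some_eq_iff (by simp) hzp).mpr hz
  · change _ = mobius (D.doubleGlue (doubleIndex k _)) z
    rw [Equiv.apply_symm_apply, D.mobius_doubleGlue_some_true j hzp (ne_pole_of_mem_seam hz), ← hw,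
      D.mobius_inv_mobius hwp]

/-- Equal values of the lower half. -/
theorem doubleGlued_of_lower_eq {z w : ℂ} (hz : z ∈ D.domain) (hw : w ∈ D.domain)
    (h : S.lower z = S.lower w) : D.double.Glued z w := by
  obtain ⟨h1, h2⟩ := Prod.mk.inj h
  clear h
  rcases S.glued₁ z hz w hw h1 with h | ⟨j, ⟨h, rfl⟩ | ⟨h, rfl⟩⟩
  · exact Or.inl h
  · induction j using Fin.cases with
    -- The handle that was cut is open within a single sheet: its two circles are at heights 1/4 and
    -- 3/4.
    | zero => rw [S.h_seam h, S.h_second_zero h] at h2; norm_num at h2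
    | succ j => exact doubleGlued_lower h
  · induction j using Fin.cases with
    | zero => rw [S.h_seam h, S.h_second_zero h] at h2; norm_num at h2
    | succ j => exact (doubleGlued_lower h).symm

theorem doubleGlued_of_upper_eq {z w : ℂ} (hzp : z ≠ D.pole 0) (hwp : w ≠ D.pole 0)
    (hz : mobius (D.glue 0) z ∈ D.domain) (hw : mobius (D.glue 0) w ∈ D.domain)
    (h : S.upper z = S.upper w) : D.double.Glued z w := by
  obtain ⟨h1, h2⟩ := Prod.mk.inj h
  have h2 : S.h (mobius (D.glue 0) z) = S.h (mobius (D.glue 0) w) := by linarith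
  rcases S.glued₂ _ hz _ hw h1 with h | ⟨j, ⟨h, h'⟩ | ⟨h, h'⟩⟩
  · left
    rw [← D.pole_add_eq 0 hzp, h, D.pole_add_eq 0 hwp]
  · rw [h'] at h2
    induction j using Fin.cases with
    | zero => rw [S.h_seam h, S.h_second_zero h] at h2; norm_num at h2
    | succ j => exact doubleGlued_upper hzp hwp h h'
  · rw [h'] at h2
    induction j using Fin.cases with
    | zero => rw [S.h_seam h, S.h_second_zero h] at h2; norm_num at h2
    | succ j => exact (doubleGlued_upper hwp hzp h h').symm

/-- Equal values mean h z = 1 - h w' for the corresponding point w'. If also h z = h w', both are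
1/2, where the push is nonzero and the sheets are disjoint. So the points are on opposite circles of
a handle; both circles of a remaining handle have h = 1/4, and 1/4 ≠ 1 - 1/4, which leaves the first
handle, where the sheets are meant to be glued. -/
theorem doubleGlued_of_lower_eq_upper {z w : ℂ} (hwp : w ≠ D.pole 0)
    (hz : z ∈ D.domain) (hw : mobius (D.glue 0) w ∈ D.domain)
    (h : S.lower z = S.upper w) : D.double.Glued z w := by
  obtain ⟨h1, h2⟩ := Prod.mk.inj h
  obtain ⟨hb, hg⟩ := S.glued₁₂ z hz _ hw h1
  have hne : S.h z ≠ S.h (mobius (D.glue 0) w) := fun he =>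
    S.b_ne_zero z hz.1 (by linarith) hb
  rcases hg.resolve_left hne with h | ⟨j, ⟨h, h'⟩ | ⟨h, h'⟩⟩
  · exact absurd (congrArg S.h h) hne
  · induction j using Fin.cases with
    | zero =>
      left
      rw [← D.pole_add_eq 0 (ne_pole_of_mem_seam h), ← h', D.pole_add_eq 0 hwp]
    | succ j =>
      rw [h', S.h_seam h, S.h_second_succ h] at h2
      norm_num at h2
  · induction j using Fin.cases with
    | zero =>
      rw [h']
      exact doubleGlued_none hwp h
    | succ j =>
      rw [h', S.h_seam h, S.h_second_succ h] at h2
      norm_num at h2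

theorem map_eq_iff (hφ : D.IsSmoothEmbedding φ) {z w : ℂ} (hz : z ∈ D.double.domain)
    (hw : w ∈ D.double.domain) : S.map z = S.map w ↔ D.double.Glued z w := by
  constructor
  · intro h
    have hzp := D.ne_pole_of_mem_double hz
    have hwp := D.ne_pole_of_mem_double hw
    simp only [map] at h
    split_ifs at h with h1 h2 h2
    · exact S.doubleGlued_of_lower_eq (D.mem_domain_of_mem_double hz h1)
        (D.mem_domain_of_mem_double hw h2) h
    · exact S.doubleGlued_of_lower_eq_upper hwp (D.mem_domain_of_mem_double hz h1)
        (D.mobius_mem_domain_of_mem_double hw (le_of_not_ge h2)) h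
    · exact (S.doubleGlued_of_lower_eq_upper hzp (D.mem_domain_of_mem_double hw h2)
        (D.mobius_mem_domain_of_mem_double hz (le_of_not_ge h1)) h.symm).symm
    · exact S.doubleGlued_of_upper_eq hzp hwp
        (D.mobius_mem_domain_of_mem_double hz (le_of_not_ge h1))
        (D.mobius_mem_domain_of_mem_double hw (le_of_not_ge h2)) h
  · rintro (rfl | ⟨j, ⟨h, rfl⟩ | ⟨h, rfl⟩⟩)
    · rfl
    · exact ((S.map_glue_near hφ j).self_of_nhdsSet z h).symm
    · exact (S.map_glue_near hφ j).self_of_nhdsSet w h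

theorem isSmoothEmbedding_map (hφ : D.IsSmoothEmbedding φ) :
    D.double.IsSmoothEmbedding S.map where
  smooth _ hz := S.contDiffAt_map hφ hz
  immersion z hz := by
    have h1 := S.injective_fderiv_map_fst hφ hz
    have h2 : fderiv ℝ (fun w => (S.map w).1) z = _ :=
      (((S.contDiffAt_map hφ hz).differentiableAt (by simp)).hasFDerivAt.fst).fderiv
    rw [h2] at h1
    rw [ContinuousLinearMap.coe_comp] at h1
    exact Function.Injective.of_comp h1
  glue_near := S.map_glue_near hφ
  eq_iff _ hz _ hw := S.map_eq_iff hφ hz hw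

/-- At the upper end `top₂` gives φ(u⁻¹), which is the reversed knot; in the interior both h and 1 -
h stay strictly between 0 and 1. -/
theorem isProperBetween_map {K : Knot}
    (hK : ∀ u : Circle, φ u = K u) : IsProperBetween D.double S.map K K.reverse where
  mem_sphere z hz := by
    simp only [map]
    split_ifs with h
    · exact S.sphere₁ z (D.mem_domain_of_mem_double hz h)
    · exact S.sphere₂ _ (D.mobius_mem_domain_of_mem_double hz (le_of_not_ge h))
  bottom u := by
    have hu : ‖(u : ℂ)‖ = 1 := Circle.norm_coe u
    have h1 : D.radius (.inl (0, false)) < dist (u : ℂ) (D.center (.inl (0, false))) := by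
      by_contra! hcon
      exact absurd hu (D.norm_lt_one_of_mem_closedBall hcon).ne
    rw [map, if_pos h1.le, lower, S.outside _ hu.ge, hu, S.eq₁ _ fun h => (S.B_subset h).1.ne hu, hK]
    norm_num
  top u := by
    have hd : dist (D.pullC none + D.pullR none * u) (D.pullC none) = D.pullR none := by
      rw [dist_eq_norm, add_sub_cancel_left, norm_mul, Circle.norm_coe, mul_one,
        Complex.norm_real, Real.norm_eq_abs, abs_of_pos (D.pullR_pos (by simp))]
    have h1 := D.dist_center_lt_of_pull (i := none) (by simp) hd.le
    have hzp : D.pullC none + D.pullR none * u ≠ D.pole 0 := by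
      intro h
      rw [h] at hd
      exact absurd hd D.dist_pole_pullC_none_lt.ne
    have hn := (D.dist_pullC_none_eq_iff hzp).mp hd
    change S.map (D.pullC none + D.pullR none * u) = _
    rw [map, if_neg (not_le.mpr h1), upper, S.top₂, S.outside _ hn.ge, hn, hK]
    norm_num [Knot.reverse]
  interior z hz hz1 hz2 := by
    simp only [map]
    split_ifs with h
    · exact S.mem_Ioo z hz1
    · have hzp := D.ne_pole_of_mem_double hz
      have h1 : ‖mobius (D.glue 0) z‖ < 1 := by
        by_contra! hcon
        exact absurd ((D.dist_pullC_none_le_iff hzp).mpr hcon) (not_le.mpr hz2)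
      have := S.mem_Ioo _ h1
      constructor <;> simp only [upper] <;> linarith [this.1, this.2]

theorem eventually_map_eq_lower_of_norm {z : ℂ} (hφ : D.IsSmoothEmbedding φ) (hz : ‖z‖ = 1) :
    S.map =ᶠ[𝓝 z] S.lower := by
  refine S.map_eventuallyEq_lower hφ ?_
  by_contra! hcon
  exact absurd hz (D.norm_lt_one_of_mem_closedBall hcon.le).ne

theorem ne_pole_of_top {z : ℂ} (hz : dist z (D.pullC none) = D.pullR none) : z ≠ D.pole 0 := by
  rintro rfl
  exact absurd hz D.dist_pole_pullC_none_lt.ne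

theorem eventually_map_eq_upper_of_top {z : ℂ} (hφ : D.IsSmoothEmbedding φ)
    (hz : dist z (D.pullC none) = D.pullR none) : S.map =ᶠ[𝓝 z] S.upper :=
  S.map_eventuallyEq_upper hφ (D.dist_center_lt_of_pull (i := none) (by simp) hz.le).le

theorem fderiv_height_ne_zero_bottom {z : ℂ} (hφ : D.IsSmoothEmbedding φ) (hz : ‖z‖ = 1) :
    fderiv ℝ (fun w => (S.map w).2) z ≠ 0 := by
  have e : (fun w => (S.map w).2) =ᶠ[𝓝 z] fun w => (S.lower w).2 :=
      (S.eventually_map_eq_lower_of_norm hφ hz).fun_comp Prod.snd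
  rw [Filter.EventuallyEq.fderiv_eq e]
  exact S.fderiv_ne_zero hz

theorem fderiv_height_ne_zero_top {z : ℂ} (hφ : D.IsSmoothEmbedding φ)
    (hz : dist z (D.pullC none) = D.pullR none) : fderiv ℝ (fun w => (S.map w).2) z ≠ 0 := by
  have hzp := ne_pole_of_top hz
  have hn := (D.dist_pullC_none_eq_iff hzp).mp hz
  have e : (fun w => (S.map w).2) =ᶠ[𝓝 z] fun w => (S.upper w).2 :=
      (S.eventually_map_eq_upper_of_top hφ hz).fun_comp Prod.snd
  rw [Filter.EventuallyEq.fderiv_eq e]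
  have h1 : fderiv ℝ (fun w => 1 - S.h (mobius (D.glue 0) w)) z =
      -((fderiv ℝ S.h (mobius (D.glue 0) z)).comp (fderiv ℝ (mobius (D.glue 0)) z)) := by
    rw [fderiv_const_sub]
    exact congrArg Neg.neg (fderiv_comp z (S.smooth.differentiable (by simp) _)
      ((D.contDiffAt_mobius 0 hzp).differentiableAt (by simp)))
  change fderiv ℝ (fun w => 1 - S.h (mobius (D.glue 0) w)) z ≠ 0
  rw [h1, neg_ne_zero]
  intro h0
  refine S.fderiv_ne_zero hn ?_
  ext ζ
  obtain ⟨ξ, hξ⟩ := (LinearMap.injective_iff_surjective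
    (f := (fderiv ℝ (mobius (D.glue 0)) z : ℂ →ₗ[ℝ] ℂ))).mp (D.injective_fderiv_mobius 0 hzp) ζ
  have := DFunLike.congr_fun h0 ξ
  rw [← hξ]
  exact this

/-- Near the lower end, parameters outside the domain are sent out of the slab, so the extended map
adds no points to the surface in S³ × [0,1]. -/
theorem eventually_map_snd_neg {z : ℂ} (hφ : D.IsSmoothEmbedding φ) (hz : ‖z‖ = 1) :
    ∀ᶠ w in 𝓝 z, 1 < ‖w‖ → (S.map w).2 < 0 := by
  filter_upwards [S.eventually_map_eq_lower_of_norm hφ hz] with w hw h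
  rw [hw, lower, S.outside w h.le]
  simp only; nlinarith

theorem eventually_one_lt_map_snd {z : ℂ} (hφ : D.IsSmoothEmbedding φ)
    (hz : dist z (D.pullC none) = D.pullR none) :
    ∀ᶠ w in 𝓝 z, dist w (D.pullC none) < D.pullR none → 1 < (S.map w).2 := by
  filter_upwards [S.eventually_map_eq_upper_of_top hφ hz,
    isOpen_ne.mem_nhds (ne_pole_of_top hz)] with w hw hwp h
  have h1 := (D.dist_pullC_none_lt_iff hwp).mp h
  rw [hw, upper, S.outside _ h1.le]
  simp only; nlinarith

end Sheets

end HandleDisc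

end KnotCobordism

end

/-! ### Flat charts from the inverse function theorem. -/

open scoped Manifold ContDiff Topology ComplexConjugate

noncomputable section

namespace KnotCobordism

/-- The radial projection to the sphere (with a junk value at the origin). -/
def toSphere (y : E4) : S3 :=
  if h : y = 0 then ⟨EuclideanSpace.single 0 1, by simp⟩
  else ⟨‖y‖⁻¹ • y, by
    rw [mem_sphere_zero_iff_norm, norm_smul, norm_inv, norm_norm,
      inv_mul_cancel₀ (norm_ne_zero_iff.mpr h)]⟩

theorem coe_toSphere {y : E4} (h : y ≠ 0) : (toSphere y : E4) = ‖y‖⁻¹ • y := by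
  rw [toSphere, dif_neg h]

/-- The inverse function theorem for a map between spaces of the same dimension. -/
theorem exists_openPartialHomeomorph {E F : Type*} [NormedAddCommGroup E] [NormedSpace ℝ E]
    [FiniteDimensional ℝ E] [NormedAddCommGroup F] [NormedSpace ℝ F] [FiniteDimensional ℝ F]
    (hEF : Module.finrank ℝ E = Module.finrank ℝ F) {f : E → F} {a : E}
    (hf : ContDiffAt ℝ ∞ f a) (hinj : Function.Injective (fderiv ℝ f a)) :
    ∃ e : OpenPartialHomeomorph E F, a ∈ e.source ∧ ∀ x, e x = f x := by
  have hcomplete : CompleteSpace E := FiniteDimensional.complete ℝ E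
  set L : E ≃ₗ[ℝ] F := LinearEquiv.ofInjectiveOfFinrankEq (fderiv ℝ f a : E →ₗ[ℝ] F) hinj hEF
  set L' : E ≃L[ℝ] F := L.toContinuousLinearEquiv
  have hL : (L' : E →L[ℝ] F) = fderiv ℝ f a := by
    ext x; rfl
  have h1 : HasFDerivAt f (L' : E →L[ℝ] F) a := by
    rw [hL]; exact (hf.differentiableAt (by simp)).hasFDerivAt
  refine ⟨hf.toOpenPartialHomeomorph f h1 (by simp), hf.mem_toOpenPartialHomeomorph_source h1 _,
    fun x => rfl⟩

/-- The inclusion of `S³ × [0, 1]`. -/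
def incl (q : S3 × unitInterval) : E4 × ℝ := ((q.1 : E4), (q.2 : ℝ))

theorem continuous_incl : Continuous incl := by unfold incl; fun_prop

theorem incl_injective : Function.Injective incl := by
  rintro ⟨a, b⟩ ⟨a', b'⟩ h
  obtain ⟨h1, h2⟩ := Prod.mk.inj h
  exact Prod.ext (Subtype.ext h1) (Subtype.ext h2)

section Chart

variable {Φ : ℂ → E4 × ℝ} {z₀ : ℂ} {k : ℂ → ℝ} {c : ℝ} {v : E4}

/-- A thickening of a surface in `S³ × ℝ`, radially extended. -/
def thicken (Φ : ℂ → E4 × ℝ) (v : E4) (x : (ℂ × ℝ × ℝ) × ℝ) : E4 × ℝ :=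
  (x.2 • ((Φ x.1.1).1 + x.1.2.1 • v), (Φ x.1.1).2 + x.1.2.2)

theorem contDiffAt_thicken (hΦ : ContDiffAt ℝ ∞ Φ z₀) :
    ContDiffAt ℝ ∞ (thicken Φ v) ((z₀, 0, 0), 1) := by
  have h : ContDiffAt ℝ ∞ (fun x : (ℂ × ℝ × ℝ) × ℝ => Φ x.1.1) ((z₀, 0, 0), 1) :=
    ContDiffAt.comp (g := Φ) (f := fun x : (ℂ × ℝ × ℝ) × ℝ => x.1.1) _ hΦ (by fun_prop)
  have h1 := h.fst
  have h2 := h.snd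
  unfold thicken
  fun_prop

theorem fderiv_thicken (hΦ : ContDiffAt ℝ ∞ Φ z₀) (w : (ℂ × ℝ × ℝ) × ℝ) :
    fderiv ℝ (thicken Φ v) ((z₀, 0, 0), 1) w =
      (w.2 • (Φ z₀).1 + ((fderiv ℝ Φ z₀ w.1.1).1 + w.1.2.1 • v),
        (fderiv ℝ Φ z₀ w.1.1).2 + w.1.2.2) := by
  have hd := (hΦ.differentiableAt (by simp)).hasFDerivAt
  set a : (ℂ × ℝ × ℝ) × ℝ := ((z₀, 0, 0), 1)
  set P₁ := ContinuousLinearMap.fst ℝ (ℂ × ℝ × ℝ) ℝ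
  have hz : HasFDerivAt (fun x : (ℂ × ℝ × ℝ) × ℝ => x.1.1)
    ((ContinuousLinearMap.fst ℝ ℂ (ℝ × ℝ)).comp P₁) a :=
    ((ContinuousLinearMap.fst ℝ ℂ (ℝ × ℝ)).comp P₁).hasFDerivAt
  have hs : HasFDerivAt (fun x : (ℂ × ℝ × ℝ) × ℝ => x.1.2.1)
    (((ContinuousLinearMap.fst ℝ ℝ ℝ).comp (ContinuousLinearMap.snd ℝ ℂ (ℝ × ℝ))).comp P₁) a :=
    (((ContinuousLinearMap.fst ℝ ℝ ℝ).comp (ContinuousLinearMap.snd ℝ ℂ (ℝ × ℝ))).comp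
      P₁).hasFDerivAt
  have ht : HasFDerivAt (fun x : (ℂ × ℝ × ℝ) × ℝ => x.1.2.2)
    (((ContinuousLinearMap.snd ℝ ℝ ℝ).comp (ContinuousLinearMap.snd ℝ ℂ (ℝ × ℝ))).comp P₁) a :=
    (((ContinuousLinearMap.snd ℝ ℝ ℝ).comp (ContinuousLinearMap.snd ℝ ℂ (ℝ × ℝ))).comp
      P₁).hasFDerivAt
  have hr : HasFDerivAt (fun x : (ℂ × ℝ × ℝ) × ℝ => x.2)
    (ContinuousLinearMap.snd ℝ (ℂ × ℝ × ℝ) ℝ) a := hasFDerivAt_snd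
  have hΦ' : HasFDerivAt (fun x : (ℂ × ℝ × ℝ) × ℝ => Φ x.1.1) _ a :=
    HasFDerivAt.comp (g := Φ) (f := fun x : (ℂ × ℝ × ℝ) × ℝ => x.1.1) a hd hz
  have key := (hr.smul (hΦ'.fst.add (hs.smul_const v))).prodMk (hΦ'.snd.add ht)
  have e : fderiv ℝ (thicken Φ v) a = _ := key.fderiv
  rw [e]
  simp [a, P₁]
  abel

theorem fderiv_fst_apply (hΦ : ContDiffAt ℝ ∞ Φ z₀) (ζ : ℂ) :
    fderiv ℝ (fun w => (Φ w).1) z₀ ζ = (fderiv ℝ Φ z₀ ζ).1 := by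
  have e : fderiv ℝ (fun w => (Φ w).1) z₀ = _ :=
    ((hΦ.differentiableAt (by simp)).hasFDerivAt.fst).fderiv
  rw [e]; rfl

/-- The derivative is injective because the position, the tangent plane and the normal v span ℝ⁴,
while the last parameter moves the height alone. The radial parameter replaces the sphere by an open
set of ℝ⁴, where the inverse function theorem for vector spaces applies. -/
theorem exists_thicken (hΦ : ContDiffAt ℝ ∞ Φ z₀) (hn : ‖(Φ z₀).1‖ = 1)
    (himm : Function.Injective (fderiv ℝ (fun w => (Φ w).1) z₀))
    (horth : ∀ ζ, inner ℝ (Φ z₀).1 (fderiv ℝ (fun w => (Φ w).1) z₀ ζ) = 0) :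
    ∃ (v : E4) (e : OpenPartialHomeomorph ((ℂ × ℝ × ℝ) × ℝ) (E4 × ℝ)),
      ((z₀, 0, 0), 1) ∈ e.source ∧ ∀ x, e x = thicken Φ v x := by
  set L := fderiv ℝ (fun w => (Φ w).1) z₀
  have hp0 : (Φ z₀).1 ≠ 0 := by
    intro h; rw [h, norm_zero] at hn; norm_num at hn
  set v := cross (Φ z₀).1 (L 1) (L Complex.I) with hv
  have hv0 : v ≠ 0 := cross_fderiv_ne_zero hp0 himm horth
  refine ⟨v, exists_openPartialHomeomorph (by simp) (contDiffAt_thicken hΦ) ?_⟩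
  rw [injective_iff_map_eq_zero]
  rintro ⟨⟨ζ, σ, τ⟩, ρ⟩ h
  rw [fderiv_thicken hΦ, ← fderiv_fst_apply hΦ] at h
  obtain ⟨h1, h2⟩ := Prod.mk.inj h
  simp only at h1 h2
  have h3 : inner ℝ v (L ζ) = 0 := inner_cross_fderiv _ _ _
  have h4 : inner ℝ v (Φ z₀).1 = 0 := inner_cross_left _ _ _
  have hσ : σ = 0 := by
    have := congrArg (inner ℝ v) h1
    rw [inner_add_right, inner_add_right, inner_smul_right, h4, h3, inner_smul_right,
      real_inner_self_eq_norm_sq, inner_zero_right] at this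
    simpa [hv0] using this
  have hρ : ρ = 0 := by
    have := congrArg (inner ℝ (Φ z₀).1) h1
    rw [inner_add_right, inner_add_right, inner_smul_right, horth, hσ, zero_smul,
      real_inner_self_eq_norm_sq, inner_zero_right, hn] at this
    simpa using this
  have hζ : ζ = 0 := by
    rw [hσ, hρ, zero_smul, zero_smul, zero_add, add_zero] at h1
    exact himm (h1.trans (map_zero _).symm)
  rw [hζ] at h2
  have hτ : τ = 0 := by simpa using h2
  rw [hζ, hσ, hρ, hτ]; rfl

/-- Coordinates in which the first one is `k`. -/
def flatCoord (k : ℂ → ℝ) (ℓ : ℂ →L[ℝ] ℝ) (c : ℝ) (x : ℂ × ℝ × ℝ) : E4 :=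
  !₂[k x.1 + c * x.2.2, ℓ x.1, x.2.1, x.2.2]

theorem contDiffAt_flatCoord {ℓ : ℂ →L[ℝ] ℝ} (hk : ContDiffAt ℝ ∞ k z₀) :
    ContDiffAt ℝ ∞ (flatCoord k ℓ c) (z₀, 0, 0) := by
  have h : ContDiffAt ℝ ∞ (fun x : ℂ × ℝ × ℝ => k x.1) (z₀, 0, 0) :=
    ContDiffAt.comp (g := k) (f := fun x : ℂ × ℝ × ℝ => x.1) _ hk (by fun_prop)
  rw [contDiffAt_piLp]
  intro i
  fin_cases i <;> simp [flatCoord] <;> fun_prop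

theorem exists_flatCoord (c : ℝ) (hk : ContDiffAt ℝ ∞ k z₀) (hk' : fderiv ℝ k z₀ ≠ 0) :
    ∃ (ℓ : ℂ →L[ℝ] ℝ) (e : OpenPartialHomeomorph (ℂ × ℝ × ℝ) E4),
      (z₀, 0, 0) ∈ e.source ∧ ∀ x, e x = flatCoord k ℓ c x := by
  -- Multiplication by i turns the kernel line of dk away from itself, so dk and ℓ together are
  -- coordinates on ℂ.
  set ℓ : ℂ →L[ℝ] ℝ := (fderiv ℝ k z₀).comp (ContinuousLinearMap.mul ℝ ℂ Complex.I) with hℓ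
  refine ⟨ℓ, exists_openPartialHomeomorph (by simp) (contDiffAt_flatCoord (c := c) hk) ?_⟩
  have hd := ((contDiffAt_flatCoord (c := c) (ℓ := ℓ) hk).differentiableAt (by simp)).hasFDerivAt
  have hcomp : ∀ i : Fin 4, HasFDerivAt (fun x => flatCoord k ℓ c x i)
      ((EuclideanSpace.proj i : E4 →L[ℝ] ℝ).comp (fderiv ℝ (flatCoord k ℓ c) (z₀, 0, 0)))
      (z₀, 0, 0) := fun i => (EuclideanSpace.proj i : E4 →L[ℝ] ℝ).hasFDerivAt.comp _ hd
  have hz : HasFDerivAt (fun x : ℂ × ℝ × ℝ => x.1) (ContinuousLinearMap.fst ℝ ℂ (ℝ × ℝ))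
    (z₀, (0 : ℝ), (0 : ℝ)) := hasFDerivAt_fst
  have hs : HasFDerivAt (fun x : ℂ × ℝ × ℝ => x.2.1) ((ContinuousLinearMap.fst ℝ ℝ ℝ).comp
    (ContinuousLinearMap.snd ℝ ℂ (ℝ × ℝ))) (z₀, (0 : ℝ), (0 : ℝ)) :=
    ((ContinuousLinearMap.fst ℝ ℝ ℝ).comp (ContinuousLinearMap.snd ℝ ℂ (ℝ × ℝ))).hasFDerivAt
  have ht : HasFDerivAt (fun x : ℂ × ℝ × ℝ => x.2.2) ((ContinuousLinearMap.snd ℝ ℝ ℝ).comp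
    (ContinuousLinearMap.snd ℝ ℂ (ℝ × ℝ))) (z₀, (0 : ℝ), (0 : ℝ)) :=
    ((ContinuousLinearMap.snd ℝ ℝ ℝ).comp (ContinuousLinearMap.snd ℝ ℂ (ℝ × ℝ))).hasFDerivAt
  have hkz : HasFDerivAt (fun x : ℂ × ℝ × ℝ => k x.1) _ (z₀, (0 : ℝ), (0 : ℝ)) :=
    HasFDerivAt.comp (g := k) (f := fun x : ℂ × ℝ × ℝ => x.1) (z₀, (0 : ℝ), (0 : ℝ))
      (hk.differentiableAt (by simp)).hasFDerivAt hz
  have hℓz : HasFDerivAt (fun x : ℂ × ℝ × ℝ => ℓ x.1) _ (z₀, (0 : ℝ), (0 : ℝ)) :=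
    (ℓ.comp (ContinuousLinearMap.fst ℝ ℂ (ℝ × ℝ))).hasFDerivAt
  have e0 := (hcomp 0).unique (hkz.add (ht.const_mul c))
  have e1 := (hcomp 1).unique hℓz
  have e2 := (hcomp 2).unique hs
  have e3 := (hcomp 3).unique ht
  rw [injective_iff_map_eq_zero]
  rintro ⟨ζ, σ, τ⟩ h
  have f0 := DFunLike.congr_fun e0 (ζ, σ, τ)
  have f1 := DFunLike.congr_fun e1 (ζ, σ, τ)
  have f2 := DFunLike.congr_fun e2 (ζ, σ, τ)
  have f3 := DFunLike.congr_fun e3 (ζ, σ, τ)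
  simp only [ContinuousLinearMap.comp_apply, h, map_zero] at f0 f1 f2 f3
  have hσ : σ = 0 := f2.symm
  have hτ : τ = 0 := f3.symm
  have hk0 : fderiv ℝ k z₀ ζ = 0 := by
    simpa [hτ] using f0.symm
  have hℓ0 : fderiv ℝ k z₀ (Complex.I * ζ) = 0 := f1.symm
  have hζ : ζ = 0 := by
    by_contra hne
    apply hk'
    ext w
    obtain ⟨t, rfl⟩ : ∃ t, w = t * ζ := ⟨w / ζ, (div_mul_cancel₀ w hne).symm⟩
    have : t * ζ = t.re • ζ + t.im • (Complex.I * ζ) := by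
      conv_lhs => rw [← Complex.re_add_im t]
      simp only [Complex.real_smul]; ring
    rw [this, map_add, map_smul, map_smul, hk0, hℓ0]; simp
  rw [hζ, hσ, hτ]; rfl

end Chart

end KnotCobordism

end

open scoped Manifold ContDiff Topology ComplexConjugate

noncomputable section

namespace KnotCobordism

/-- The chart is the inverse of the thickening followed by the flat coordinates. By `hsgn` its first
coordinate is nonnegative exactly when the height lies in [0,1], so S³ × [0,1] becomes the
half-space; the surface becomes the locus where both normal parameters vanish. The hypotheses `hin`
and `hout` say that near the point the set F is the image of a neighbourhood of z₀, cut by the slab.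
-/
theorem exists_flat_chart {Φ : ℂ → E4 × ℝ} {F : Set (S3 × unitInterval)} {z₀ : ℂ}
    (hΦ : ContDiffAt ℝ ∞ Φ z₀) (hn : ‖(Φ z₀).1‖ = 1)
    (himm : Function.Injective (fderiv ℝ (fun w => (Φ w).1) z₀))
    (horth : ∀ ζ, inner ℝ (Φ z₀).1 (fderiv ℝ (fun w => (Φ w).1) z₀ ζ) = 0)
    {k : ℂ → ℝ} {c : ℝ} (hk : ContDiffAt ℝ ∞ k z₀) (hk' : fderiv ℝ k z₀ ≠ 0)
    (hsgn : ∀ᶠ p : ℂ × ℝ in 𝓝 (z₀, 0),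
      (Φ p.1).2 + p.2 ∈ Set.Icc (0 : ℝ) 1 ↔ 0 ≤ k p.1 + c * p.2)
    (hin : ∀ᶠ z in 𝓝 z₀, (Φ z).2 ∈ Set.Icc (0 : ℝ) 1 → ∃ q ∈ F, incl q = Φ z)
    (hout : ∀ U ∈ 𝓝 z₀, ∃ W ∈ 𝓝 (Φ z₀), ∀ q ∈ F, incl q ∈ W → ∃ z ∈ U, incl q = Φ z)
    {p : S3 × unitInterval} (hp : incl p = Φ z₀) :
    ∃ e : OpenPartialHomeomorph (S3 × unitInterval) (EuclideanHalfSpace 4),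
      p ∈ e.source ∧ ∀ q ∈ e.source, q ∈ F ↔ (e q).val 2 = 0 ∧ (e q).val 3 = 0 := by
  obtain ⟨v, G, hG₀, hG⟩ := exists_thicken hΦ hn himm horth
  obtain ⟨ℓ, E, hE₀, hE⟩ := exists_flatCoord c hk hk'
  set x₀ : ℂ × ℝ × ℝ := (z₀, 0, 0) with hx₀
  set y : ℂ × ℝ × ℝ → E4 := fun x => (Φ x.1).1 + x.2.1 • v with hy
  set T : ℂ × ℝ × ℝ → ℝ := fun x => (Φ x.1).2 + x.2.2 with hT
  have hGv : ∀ x ρ, G (x, ρ) = (ρ • y x, T x) := fun x ρ => hG (x, ρ)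
  have hy₀ : y x₀ = (Φ z₀).1 := by simp [hy, hx₀]
  have hyne₀ : y x₀ ≠ 0 := by
    rw [hy₀]; intro h; rw [h, norm_zero] at hn; norm_num at hn
  have hT₀ : T x₀ = (Φ z₀).2 := by simp [hT, hx₀]
  have hfst : Filter.Tendsto (fun x : ℂ × ℝ × ℝ => x.1) (𝓝 x₀) (𝓝 z₀) :=
    continuous_fst.tendsto x₀
  have hΦc : ∀ᶠ z in 𝓝 z₀, ContinuousAt Φ z := by
    filter_upwards [(hΦ.of_le (m := 1) (by simp)).eventually (by simp)] with z hz
      using hz.continuousAt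
  have hyc : ∀ x : ℂ × ℝ × ℝ, ContinuousAt Φ x.1 → ContinuousAt y x := by
    intro x hx
    have h1 : ContinuousAt (fun x : ℂ × ℝ × ℝ => (Φ x.1).1) x :=
      continuous_fst.continuousAt.comp (ContinuousAt.comp (g := Φ)
        (f := fun x : ℂ × ℝ × ℝ => x.1) hx continuous_fst.continuousAt)
    exact h1.add (by fun_prop)
  have hTc : ∀ x : ℂ × ℝ × ℝ, ContinuousAt Φ x.1 → ContinuousAt T x := by
    intro x hx
    have h1 : ContinuousAt (fun x : ℂ × ℝ × ℝ => (Φ x.1).2) x :=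
      continuous_snd.continuousAt.comp (ContinuousAt.comp (g := Φ)
        (f := fun x : ℂ × ℝ × ℝ => x.1) hx continuous_fst.continuousAt)
    exact h1.add (by fun_prop)
  have hyc₀ := hyc x₀ hΦ.continuousAt
  have hTc₀ := hTc x₀ hΦ.continuousAt
  have hρc₀ : ContinuousAt (fun x => ‖y x‖⁻¹) x₀ :=
    hyc₀.norm.inv₀ (norm_ne_zero_iff.mpr hyne₀)
  have hρ₀ : ‖y x₀‖⁻¹ = 1 := by rw [hy₀, hn, inv_one]
  -- Points of F near p must come from parameters at which the thickening is invertible.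
  obtain ⟨W, hW, hWF⟩ := hout {z | ((z, (0 : ℝ), (0 : ℝ)), (1 : ℝ)) ∈ G.source}
    ((by fun_prop : Continuous fun z : ℂ => ((z, (0 : ℝ), (0 : ℝ)), (1 : ℝ))).continuousAt
      |>.preimage_mem_nhds (G.open_source.mem_nhds hG₀))
  have hev : ∀ᶠ x in 𝓝 x₀, x ∈ E.source ∧ y x ≠ 0 ∧ (x, ‖y x‖⁻¹) ∈ G.source ∧
      (T x ∈ Set.Icc (0 : ℝ) 1 ↔ 0 ≤ k x.1 + c * x.2.2) ∧
      ((Φ x.1).2 ∈ Set.Icc (0 : ℝ) 1 → ∃ q ∈ F, incl q = Φ x.1) ∧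
      (‖y x‖⁻¹ • y x, T x) ∈ W ∧ ContinuousAt Φ x.1 := by
    have h1 := E.open_source.mem_nhds hE₀
    have h2 : ∀ᶠ x in 𝓝 x₀, y x ≠ 0 := hyc₀.eventually (isOpen_ne.mem_nhds hyne₀)
    have h3 : ∀ᶠ x in 𝓝 x₀, (x, ‖y x‖⁻¹) ∈ G.source :=
      (continuousAt_id.prodMk hρc₀).eventually (G.open_source.mem_nhds (by
        show (x₀, ‖y x₀‖⁻¹) ∈ G.source
        rw [hρ₀]; exact hG₀))
    have h4 : ∀ᶠ x in 𝓝 x₀, (T x ∈ Set.Icc (0 : ℝ) 1 ↔ 0 ≤ k x.1 + c * x.2.2) :=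
      ((by fun_prop : Continuous fun x : ℂ × ℝ × ℝ => (x.1, x.2.2)).tendsto x₀).eventually hsgn
    have h6 : ∀ᶠ x in 𝓝 x₀, (‖y x‖⁻¹ • y x, T x) ∈ W :=
      ((hρc₀.smul hyc₀).prodMk hTc₀).eventually (by
        show W ∈ 𝓝 (‖y x₀‖⁻¹ • y x₀, T x₀)
        rw [hρ₀, hy₀, hT₀, one_smul]; exact hW)
    filter_upwards [h1, h2, h3, h4, hfst.eventually hin, h6, hfst.eventually hΦc]
      with x a1 a2 a3 a4 a5 a6 a7 using ⟨a1, a2, a3, a4, a5, a6, a7⟩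
  obtain ⟨O, hO, hOo, hxO⟩ := eventually_nhds_iff.mp hev
  have hE0 : ∀ x, E x 0 = k x.1 + c * x.2.2 := fun x => by rw [hE]; rfl
  have hE2 : ∀ x, E x 2 = x.2.1 := fun x => by rw [hE]; rfl
  have hE3 : ∀ x, E x 3 = x.2.2 := fun x => by rw [hE]; rfl
  -- The inverse of the half-space model is a retraction of ℝ⁴; on the half-space it changes
  -- nothing.
  have hretr : ∀ w : E4, 0 ≤ w 0 → ((𝓡∂ 4).symm w).val = w := fun w hw =>
    (𝓡∂ 4).right_inv (by rw [range_modelWithCornersEuclideanHalfSpace]; exact hw)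
  -- points of the source in coordinates
  have hsrc : ∀ q : S3 × unitInterval, incl q ∈ G.target → (G.symm (incl q)).1 ∈ O →
      0 < (G.symm (incl q)).2 → incl q = (‖y (G.symm (incl q)).1‖⁻¹ • y (G.symm (incl q)).1,
        T (G.symm (incl q)).1) := by
    intro q h1 h2 h3
    have h4 := G.right_inv h1
    set w := G.symm (incl q)
    rw [← Prod.mk.eta (p := w), hGv] at h4
    have h5 : w.2 • y w.1 = (q.1 : E4) := (Prod.mk.inj h4).1
    -- On the sphere the radial parameter is forced to be 1 / ‖y‖, so it may be dropped.
    have h6 : ‖(q.1 : E4)‖ = 1 := by simp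
    rw [← h5, norm_smul, Real.norm_eq_abs, abs_of_pos h3] at h6
    rw [← eq_inv_of_mul_eq_one_left h6]
    exact h4.symm
  have hTmem : ∀ q : S3 × unitInterval, incl q ∈ G.target → (G.symm (incl q)).1 ∈ O →
      0 < (G.symm (incl q)).2 → T (G.symm (incl q)).1 ∈ Set.Icc (0 : ℝ) 1 := by
    intro q h1 h2 h3
    have := (Prod.mk.inj (hsrc q h1 h2 h3)).2
    rw [← this]; exact q.2.2
  have hval : ∀ q : S3 × unitInterval, incl q ∈ G.target → (G.symm (incl q)).1 ∈ O →
      0 < (G.symm (incl q)).2 →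
      ((𝓡∂ 4).symm (E (G.symm (incl q)).1)).val = E (G.symm (incl q)).1 := by
    intro q h1 h2 h3
    refine hretr _ ?_
    rw [hE0]
    exact (hO _ h2).2.2.2.1.mp (hTmem q h1 h2 h3)
  -- points of the target in coordinates
  have htgt : ∀ x ∈ O, T x ∈ Set.Icc (0 : ℝ) 1 →
      incl (toSphere (y x), Set.projIcc 0 1 zero_le_one (T x)) = G (x, ‖y x‖⁻¹) := by
    intro x hx hTx
    rw [hGv, incl, coe_toSphere (hO x hx).2.1, Set.projIcc_of_mem _ hTx]
  have hTx : ∀ w : EuclideanHalfSpace 4, w.val ∈ E.target → E.symm w.val ∈ O →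
      T (E.symm w.val) ∈ Set.Icc (0 : ℝ) 1 := by
    intro w h1 h2
    rw [(hO _ h2).2.2.2.1, ← hE0, E.right_inv h1]
    exact w.2
  refine ⟨{
    toFun := fun q => (𝓡∂ 4).symm (E (G.symm (incl q)).1)
    invFun := fun w => (toSphere (y (E.symm w.val)),
      Set.projIcc 0 1 zero_le_one (T (E.symm w.val)))
    source := {q | incl q ∈ G.target ∧ (G.symm (incl q)).1 ∈ O ∧ 0 < (G.symm (incl q)).2}
    target := {w | w.val ∈ E.target ∧ E.symm w.val ∈ O}
    map_source' := ?_
    map_target' := ?_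
    left_inv' := ?_
    right_inv' := ?_
    open_source := ?_
    open_target := ?_
    continuousOn_toFun := ?_
    continuousOn_invFun := ?_ }, ?_, ?_⟩
  · rintro q ⟨h1, h2, h3⟩
    rw [Set.mem_ofPred_eq, hval q h1 h2 h3]
    exact ⟨E.map_source (hO _ h2).1, by rwa [E.left_inv (hO _ h2).1]⟩
  · rintro w ⟨h1, h2⟩
    have h3 := htgt _ h2 (hTx w h1 h2)
    have h4 := (hO _ h2).2.2.1
    refine ⟨?_, ?_, ?_⟩
    · rw [h3]; exact G.map_source h4
    · rw [h3, G.left_inv h4]; exact h2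
    · rw [h3, G.left_inv h4]
      exact inv_pos.mpr (norm_pos_iff.mpr (hO _ h2).2.1)
  · rintro q ⟨h1, h2, h3⟩
    apply incl_injective
    simp only [hval q h1 h2 h3, E.left_inv (hO _ h2).1]
    rw [htgt _ h2 (hTmem q h1 h2 h3), hGv, ← hsrc q h1 h2 h3]
  · rintro w ⟨h1, h2⟩
    simp only [htgt _ h2 (hTx w h1 h2), G.left_inv (hO _ h2).2.2.1, E.right_inv h1]
    exact (𝓡∂ 4).left_inv w
  · refine (𝓡∂ 4).continuous_symm.comp_continuousOn ?_
    refine E.continuousOn.comp (continuous_fst.comp_continuousOn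
      (G.symm.continuousOn.comp continuous_incl.continuousOn fun q hq => hq.1))
      fun q hq => (hO _ hq.2.1).1
  · have hsymm : ContinuousOn (fun w : EuclideanHalfSpace 4 => E.symm w.val)
        {w | w.val ∈ E.target ∧ E.symm w.val ∈ O} :=
      E.symm.continuousOn.comp continuous_subtype_val.continuousOn fun w hw => hw.1
    refine ContinuousOn.prodMk ?_ ?_
    · rw [Topology.IsInducing.subtypeVal.continuousOn_iff]
      have h1 : ContinuousOn (fun x => ‖y x‖⁻¹ • y x) O := fun x hx => by
        have := hyc x (hO x hx).2.2.2.2.2.2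
        exact ((this.norm.inv₀ (norm_ne_zero_iff.mpr (hO x hx).2.1)).smul
          this).continuousWithinAt
      refine (h1.comp hsymm fun w hw => hw.2).congr fun w hw => ?_
      exact coe_toSphere (hO _ hw.2).2.1
    · have h1 : ContinuousOn T O := fun x hx =>
        (hTc x (hO x hx).2.2.2.2.2.2).continuousWithinAt
      exact continuous_projIcc.comp_continuousOn (h1.comp hsymm fun w hw => hw.2)
  · have h := G.symm.isOpen_inter_preimage (hOo.prod (isOpen_Ioi (a := (0 : ℝ))))
    exact h.preimage continuous_incl
  · exact (E.symm.isOpen_inter_preimage hOo).preimage continuous_subtype_val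
  · have h1 : incl p = G (x₀, 1) := by
      rw [hp, hGv, hy₀, hT₀, one_smul]
    refine ⟨?_, ?_, ?_⟩
    · rw [h1]; exact G.map_source hG₀
    · rw [h1, G.left_inv hG₀]; exact hxO
    · rw [h1, G.left_inv hG₀]; exact one_pos
  · rintro q ⟨h1, h2, h3⟩
    change q ∈ F ↔ ((𝓡∂ 4).symm (E (G.symm (incl q)).1)).val 2 = 0 ∧
      ((𝓡∂ 4).symm (E (G.symm (incl q)).1)).val 3 = 0
    rw [hval q h1 h2 h3, hE2, hE3]
    have hq := hsrc q h1 h2 h3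
    constructor
    · intro hqF
      obtain ⟨z, hz, hqz⟩ := hWF q hqF (by rw [hq]; exact (hO _ h2).2.2.2.2.2.1)
      have h4 : incl q = G ((z, 0, 0), 1) := by
        rw [hGv, hqz]; simp [hy, hT]
      rw [h4, G.left_inv hz]
      exact ⟨rfl, rfl⟩
    · rintro ⟨hs, ht⟩
      set x := (G.symm (incl q)).1
      have hyx : y x = (Φ x.1).1 := by simp only [hy, hs, zero_smul, add_zero]
      have hTx' : T x = (Φ x.1).2 := by simp only [hT, ht, add_zero]
      obtain ⟨q', hq'F, hq'⟩ := (hO _ h2).2.2.2.2.1 (by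
        rw [← hTx']; exact hTmem q h1 h2 h3)
      have h6 : ‖(Φ x.1).1‖ = 1 := by
        rw [← hq']; simp [incl]
      rw [hyx, hTx', h6, inv_one, one_smul, Prod.mk.eta, ← hq'] at hq
      rwa [incl_injective hq]

namespace HandleDisc

variable {g : ℕ} {D : HandleDisc g 1} {Φ : ℂ → E4 × ℝ} {K₀ K₁ : Knot}

/-- The image of the compact set of parameters outside O is closed and misses p. -/
theorem exists_nhds_localize {m : ℕ} {D : HandleDisc g m} {X : Type*} [TopologicalSpace X]
    [T2Space X] {Φ : ℂ → X}
    (hΦ : ContinuousOn Φ D.domain) {O : Set ℂ} (hO : IsOpen O) {p : X}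
    (h : ∀ w ∈ D.domain, Φ w = p → w ∈ O) :
    ∃ W ∈ 𝓝 p, ∀ w ∈ D.domain, Φ w ∈ W → w ∈ O := by
  have h1 : IsCompact (Φ '' (D.domain \ O)) :=
    (D.isCompact_domain.diff hO).image_of_continuousOn (hΦ.mono Set.sdiff_subset)
  refine ⟨(Φ '' (D.domain \ O))ᶜ, h1.isClosed.isOpen_compl.mem_nhds ?_, fun w hw hw' => ?_⟩
  · rintro ⟨w, ⟨hw, hwO⟩, rfl⟩
    exact hwO (h w hw rfl)
  · by_contra hcon
    exact hw' ⟨w, ⟨hw, hcon⟩, rfl⟩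

/-- The image of a surface in `S³ × [0, 1]`. -/
def imageSet (D : HandleDisc g 1) (Φ : ℂ → E4 × ℝ) : Set (S3 × unitInterval) :=
  {p | ((p.1 : E4), (p.2 : ℝ)) ∈ Φ '' D.domain}

theorem exists_incl_eq (hP : IsProperBetween D Φ K₀ K₁) {z : ℂ} (hz : Φ z ∈ Φ '' D.domain)
    (h : (Φ z).2 ∈ Set.Icc (0 : ℝ) 1) : ∃ q ∈ D.imageSet Φ, incl q = Φ z := by
  obtain ⟨w, hw, hwz⟩ := hz
  have h1 : (Φ z).1 ∈ Metric.sphere (0 : E4) 1 := by rw [← hwz]; exact hP.mem_sphere w hw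
  exact ⟨(⟨(Φ z).1, h1⟩, ⟨(Φ z).2, h⟩), ⟨w, hw, hwz⟩, rfl⟩

section Flat

variable (hE : D.IsSmoothEmbedding Φ) (hP : IsProperBetween D Φ K₀ K₁)
  (himm : ∀ z ∈ D.domain, Function.Injective (fderiv ℝ (fun w => (Φ w).1) z))

include hE hP himm

/-- Local flatness at a point, from a description of the surface near it. -/
theorem exists_flat_chart_of_local {z₀ : ℂ} (hz₀ : z₀ ∈ D.domain) {k : ℂ → ℝ} {c : ℝ}
    (hk : ContDiffAt ℝ ∞ k z₀) (hk' : fderiv ℝ k z₀ ≠ 0)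
    (hsgn : ∀ᶠ p : ℂ × ℝ in 𝓝 (z₀, 0),
      (Φ p.1).2 + p.2 ∈ Set.Icc (0 : ℝ) 1 ↔ 0 ≤ k p.1 + c * p.2)
    (hin : ∀ᶠ z in 𝓝 z₀, (Φ z).2 ∈ Set.Icc (0 : ℝ) 1 → Φ z ∈ Φ '' D.domain)
    (hout : ∀ U ∈ 𝓝 z₀, ∃ W ∈ 𝓝 (Φ z₀), ∀ w ∈ D.domain, Φ w ∈ W → ∃ z ∈ U, Φ w = Φ z)
    {p : S3 × unitInterval} (hp : incl p = Φ z₀) :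
    ∃ e : OpenPartialHomeomorph (S3 × unitInterval) (EuclideanHalfSpace 4),
      p ∈ e.source ∧ ∀ q ∈ e.source, q ∈ D.imageSet Φ ↔ (e q).val 2 = 0 ∧ (e q).val 3 = 0 := by
  have hsm := hE.smooth z₀ hz₀
  refine exists_flat_chart (F := D.imageSet Φ) hsm (by simpa using hP.mem_sphere z₀ hz₀)
    (himm z₀ hz₀) (D.inner_fderiv_eq_zero (ψ := fun w => (Φ w).1) hz₀
      (hsm.fst.differentiableAt (by simp)) hP.mem_sphere) hk hk' hsgn ?_ ?_ hp
  · exact hin.mono fun z hz h => exists_incl_eq hP (hz h) h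
  · intro U hU
    obtain ⟨W, hW, hWF⟩ := hout U hU
    refine ⟨W, hW, ?_⟩
    rintro q ⟨w, hw, hwq⟩ hqW
    obtain ⟨z, hz, h⟩ := hWF w hw (by rw [hwq]; exact hqW)
    exact ⟨z, hz, by rw [← h, hwq]; rfl⟩

/-- Local flatness at the points off the boundary. -/
theorem exists_flat_chart_interior {z₀ : ℂ} (hz₀ : z₀ ∈ D.domain)
    (hh : (Φ z₀).2 ∈ Set.Ioo (0 : ℝ) 1)
    (hin : ∀ᶠ z in 𝓝 z₀, Φ z ∈ Φ '' D.domain)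
    (hout : ∀ U ∈ 𝓝 z₀, ∃ W ∈ 𝓝 (Φ z₀), ∀ w ∈ D.domain, Φ w ∈ W → ∃ z ∈ U, Φ w = Φ z)
    {p : S3 × unitInterval} (hp : incl p = Φ z₀) :
    ∃ e : OpenPartialHomeomorph (S3 × unitInterval) (EuclideanHalfSpace 4),
      p ∈ e.source ∧ ∀ q ∈ e.source, q ∈ D.imageSet Φ ↔ (e q).val 2 = 0 ∧ (e q).val 3 = 0 := by
  have hd : HasFDerivAt (fun z : ℂ => 1 + (z.re - z₀.re)) Complex.reCLM z₀ :=
    (Complex.reCLM.hasFDerivAt.sub_const _).const_add _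
  -- Any function positive at z₀ with nonzero derivative serves: off the ends both sides of the sign
  -- condition hold near the point.
  refine exists_flat_chart_of_local hE hP himm hz₀ (k := fun z => 1 + (z.re - z₀.re)) (c := 0)
    (contDiffAt_const.add (Complex.reCLM.contDiff.contDiffAt.sub contDiffAt_const)) ?_ ?_
    (hin.mono fun z hz _ => hz) hout hp
  · rw [hd.fderiv]
    intro h
    have := DFunLike.congr_fun h 1
    simp at this
  · have hc : ContinuousAt (fun p : ℂ × ℝ => (Φ p.1).2 + p.2) (z₀, 0) :=
      (continuous_snd.continuousAt.comp (ContinuousAt.comp (g := Φ) (f := fun x : ℂ × ℝ => x.1)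
        (hE.smooth z₀ hz₀).continuousAt continuous_fst.continuousAt)).add (by fun_prop)
    have hc' : Continuous (fun p : ℂ × ℝ => 1 + (p.1.re - z₀.re) + 0 * p.2) := by fun_prop
    filter_upwards [hc.eventually (Ioo_mem_nhds (by simpa using hh.1) (by simpa using hh.2)),
      (hc'.tendsto (z₀, 0)).eventually (lt_mem_nhds (a := 0) (by simp))] with p h1 h2
    exact ⟨fun _ => h2.le, fun _ => ⟨h1.1.le, h1.2.le⟩⟩

end Flat

end HandleDisc

end KnotCobordism

end

/-! ### Local flatness at seams and ends; the cobordism in both categories. -/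

open scoped Manifold ContDiff Topology ComplexConjugate

noncomputable section

namespace KnotCobordism

namespace HandleDisc

variable {g : ℕ} {D : HandleDisc g 1} {Φ : ℂ → E4 × ℝ} {K₀ K₁ : Knot}

theorem continuousAt_height {z₀ : ℂ} (h : ContinuousAt Φ z₀) :
    ContinuousAt (fun p : ℂ × ℝ => (Φ p.1).2 + p.2) (z₀, 0) :=
  (continuous_snd.continuousAt.comp (ContinuousAt.comp (g := Φ) (f := fun x : ℂ × ℝ => x.1)
    h continuous_fst.continuousAt)).add (by fun_prop)

theorem mem_domain_of_norm {m : ℕ} (D : HandleDisc g m) {z : ℂ} (hz : ‖z‖ = 1) : z ∈ D.domain :=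
  (D.eventually_mem_domain_iff_norm hz).self_of_nhds.mpr hz.le

theorem mem_domain_of_dist {m : ℕ} (D : HandleDisc g m) {i} {z : ℂ}
    (hz : dist z (D.center i) = D.radius i) : z ∈ D.domain :=
  (D.eventually_mem_domain_iff_dist hz).self_of_nhds.mpr hz.ge

/-- A point off the circles of the handles is glued to no other point. -/
theorem Glued.eq_of_forall_ne {m : ℕ} {D : HandleDisc g m} {w z : ℂ} (h : D.Glued w z)
    (hz : ∀ i, dist z (D.center (.inl i)) ≠ D.radius (.inl i)) : w = z := by
  rcases h with rfl | ⟨j, ⟨hw, rfl⟩ | ⟨hz', -⟩⟩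
  · rfl
  · exact absurd (D.glue_circle j w hw) (hz _)
  · exact absurd hz' (hz _)

section Flat

variable (hE : D.IsSmoothEmbedding Φ) (hP : IsProperBetween D Φ K₀ K₁)
  (himm : ∀ z ∈ D.domain, Function.Injective (fderiv ℝ (fun w => (Φ w).1) z))

include hE

theorem exists_nhds_of_forall_ne {z₀ : ℂ} (hz₀ : z₀ ∈ D.domain)
    (hne : ∀ i, dist z₀ (D.center (.inl i)) ≠ D.radius (.inl i)) :
    ∀ U ∈ 𝓝 z₀, ∃ W ∈ 𝓝 (Φ z₀), ∀ w ∈ D.domain, Φ w ∈ W → ∃ z ∈ U, Φ w = Φ z := by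
  intro U hU
  obtain ⟨V, hVU, hV, hzV⟩ := mem_nhds_iff.mp hU
  obtain ⟨W, hW, h⟩ := exists_nhds_localize
    (fun z hz => (hE.smooth z hz).continuousAt.continuousWithinAt) hV (p := Φ z₀)
    (fun w hw hww => by
      rw [((hE.eq_iff w hw z₀ hz₀).mp hww).eq_of_forall_ne hne]; exact hzV)
  exact ⟨W, hW, fun w hw hwW => ⟨w, hVU (h w hw hwW), rfl⟩⟩

/-- A seam point also has a preimage on the second circle of the handle. Parameters near that one
are carried by the inverse gluing map to parameters near z₀ with the same image. -/
theorem exists_nhds_of_mem_seam {j : Fin g} {z₀ : ℂ} (hz₀ : z₀ ∈ D.seam j) :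
    ∀ U ∈ 𝓝 z₀, ∃ W ∈ 𝓝 (Φ z₀), ∀ w ∈ D.domain, Φ w ∈ W → ∃ z ∈ U, Φ w = Φ z := by
  intro U hU
  have hd : dist z₀ (D.center (.inl (j, false))) = D.radius (.inl (j, false)) := hz₀
  have hz₀D := D.mem_domain_of_dist hd
  have hpole := D.ne_pole_of_radius_le j hd.ge
  have hU' : U ∩ {z | Φ (mobius (D.glue j) z) = Φ z} ∈ 𝓝 z₀ :=
    Filter.inter_mem hU ((hE.glue_near j).filter_mono (nhds_le_nhdsSet hz₀))
  obtain ⟨V, hVU, hV, hzV⟩ := mem_nhds_iff.mp hU'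
  set inv : ℂ → ℂ := fun w => D.pole j + D.coef j / (w - D.apex j)
  have hinv : ContinuousOn inv {w | w ≠ D.apex j} :=
    continuousOn_const.add (continuousOn_const.div (by fun_prop) fun w hw => sub_ne_zero.mpr hw)
  -- Neighbourhoods of both preimages; the apex is removed since the inverse gluing map is not
  -- continuous there.
  have hO : IsOpen (V ∪ ({w | w ≠ D.apex j} ∩ inv ⁻¹' V)) :=
    hV.union (hinv.isOpen_inter_preimage isOpen_ne hV)
  obtain ⟨W, hW, h⟩ := exists_nhds_localize
    (fun z hz => (hE.smooth z hz).continuousAt.continuousWithinAt) hO (p := Φ z₀) (by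
      intro w hw hww
      rcases (hE.eq_iff w hw z₀ hz₀D).mp hww with rfl | ⟨j', ⟨hw', hzw⟩ | ⟨hz', rfl⟩⟩
      · exact Or.inl hzV
      · exfalso
        have h1 := D.glue_circle j' w hw'
        rw [← hzw] at h1
        exact (D.radius_lt_dist_of_mem_closedBall (i := .inl (j, false)) (j := .inl (j', true))
          (by simp) hd.le).ne' h1
      · have hj : j' = j := by
          by_contra hne
          exact (D.radius_lt_dist_of_mem_closedBall (i := .inl (j, false))
            (j := .inl (j', false)) (by simpa using Ne.symm hne) hd.le).ne' hz'
        subst hj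
        refine Or.inr ⟨D.mobius_ne_apex _ hpole, ?_⟩
        show inv _ ∈ V
        rw [show inv (mobius (D.glue j') z₀) = z₀ from D.pole_add_eq _ hpole]
        exact hzV)
  refine ⟨W, hW, fun w hw hwW => ?_⟩
  rcases h w hw hwW with hwV | ⟨hwa, hwV⟩
  · exact ⟨w, (hVU hwV).1, rfl⟩
  · have h1 := (hVU hwV).2
    refine ⟨inv w, (hVU hwV).1, ?_⟩
    rw [← show Φ (mobius (D.glue j) (inv w)) = Φ (inv w) from h1,
      show mobius (D.glue j) (inv w) = w from D.mobius_pole_add j hwa]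

/-- A parameter just inside the first hole is not in the domain, but the gluing map exchanges sides
and sends it to one that is, with the same image. -/
theorem eventually_mem_image_of_mem_seam {j : Fin g} {z₀ : ℂ} (hz₀ : z₀ ∈ D.seam j) :
    ∀ᶠ z in 𝓝 z₀, Φ z ∈ Φ '' D.domain := by
  have hd : dist z₀ (D.center (.inl (j, false))) = D.radius (.inl (j, false)) := hz₀
  have hpole := D.ne_pole_of_radius_le j hd.ge
  filter_upwards [D.eventually_mem_domain_iff_dist hd, isOpen_ne.mem_nhds hpole,
    (hE.glue_near j).filter_mono (nhds_le_nhdsSet hz₀),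
    (D.continuousAt_mobius j hpole).eventually
      (D.eventually_mem_domain_iff_dist (D.glue_circle j z₀ hd))] with z h1 h2 h3 h4
  rcases le_or_gt (D.radius (.inl (j, false))) (dist z (D.center (.inl (j, false)))) with h | h
  · exact ⟨z, h1.mpr h, rfl⟩
  · refine ⟨_, h4.mpr ?_, h3⟩
    by_contra! hcon
    exact absurd ((D.dist_mobius_lt_iff j h2).mp hcon) h.not_gt

include hP himm

/-- Local flatness at the lower end. -/
theorem exists_flat_chart_bottom {z₀ : ℂ} (hz₀ : ‖z₀‖ = 1)
    (hd : fderiv ℝ (fun w => (Φ w).2) z₀ ≠ 0)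
    (hneg : ∀ᶠ w in 𝓝 z₀, 1 < ‖w‖ → (Φ w).2 < 0)
    {p : S3 × unitInterval} (hp : incl p = Φ z₀) :
    ∃ e : OpenPartialHomeomorph (S3 × unitInterval) (EuclideanHalfSpace 4),
      p ∈ e.source ∧ ∀ q ∈ e.source, q ∈ D.imageSet Φ ↔ (e q).val 2 = 0 ∧ (e q).val 3 = 0 := by
  have hz₀D := D.mem_domain_of_norm hz₀
  have hsm := hE.smooth z₀ hz₀D
  have h0 : (Φ z₀).2 = 0 := by
    have := hP.bottom ⟨z₀, mem_sphere_zero_iff_norm.mpr hz₀⟩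
    exact congrArg Prod.snd this
  -- The first coordinate of the chart is the height itself; the bound by 1 is automatic near this
  -- end.
  refine exists_flat_chart_of_local hE hP himm hz₀D (k := fun w => (Φ w).2) (c := 1) hsm.snd hd
    ?_ ?_ (exists_nhds_of_forall_ne hE hz₀D fun i hi => ?_) hp
  · filter_upwards [(continuousAt_height hsm.continuousAt).eventually
      (gt_mem_nhds (a := (1 : ℝ)) (by simp [h0]))] with x hx
    rw [one_mul]
    exact ⟨fun h => h.1, fun h => ⟨h, hx.le⟩⟩
  · filter_upwards [hneg, D.eventually_mem_domain_iff_norm hz₀] with z h1 h2 h3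
    refine ⟨z, h2.mpr ?_, rfl⟩
    by_contra! hcon
    exact absurd h3.1 (h1 hcon).not_ge
  · exact absurd hz₀ (D.norm_lt_one_of_mem_closedBall hi.le).ne

/-- Local flatness at the upper end. -/
theorem exists_flat_chart_top {z₀ : ℂ} (hz₀ : dist z₀ (D.center (.inr 0)) = D.radius (.inr 0))
    (hd : fderiv ℝ (fun w => (Φ w).2) z₀ ≠ 0)
    (hlt : ∀ᶠ w in 𝓝 z₀, dist w (D.center (.inr 0)) < D.radius (.inr 0) → 1 < (Φ w).2)
    {p : S3 × unitInterval} (hp : incl p = Φ z₀) :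
    ∃ e : OpenPartialHomeomorph (S3 × unitInterval) (EuclideanHalfSpace 4),
      p ∈ e.source ∧ ∀ q ∈ e.source, q ∈ D.imageSet Φ ↔ (e q).val 2 = 0 ∧ (e q).val 3 = 0 := by
  have hz₀D := D.mem_domain_of_dist hz₀
  have hsm := hE.smooth z₀ hz₀D
  have hr := D.radius_pos (.inr 0)
  have h0 : (Φ z₀).2 = 1 := by
    have hr' : (D.radius (.inr 0) : ℂ) ≠ 0 := by exact_mod_cast hr.ne'
    have h1 : ‖(z₀ - D.center (.inr 0)) / D.radius (.inr 0)‖ = 1 := by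
      rw [norm_div, ← dist_eq_norm, hz₀, Complex.norm_real, Real.norm_of_nonneg hr.le,
        div_self hr.ne']
    have := hP.top ⟨_, mem_sphere_zero_iff_norm.mpr h1⟩
    simp only [mul_div_cancel₀ _ hr', add_sub_cancel] at this
    exact congrArg Prod.snd this
  -- Here the first coordinate is one minus the height.
  refine exists_flat_chart_of_local hE hP himm hz₀D (k := fun w => 1 - (Φ w).2) (c := -1)
    (contDiffAt_const.sub hsm.snd) ?_
    ?_ ?_ (exists_nhds_of_forall_ne hE hz₀D fun i hi => ?_) hp
  · rw [fderiv_const_sub]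
    exact neg_ne_zero.mpr hd
  · filter_upwards [(continuousAt_height hsm.continuousAt).eventually
      (lt_mem_nhds (a := 0) (by simp [h0]))] with x hx
    exact ⟨fun h => by linarith [h.2], fun h => ⟨hx.le, by linarith⟩⟩
  · filter_upwards [hlt, D.eventually_mem_domain_iff_dist hz₀] with z h1 h2 h3
    refine ⟨z, h2.mpr ?_, rfl⟩
    by_contra! hcon
    exact absurd h3.2 (h1 hcon).not_ge
  · exact (D.radius_lt_dist_of_mem_closedBall (i := .inr 0) (j := .inl i) (by simp)
      hz₀.le).ne' hi

/-- Smooth surfaces that are transverse to the ends are locally flat. -/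
theorem isLocallyFlat_imageSet
    (hbot : ∀ z, ‖z‖ = 1 → fderiv ℝ (fun w => (Φ w).2) z ≠ 0 ∧
      ∀ᶠ w in 𝓝 z, 1 < ‖w‖ → (Φ w).2 < 0)
    (htop : ∀ z, dist z (D.center (.inr 0)) = D.radius (.inr 0) →
      fderiv ℝ (fun w => (Φ w).2) z ≠ 0 ∧
      ∀ᶠ w in 𝓝 z, dist w (D.center (.inr 0)) < D.radius (.inr 0) → 1 < (Φ w).2) :
    IsLocallyFlat (D.imageSet Φ) := by
  rintro p ⟨z, hz, hzp⟩
  have hp : incl p = Φ z := hzp.symm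
  have hseam : ∀ j, ∀ z ∈ D.seam j, incl p = Φ z →
      ∃ e : OpenPartialHomeomorph (S3 × unitInterval) (EuclideanHalfSpace 4),
      p ∈ e.source ∧ ∀ q ∈ e.source, q ∈ D.imageSet Φ ↔
        (e q).val 2 = 0 ∧ (e q).val 3 = 0 := by
    intro j z hz hpz
    have hd : dist z (D.center (.inl (j, false))) = D.radius (.inl (j, false)) := hz
    have hzD := D.mem_domain_of_dist hd
    exact exists_flat_chart_interior hE hP himm hzD
      (hP.interior z hzD (D.norm_lt_one_of_mem_closedBall hd.le)
        (D.radius_lt_dist_of_mem_closedBall (by simp) hd.le))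
      (eventually_mem_image_of_mem_seam hE hz) (exists_nhds_of_mem_seam hE hz) hpz
  rcases D.mem_core_or hz with hc | h1 | ⟨⟨j, b⟩ | i, hi⟩
  · exact exists_flat_chart_interior hE hP himm hz (hP.interior z hz hc.1 (hc.2 _))
      (Filter.mem_of_superset (D.domain_mem_nhds hc) fun w hw => ⟨w, hw, rfl⟩)
      (exists_nhds_of_forall_ne hE hz fun i => (hc.2 _).ne') hp
  · exact exists_flat_chart_bottom hE hP himm h1 (hbot z h1).1 (hbot z h1).2 hp
  · cases b
    · exact hseam j z hi hp
    -- A point on the second circle is represented by its partner on the seam.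
    · obtain ⟨w, hw, rfl⟩ := D.exists_mem_seam j hi
      refine hseam j w hw (hp.trans ?_)
      exact ((hE.glue_near j).filter_mono (nhds_le_nhdsSet hw)).self_of_nhds
  · obtain rfl : i = 0 := Subsingleton.elim _ _
    exact exists_flat_chart_top hE hP himm hi (htop z hi).1 (htop z hi).2 hp

end Flat

end HandleDisc

/-- The double of a Seifert surface of positive genus. -/
theorem hasCobordism_of_hasSeifertSurface {K : Knot} {k : ℕ} (h : K.HasSeifertSurface (k + 1)) :
    HasSmoothCobordism K K.reverse (2 * k + 1) ∧
      HasLocallyFlatCobordism K K.reverse (2 * k + 1) := by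
  obtain ⟨D, φ, hφ, hs, hK⟩ := h
  obtain ⟨S⟩ := D.nonempty_sheets hφ hs
  have hE := S.isSmoothEmbedding_map hφ
  have hP := S.isProperBetween_map hK
  refine ⟨⟨D.double, S.map, hE, hP, fun z hz h => ?_⟩, ⟨D.double, S.map,
    ⟨fun z hz => (hE.smooth z hz).continuousAt.continuousWithinAt, hE.eq_iff⟩, hP,
    HandleDisc.isLocallyFlat_imageSet hE hP (fun z hz => S.injective_fderiv_map_fst hφ hz)
      (fun z hz => ⟨S.fderiv_height_ne_zero_bottom hφ hz, S.eventually_map_snd_neg hφ hz⟩)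
      (fun z hz => ⟨S.fderiv_height_ne_zero_top hφ hz, S.eventually_one_lt_map_snd hφ hz⟩)⟩⟩
  by_cases h1 : ‖z‖ = 1
  · exact S.fderiv_height_ne_zero_bottom hφ h1
  by_cases h2 : dist z (D.double.center (.inr 0)) = D.double.radius (.inr 0)
  · exact S.fderiv_height_ne_zero_top hφ h2
  have h3 := hP.interior z hz (lt_of_le_of_ne hz.1 h1) (lt_of_le_of_ne (hz.2 _) (Ne.symm h2))
  rcases h with h | h
  · exact absurd h h3.1.ne'
  · exact absurd h h3.2.ne

end KnotCobordism

end

/-! ### Knots as radial projections of curves in ℝ⁴, and their isotopies. -/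

open scoped Manifold ContDiff Topology ComplexConjugate

noncomputable section

namespace KnotCobordism

attribute [local instance] finrank_real_complex_fact'

theorem fact_finrank_E4 : Fact (Module.finrank ℝ E4 = 3 + 1) := ⟨finrank_euclideanSpace_fin⟩

attribute [local instance] fact_finrank_E4

theorem contMDiff_circle_coe : ContMDiff (𝓡 1) 𝓘(ℝ, ℂ) ∞ (fun u : Circle => (u : ℂ)) :=
  contMDiff_coe_sphere (E := ℂ) (n := 1)

theorem injective_mfderiv_circle_coe (u : Circle) :
    Function.Injective (mfderiv (𝓡 1) 𝓘(ℝ, ℂ) (fun u : Circle => (u : ℂ)) u) :=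
  injective_mvfderiv_subtypeVal_sphere (E := ℂ) (n := 1) u

theorem inner_mfderiv_circle_coe (u : Circle) (v : TangentSpace (𝓡 1) u) :
    inner ℝ (u : ℂ) (mfderiv (𝓡 1) 𝓘(ℝ, ℂ) (fun u : Circle => (u : ℂ)) u v : ℂ) = 0 := by
  have h := range_mvfderiv_subtypeVal (E := ℂ) (n := 1) u
  have h1 : (mfderiv (𝓡 1) 𝓘(ℝ, ℂ) (fun u : Circle => (u : ℂ)) u v : ℂ) ∈
      (Submodule.span ℝ {(u : ℂ)})ᗮ := by
    rw [← show _ = (Submodule.span ℝ {(u : ℂ)})ᗮ from h]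
    exact ⟨v, rfl⟩
  exact (Submodule.mem_orthogonal_singleton_iff_inner_right).mp h1

/-- A vector orthogonal to a point of the circle is tangent to it. -/
theorem exists_eq_smul_mul_I {u w : ℂ} (hu : ‖u‖ = 1) (h : inner ℝ u w = 0) :
    ∃ a : ℝ, w = a • (u * Complex.I) := by
  have hu0 : u ≠ 0 := by rintro rfl; simp at hu
  have h1 : (conj u * w).re = 0 := by
    rw [← h, Complex.inner, mul_comm]
  refine ⟨(conj u * w).im, ?_⟩
  have h2 : conj u * w = ((conj u * w).im : ℂ) * Complex.I := by
    conv_lhs => rw [← Complex.re_add_im (conj u * w), h1]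
    simp
  have h3 : u * conj u = 1 := by rw [Complex.mul_conj, Complex.normSq_eq_norm_sq, hu]; simp
  calc w = u * (conj u * w) := by rw [← mul_assoc, h3, one_mul]
    _ = _ := by rw [h2]; simp only [Complex.real_smul]; simp; ring

theorem contDiffAt_normalize {y : E4} (hy : y ≠ 0) :
    ContDiffAt ℝ ∞ (fun y : E4 => ‖y‖⁻¹ • y) y :=
  ((contDiffAt_norm ℝ hy).inv (norm_ne_zero_iff.mpr hy)).smul contDiffAt_id

theorem contMDiff_toSphere {EM HM M : Type*} [NormedAddCommGroup EM] [NormedSpace ℝ EM]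
    [TopologicalSpace HM] {I : ModelWithCorners ℝ EM HM} [TopologicalSpace M] [ChartedSpace HM M]
    [IsManifold I ∞ M] {f : M → E4} (hf : ContMDiff I 𝓘(ℝ, E4) ∞ f) (h0 : ∀ x, f x ≠ 0) :
    ContMDiff I (𝓡 3) ∞ (fun x => toSphere (f x)) := by
  have h1 : ContMDiff I 𝓘(ℝ, E4) ∞ (fun x => ‖f x‖⁻¹ • f x) := fun x =>
    ContMDiffAt.comp (g := fun y : E4 => ‖y‖⁻¹ • y) x (contDiffAt_normalize (h0 x)).contMDiffAt
      (hf x)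
  have h2 : ∀ x, ‖f x‖⁻¹ • f x ∈ Metric.sphere (0 : E4) 1 := fun x => by
    rw [← coe_toSphere (h0 x)]; exact (toSphere (f x)).2
  have h3 := h1.codRestrict_sphere (n := 3) h2
  convert! h3 using 1
  funext x
  exact Subtype.ext (coe_toSphere (h0 x))

/-- A closed curve in `ℝ⁴` whose radial projection to `S³` is a knot, extended to a neighbourhood
of the circle. -/
structure IsLoop (f : ℂ → E4) : Prop where
  smooth : ∀ u : Circle, ContDiffAt ℝ ∞ f u
  ne_zero : ∀ u : Circle, f u ≠ 0
  -- No two points lie on one ray from the origin, and the velocity is never radial: this is what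
  -- the projection to the sphere needs to be injective and immersive.
  inj : ∀ (u v : Circle) (c : ℝ), 0 < c → f u = c • f v → u = v
  imm : ∀ (u : Circle) (c : ℝ), fderiv ℝ f u (u * Complex.I) ≠ c • f u

namespace IsLoop

variable {f : ℂ → E4} (h : IsLoop f)

include h

theorem contMDiff : ContMDiff (𝓡 1) 𝓘(ℝ, E4) ∞ (fun u : Circle => f u) := fun u =>
  ContMDiffAt.comp (g := f) (f := fun u : Circle => (u : ℂ)) u (h.smooth u).contMDiffAt
    (contMDiff_circle_coe u)

/-- The radial projection of a loop. -/
def knot : Knot where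
  toFun u := toSphere (f u)
  smooth := contMDiff_toSphere h.contMDiff h.ne_zero
  injective := by
    intro u v huv
    have h1 := congrArg (Subtype.val) huv
    simp only [coe_toSphere (h.ne_zero _)] at h1
    have hu := norm_pos_iff.mpr (h.ne_zero u)
    have hv := norm_pos_iff.mpr (h.ne_zero v)
    refine h.inj u v (‖f u‖ * ‖f v‖⁻¹) (by positivity) ?_
    rw [mul_smul, ← h1, smul_smul, mul_inv_cancel₀ hu.ne', one_smul]
  immersion := by
    intro u
    set k : Circle → S3 := fun u => toSphere (f u)
    have hk : ContMDiff (𝓡 1) (𝓡 3) ∞ k := contMDiff_toSphere h.contMDiff h.ne_zero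
    have hu := norm_pos_iff.mpr (h.ne_zero u)
    set N : ℂ → E4 := fun z => ‖f z‖⁻¹ • f z with hN
    have hNd : DifferentiableAt ℝ N u :=
      (((h.smooth u).norm ℝ (h.ne_zero u)).inv hu.ne' |>.smul (h.smooth u)).differentiableAt
        (by simp)
    have hnd : DifferentiableAt ℝ (fun z => ‖f z‖) u :=
      ((h.smooth u).norm ℝ (h.ne_zero u)).differentiableAt (by simp)
    have e : (fun v : S3 => (v : E4)) ∘ k = N ∘ fun u : Circle => (u : ℂ) := by
      funext v; exact coe_toSphere (h.ne_zero v)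
    have hcoe : MDifferentiableAt (𝓡 3) 𝓘(ℝ, E4) (fun v : S3 => (v : E4)) (k u) :=
      (contMDiff_coe_sphere (m := ∞) (k u)).mdifferentiableAt (by simp)
    have e1 := mfderiv_comp u hcoe ((hk u).mdifferentiableAt (by simp))
    have e2 := mfderiv_comp (g := N) (f := fun u : Circle => (u : ℂ)) u hNd.mdifferentiableAt
      ((contMDiff_circle_coe u).mdifferentiableAt (by simp))
    rw [e, e2, mfderiv_eq_fderiv] at e1
    rw [injective_iff_map_eq_zero]
    intro v hv
    have e3 := DFunLike.congr_fun e1 v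
    have hw : fderiv ℝ N u (mfderiv (𝓡 1) 𝓘(ℝ, ℂ) (fun u : Circle => (u : ℂ)) u v : ℂ) = 0 := by
      refine e3.trans ?_
      show mfderiv (𝓡 3) 𝓘(ℝ, E4) (fun v : S3 => (v : E4)) (k u) (mfderiv (𝓡 1) (𝓡 3) k u v) = 0
      rw [hv]; exact map_zero _
    obtain ⟨a, ha⟩ := exists_eq_smul_mul_I u.norm_coe (inner_mfderiv_circle_coe u v)
    -- By the product rule, a tangent vector killed by dN is sent by df to a multiple of f, which
    -- `imm` forbids.
    have hfN : f =ᶠ[𝓝 (u : ℂ)] fun z => ‖f z‖ • N z := by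
      filter_upwards [(h.smooth u).continuousAt.eventually (isOpen_ne.mem_nhds (h.ne_zero u))]
        with z hz
      rw [hN]
      simp only
      rw [smul_smul, mul_inv_cancel₀ (norm_ne_zero_iff.mpr hz), one_smul]
    have hd : fderiv ℝ f u = _ := hfN.fderiv_eq.trans (hnd.hasFDerivAt.smul hNd.hasFDerivAt).fderiv
    have hz : a = 0 := by
      by_contra hne
      rw [ha, map_smul, smul_eq_zero_iff_right hne] at hw
      refine h.imm u (fderiv ℝ (fun z => ‖f z‖) u (u * Complex.I) * ‖f u‖⁻¹) ?_
      rw [hd]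
      simp only [add_apply, smul_apply, ContinuousLinearMap.smulRight_apply,
        hw, smul_zero, zero_add]
      rw [hN, mul_smul]
    rw [hz, zero_smul] at ha
    exact injective_mfderiv_circle_coe u (ha.trans (map_zero _).symm)

end IsLoop

/-- A smooth isotopy of knots. -/
def Isotopic (K K' : Knot) : Prop :=
  ∃ H : ℝ → Knot,
    ContMDiff (𝓘(ℝ, ℝ).prod (𝓡 1)) (𝓡 3) ∞ (fun p : ℝ × Circle => H p.1 p.2) ∧
    H 0 = K ∧ H 1 = K'

theorem Knot.ext {K K' : Knot} (h : ∀ u, K u = K' u) : K = K' := by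
  cases K; cases K'; congr; exact funext h

/-- A family of loops gives an isotopy. -/
theorem isotopic_of_loops {Ψ : ℝ → ℂ → E4}
    (hΨ : ∀ t ∈ Set.Icc (0 : ℝ) 1, ∀ u : Circle,
      ContDiffAt ℝ ∞ (fun p : ℝ × ℂ => Ψ p.1 p.2) (t, (u : ℂ)))
    (h : ∀ t ∈ Set.Icc (0 : ℝ) 1, IsLoop (Ψ t)) {K K' : Knot}
    (h0 : ∀ u : Circle, K u = toSphere (Ψ 0 u)) (h1 : ∀ u : Circle, K' u = toSphere (Ψ 1 u)) :
    Isotopic K K' := by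
  -- An isotopy is parametrized by all of ℝ, whereas Ψ is controlled only on [0,1].
  have hσ : ∀ t, Real.smoothTransition t ∈ Set.Icc (0 : ℝ) 1 := fun t =>
    ⟨Real.smoothTransition.nonneg t, Real.smoothTransition.le_one t⟩
  refine ⟨fun t => (h _ (hσ t)).knot, ?_, Knot.ext fun u => ?_, Knot.ext fun u => ?_⟩
  · refine contMDiff_toSphere (f := fun p : ℝ × Circle => Ψ (Real.smoothTransition p.1) p.2) ?_
      fun p => (h _ (hσ p.1)).ne_zero p.2
    intro p
    have h2 : ContMDiff (𝓘(ℝ, ℝ).prod (𝓡 1)) 𝓘(ℝ, ℝ × ℂ) ∞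
        (fun p : ℝ × Circle => (Real.smoothTransition p.1, (p.2 : ℂ))) :=
      (Real.smoothTransition.contDiff.contMDiff.comp contMDiff_fst).prodMk_space
        (contMDiff_circle_coe.comp contMDiff_snd)
    exact ContMDiffAt.comp (g := fun p : ℝ × ℂ => Ψ p.1 p.2)
      (f := fun p : ℝ × Circle => (Real.smoothTransition p.1, (p.2 : ℂ))) p
      (hΨ _ (hσ p.1) p.2).contMDiffAt (h2 p)
  · rw [h0]
    show toSphere (Ψ (Real.smoothTransition 0) u) = _
    rw [Real.smoothTransition.zero]
  · rw [h1]
    show toSphere (Ψ (Real.smoothTransition 1) u) = _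
    rw [Real.smoothTransition.one]

/-- The first isotopy is made stationary from t = 1/3 on and the second one up to t = 2/3, so the
two pieces are constant where they are joined and fit smoothly. -/
theorem Isotopic.trans {K₁ K₂ K₃ : Knot} (h : Isotopic K₁ K₂) (h' : Isotopic K₂ K₃) :
    Isotopic K₁ K₃ := by
  obtain ⟨H, hH, hH0, hH1⟩ := h
  obtain ⟨H', hH', hH'0, hH'1⟩ := h'
  have hA : ContMDiff (𝓘(ℝ, ℝ).prod (𝓡 1)) (𝓡 3) ∞
      (fun p : ℝ × Circle => H (Real.smoothTransition (3 * p.1)) p.2) := by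
    have h2 : ContDiff ℝ ∞ fun t : ℝ => Real.smoothTransition (3 * t) :=
      Real.smoothTransition.contDiff.comp (by fun_prop)
    exact hH.comp ((h2.contMDiff.comp contMDiff_fst).prodMk contMDiff_snd)
  have hB : ContMDiff (𝓘(ℝ, ℝ).prod (𝓡 1)) (𝓡 3) ∞
      (fun p : ℝ × Circle => H' (Real.smoothTransition (3 * p.1 - 2)) p.2) := by
    have h2 : ContDiff ℝ ∞ fun t : ℝ => Real.smoothTransition (3 * t - 2) :=
      Real.smoothTransition.contDiff.comp (by fun_prop)
    exact hH'.comp ((h2.contMDiff.comp contMDiff_fst).prodMk contMDiff_snd)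
  refine ⟨fun t => if t ≤ 1 / 2 then H (Real.smoothTransition (3 * t))
    else H' (Real.smoothTransition (3 * t - 2)), ?_, ?_, ?_⟩
  · intro p
    rcases lt_or_ge p.1 (2 / 3) with hp | hp
    · refine (hA p).congr_of_eventuallyEq ?_
      filter_upwards [(continuous_fst.tendsto p).eventually (gt_mem_nhds hp)] with q hq
      split_ifs with h
      · rfl
      · rw [Real.smoothTransition.zero_of_nonpos (by linarith),
          Real.smoothTransition.one_of_one_le (by linarith), hH1, hH'0]
    · refine (hB p).congr_of_eventuallyEq ?_
      filter_upwards [(continuous_fst.tendsto p).eventually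
        (lt_mem_nhds (a := 1 / 2) (by linarith))] with q hq
      rw [if_neg (not_le.mpr hq)]
  · norm_num [hH0]
  · norm_num [hH'1]

end KnotCobordism

end

/-! ### Curves on spheres, in hyperplanes and in planes; all great circles are isotopic. -/

open scoped Manifold ContDiff Topology ComplexConjugate

noncomputable section

namespace KnotCobordism

theorem toSphere_smul {c : ℝ} (hc : 0 < c) (y : E4) : toSphere (c • y) = toSphere y := by
  rcases eq_or_ne y 0 with rfl | hy
  · rw [smul_zero]
  · apply Subtype.ext
    rw [coe_toSphere hy, coe_toSphere (smul_ne_zero hc.ne' hy), norm_smul, Real.norm_of_nonneg hc.le,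
      smul_smul, mul_inv, mul_right_comm, inv_mul_cancel₀ hc.ne', one_mul]

theorem coe_toSphere_of_norm {y : E4} (hy : ‖y‖ = 1) : (toSphere y : E4) = y := by
  rw [coe_toSphere (by rintro rfl; simp at hy), hy, inv_one, one_smul]

/-- Embedded curves on the sphere are loops. -/
theorem isLoop_of_norm_eq_one {f : ℂ → E4} (hf : ∀ u : Circle, ContDiffAt ℝ ∞ f u)
    (hn : ∀ u : Circle, ‖f u‖ = 1) (hinj : ∀ u v : Circle, f u = f v → u = v)
    (horth : ∀ u : Circle, inner ℝ (f u) (fderiv ℝ f u (u * Complex.I)) = 0)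
    (himm : ∀ u : Circle, fderiv ℝ f u (u * Complex.I) ≠ 0) : IsLoop f where
  smooth := hf
  ne_zero u h := by simpa [h] using hn u
  inj u v c hc h := by
    have h1 := congrArg norm h
    rw [norm_smul, hn, hn, mul_one, Real.norm_of_nonneg hc.le] at h1
    rw [← h1, one_smul] at h
    exact hinj u v h
  imm u c h := by
    have h1 := horth u
    rw [h, inner_smul_right, real_inner_self_eq_norm_sq, hn, one_pow, mul_one] at h1
    exact himm u (by rw [h, h1, zero_smul])

/-- Embedded curves in an affine hyperplane off the origin are loops. -/
theorem isLoop_const_add {X : ℂ → E4} {p : E4} (hp : ‖p‖ = 1)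
    (hX : ∀ u : Circle, ContDiffAt ℝ ∞ X u)
    (horth : ∀ u : Circle, ∀ᶠ z in 𝓝 (u : ℂ), inner ℝ p (X z) = 0)
    (hinj : ∀ u v : Circle, X u = X v → u = v)
    (himm : ∀ u : Circle, fderiv ℝ X u (u * Complex.I) ≠ 0) : IsLoop (fun z => p + X z) := by
  have hi : ∀ u : Circle, inner ℝ p (p + X u) = 1 := fun u => by
    rw [inner_add_right, real_inner_self_eq_norm_sq, hp, (horth u).self_of_nhds]; norm_num
  have horth' : ∀ u : Circle, inner ℝ p (fderiv ℝ X u (u * Complex.I)) = 0 := fun u => by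
    have h1 : HasFDerivAt (fun z => innerSL ℝ p (X z)) ((innerSL ℝ p).comp (fderiv ℝ X u)) (u : ℂ) :=
      (innerSL ℝ p).hasFDerivAt.comp _ ((hX u).differentiableAt (by simp)).hasFDerivAt
    have h2 : (fun z => innerSL ℝ p (X z)) =ᶠ[𝓝 (u : ℂ)] fun _ => 0 := horth u
    have h3 := h1.fderiv.symm.trans (h2.fderiv_eq.trans (fderiv_const_apply _))
    exact DFunLike.congr_fun h3 (u * Complex.I)
  refine ⟨fun u => contDiffAt_const.add (hX u), fun u h => ?_, fun u v c hc h => ?_,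
    fun u c h => ?_⟩
  · have := hi u
    rw [h, inner_zero_right] at this
    norm_num at this
  · have h1 := congrArg (inner ℝ p) h
    rw [inner_smul_right, hi, hi, mul_one] at h1
    rw [← h1, one_smul] at h
    exact hinj u v (add_left_cancel h)
  · rw [fderiv_const_add] at h
    have h1 := horth' u
    rw [h, inner_smul_right, hi, mul_one] at h1
    exact himm u (by rw [h, h1, zero_smul])

/-- Round ellipses are loops. -/
theorem isLoop_affine {q : E4} {M : ℂ →L[ℝ] E4} (hM : Function.Injective M)
    (horth : ∀ ζ, inner ℝ q (M ζ) = 0) : IsLoop (fun z => q + M z) := by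
  -- A vector both orthogonal and parallel to q is zero; q = 0 is allowed.
  have key : ∀ (ζ : ℂ) (a : ℝ), M ζ = a • q → ζ = 0 := by
    intro ζ a h
    have h1 : inner ℝ (M ζ) (M ζ) = 0 := by
      conv_lhs => rw [h]
      rw [inner_smul_left, ← h, horth]; simp
    exact hM ((inner_self_eq_zero.mp h1).trans (map_zero _).symm)
  refine ⟨fun u => contDiffAt_const.add M.contDiff.contDiffAt, fun u h => ?_,
    fun u v c hc h => ?_, fun u c h => ?_⟩
  · have := key u (-1) (by rw [neg_one_smul]; exact eq_neg_of_add_eq_zero_right h)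
    exact u.coe_ne_zero this
  · have h1 := key (u - c • v) (c - 1) (by
      rw [map_sub, map_smul, sub_smul, one_smul, sub_eq_sub_iff_add_eq_add, add_comm _ q, h,
        smul_add])
    have h2 := sub_eq_zero.mp h1
    have h3 := congrArg norm h2
    rw [norm_smul, u.norm_coe, v.norm_coe, mul_one, Real.norm_of_nonneg hc.le] at h3
    rw [← h3, one_smul] at h2
    exact Circle.ext h2
  · rw [fderiv_const_add, M.fderiv] at h
    have h1 := key (u * Complex.I - c • (u : ℂ)) c (by
      rw [map_sub, map_smul, h, smul_add, add_sub_cancel_right])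
    have h2 : (u : ℂ) * (Complex.I - c) = 0 := by
      rw [← h1, Complex.real_smul]; ring
    have h3 := (mul_eq_zero.mp h2).resolve_left u.coe_ne_zero
    simpa using congrArg Complex.im h3

/-- Two planes in `ℝ⁴` have a common complement. -/
theorem exists_common_complement (V W : Submodule ℝ E4) (hV : Module.finrank ℝ V = 2)
    (hW : Module.finrank ℝ W = 2) :
    ∃ M : ℂ →L[ℝ] E4, ∀ ζ, M ζ ∈ V ∨ M ζ ∈ W → ζ = 0 := by
  -- A vector space is not the union of two proper subspaces. Applied twice, the second time after
  -- adjoining x to both planes, this yields a basis of the complement.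
  have key : ∀ V W : Submodule ℝ E4, Module.finrank ℝ V < 4 → Module.finrank ℝ W < 4 →
      ∃ x, x ∉ V ∧ x ∉ W := by
    intro V W hV hW
    have h4 : Module.finrank ℝ E4 = 4 := finrank_euclideanSpace_fin
    obtain ⟨x, hx⟩ : ∃ x, x ∉ V := by
      by_contra! h
      rw [(Submodule.eq_top_iff'.mpr h), finrank_top, h4] at hV
      exact lt_irrefl _ hV
    obtain ⟨y, hy⟩ : ∃ x, x ∉ W := by
      by_contra! h
      rw [(Submodule.eq_top_iff'.mpr h), finrank_top, h4] at hW
      exact lt_irrefl _ hW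
    by_cases h1 : x ∈ W
    · by_cases h2 : y ∈ V
      · exact ⟨x + y, fun h => hx ((V.add_mem_iff_left h2).mp h),
          fun h => hy ((W.add_mem_iff_right h1).mp h)⟩
      · exact ⟨y, h2, hy⟩
    · exact ⟨x, hx, h1⟩
  obtain ⟨x, hxV, hxW⟩ := key V W (by omega) (by omega)
  have hdim : ∀ V : Submodule ℝ E4, Module.finrank ℝ V = 2 →
      Module.finrank ℝ (V ⊔ Submodule.span ℝ {x} : Submodule ℝ E4) < 4 := by
    intro V hV
    have h1 := Submodule.finrank_add_le_finrank_add_finrank V (Submodule.span ℝ {x})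
    have h2 : Module.finrank ℝ (Submodule.span ℝ {x}) ≤ 1 := (finrank_span_le_card _).trans (by simp)
    omega
  obtain ⟨y, hyV, hyW⟩ := key _ _ (hdim V hV) (hdim W hW)
  have hzero : ∀ (V : Submodule ℝ E4), x ∉ V → y ∉ V ⊔ Submodule.span ℝ {x} → ∀ a b : ℝ,
      a • x + b • y ∈ V → a = 0 ∧ b = 0 := by
    intro V hx hy a b h
    have hb : b = 0 := by
      by_contra hb
      apply hy
      have h1 : b • y ∈ V ⊔ Submodule.span ℝ {x} := by
        rw [show b • y = (a • x + b • y) + (-a) • x by rw [neg_smul]; abel]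
        exact Submodule.add_mem_sup h
          (Submodule.smul_mem _ _ (Submodule.mem_span_singleton_self x))
      exact (Submodule.smul_mem_iff _ hb).mp h1
    refine ⟨?_, hb⟩
    by_contra ha
    rw [hb, zero_smul, add_zero] at h
    exact hx ((Submodule.smul_mem_iff _ ha).mp h)
  refine ⟨Complex.reCLM.smulRight x + Complex.imCLM.smulRight y, fun ζ hζ => ?_⟩
  have h : ζ.re = 0 ∧ ζ.im = 0 := by
    rcases hζ with hζ | hζ
    · exact hzero V hxV hyV _ _ hζ
    · exact hzero W hxW hyW _ _ hζ
  exact Complex.ext h.1 h.2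

theorem finrank_range {M : ℂ →L[ℝ] E4} (hM : Function.Injective M) :
    Module.finrank ℝ (LinearMap.range (M : ℂ →ₗ[ℝ] E4)) = 2 := by
  rw [LinearMap.finrank_range_of_inj hM, Complex.finrank_real_complex]

/-- The knot of a linear loop. -/
theorem isLoop_linear {M : ℂ →L[ℝ] E4} (hM : Function.Injective M) : IsLoop (fun z => M z) := by
  simpa using isLoop_affine (q := 0) hM (by simp)

/-- Linear loops with complementary planes are isotopic. -/
theorem isotopic_linear_of_disjoint {M M' : ℂ →L[ℝ] E4} (hM : Function.Injective M)
    (hM' : Function.Injective M') (h : ∀ ζ ξ, M ζ = M' ξ → ξ = 0) :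
    Isotopic (isLoop_linear hM).knot (isLoop_linear hM').knot := by
  refine isotopic_of_loops (Ψ := fun t z => ((1 - t) • M + t • M') z) (fun t _ u => ?_)
    (fun t _ => isLoop_linear ?_) (fun u => ?_) (fun u => ?_)
  · have h1 : ContDiff ℝ ∞ fun p : ℝ × ℂ => (1 - p.1) • M p.2 + p.1 • M' p.2 := by fun_prop
    exact h1.contDiffAt
  · rw [injective_iff_map_eq_zero]
    intro ζ hζ
    have h1 : M ((1 - t) • ζ) = M' (-(t • ζ)) := by
      rw [map_smul, map_neg, map_smul]
      exact eq_neg_of_add_eq_zero_left hζ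
    have h2 := h _ _ h1
    rw [h2, map_zero] at h1
    have h3 := hM (h1.trans (map_zero M).symm)
    rcases smul_eq_zero.mp h3 with h4 | h4
    · rw [show t = 1 by linarith] at h2
      simpa using h2
    · exact h4
  · show toSphere (M u) = _
    simp
  · show toSphere (M' u) = _
    simp

/-- The segment between two linear embeddings can degenerate when their planes meet, so the isotopy
passes through a third plane complementary to both. -/
theorem Isotopic.linear {M M' : ℂ →L[ℝ] E4} (hM : Function.Injective M)
    (hM' : Function.Injective M') :
    Isotopic (isLoop_linear hM).knot (isLoop_linear hM').knot := by
  obtain ⟨N, hN⟩ := exists_common_complement _ _ (finrank_range hM) (finrank_range hM')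
  have hNi : Function.Injective N := by
    rw [injective_iff_map_eq_zero]
    intro ζ hζ
    exact hN ζ (Or.inl (by rw [hζ]; exact Submodule.zero_mem _))
  refine (isotopic_linear_of_disjoint hM hNi fun ζ ξ h => hN ξ (Or.inl ⟨ζ, h⟩)).trans
    (isotopic_linear_of_disjoint hNi hM' fun ζ ξ h => ?_)
  have := hN ζ (Or.inr ⟨ξ, h.symm⟩)
  rw [this, map_zero] at h
  exact hM' (h.symm.trans (map_zero M').symm)

/-- The standard great circle. -/
def greatCircle : ℂ →L[ℝ] E4 :=
  Complex.reCLM.smulRight (EuclideanSpace.single 0 1) +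
    Complex.imCLM.smulRight (EuclideanSpace.single 1 1)

theorem greatCircle_apply (z : ℂ) : greatCircle z = !₂[z.re, z.im, 0, 0] := by
  ext i
  fin_cases i <;> simp [greatCircle]

theorem injective_greatCircle : Function.Injective greatCircle := by
  rw [injective_iff_map_eq_zero]
  intro z hz
  rw [greatCircle_apply] at hz
  refine Complex.ext ?_ ?_
  · simpa using congrArg (fun x : E4 => x 0) hz
  · simpa using congrArg (fun x : E4 => x 1) hz

theorem norm_greatCircle (u : Circle) : ‖greatCircle u‖ = 1 := by
  rw [greatCircle_apply, EuclideanSpace.norm_eq, Real.sqrt_eq_one, Fin.sum_univ_four]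
  have h : (u : ℂ).re * (u : ℂ).re + (u : ℂ).im * (u : ℂ).im = 1 := by
    rw [← Complex.normSq_apply, Circle.normSq_coe]
  simp
  linarith

theorem isTrivial_of_isotopic {K : Knot} {M : ℂ →L[ℝ] E4} (hM : Function.Injective M)
    (h : Isotopic K (isLoop_linear hM).knot) : K.IsTrivial := by
  obtain ⟨H, h1, h2, h3⟩ := h.trans (Isotopic.linear hM injective_greatCircle)
  refine ⟨H, h1, h2, fun u => ?_⟩
  rw [h3, ← greatCircle_apply]
  exact coe_toSphere_of_norm (norm_greatCircle u)

end KnotCobordism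

end

/-! ### Knots that bound discs are trivial. -/

open scoped Manifold ContDiff Topology ComplexConjugate

noncomputable section

namespace KnotCobordism

/-- The segment between a rescaled map and its linearization. -/
def straighten (ψ : ℂ → E4) (ε s : ℝ) (z : ℂ) : E4 :=
  ε • fderiv ℝ ψ 0 z + (1 - s) • (ψ (ε • z) - fderiv ℝ ψ 0 (ε • z))

theorem contDiffAt_straighten {ψ : ℂ → E4} {ε : ℝ} {x : ℝ × ℂ} (hψ : ContDiffAt ℝ ∞ ψ (ε • x.2)) :
    ContDiffAt ℝ ∞ (fun p : ℝ × ℂ => straighten ψ ε p.1 p.2) x := by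
  have h1 : ContDiffAt ℝ ∞ (fun p : ℝ × ℂ => ψ (ε • p.2)) x :=
    ContDiffAt.comp (g := ψ) (f := fun p : ℝ × ℂ => ε • p.2) x hψ (by fun_prop)
  unfold straighten
  fun_prop

theorem hasFDerivAt_straighten {ψ : ℂ → E4} {ε s : ℝ} {z : ℂ}
    (hψ : DifferentiableAt ℝ ψ (ε • z)) :
    HasFDerivAt (straighten ψ ε s) (ε • fderiv ℝ ψ 0 +
      (1 - s) • (ε • fderiv ℝ (fun w => ψ w - fderiv ℝ ψ 0 w) (ε • z))) z := by
  have h1 : HasFDerivAt (fun z : ℂ => ε • z) (ε • ContinuousLinearMap.id ℝ ℂ) z :=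
    (hasFDerivAt_id z).const_smul ε
  have h2 : HasFDerivAt (fun w => ψ w - fderiv ℝ ψ 0 w)
      (fderiv ℝ (fun w => ψ w - fderiv ℝ ψ 0 w) (ε • z)) (ε • z) :=
    (hψ.sub (fderiv ℝ ψ 0).differentiableAt).hasFDerivAt
  have h3 := HasFDerivAt.comp (g := fun w => ψ w - fderiv ℝ ψ 0 w) (f := fun z : ℂ => ε • z)
    z h2 h1
  refine (((fderiv ℝ ψ 0).hasFDerivAt.const_smul ε).add (h3.const_smul (1 - s))).congr_fderiv ?_
  ext ζ; simp

/-- Near the origin, an immersion may be straightened through embedded curves. -/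
theorem exists_straighten_embedded {ψ : ℂ → E4} (hψ : ContDiffAt ℝ ∞ ψ 0)
    (hinj : Function.Injective (fderiv ℝ ψ 0)) :
    ∃ δ > 0, ∀ ε, 0 < ε → ε < δ → (∀ u : Circle, DifferentiableAt ℝ ψ (ε • (u : ℂ))) →
      ∀ s ∈ Set.Icc (0 : ℝ) 1,
      (∀ u v : Circle, straighten ψ ε s u = straighten ψ ε s v → u = v) ∧
      ∀ u : Circle, fderiv ℝ (straighten ψ ε s) u (u * Complex.I) ≠ 0 := by
  set L := fderiv ℝ ψ 0 with hL
  obtain ⟨K, hK, hanti⟩ := (L : ℂ →ₗ[ℝ] E4).injective_iff_antilipschitz.mp hinj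
  have hK' : (0 : ℝ) < K := hK
  have hlow : ∀ x : ℂ, ‖x‖ ≤ K * ‖L x‖ := fun x => by
    simpa [dist_eq_norm] using hanti.le_mul_dist x 0
  -- On this neighbourhood ψ - L is Lipschitz with half the expansion constant of L.
  obtain ⟨U, hU, happ⟩ := (hψ.hasStrictFDerivAt (by simp)).approximates_deriv_on_nhds
    (c := K⁻¹ / 2) (Or.inr (by positivity))
  obtain ⟨δ, hδ, hball⟩ := Metric.mem_nhds_iff.mp hU
  have hlip := (happ.mono_set hball).lipschitzOnWith
  refine ⟨δ, hδ, fun ε hε hεδ hd s hs => ?_⟩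
  have hmem : ∀ u : Circle, ε • (u : ℂ) ∈ Metric.ball (0 : ℂ) δ := fun u => by
    rw [mem_ball_zero_iff, norm_smul, u.norm_coe, mul_one, Real.norm_of_nonneg hε.le]
    exact hεδ
  have hs' : |1 - s| ≤ 1 := by rw [abs_le]; constructor <;> linarith [hs.1, hs.2]
  -- The linear part ε L is not cancelled by a perturbation of at most half its lower bound. This
  -- gives injectivity, applied to differences, and immersivity, applied to derivatives.
  have hzero : ∀ (x : ℂ) (y : E4), ε • L x + (1 - s) • y = 0 →
      ‖y‖ ≤ (K : ℝ)⁻¹ / 2 * (ε * ‖x‖) → x = 0 := by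
    intro x y h1 h2
    have h3 : ε * ‖L x‖ ≤ ‖y‖ := by
      have h4 := congrArg norm (eq_neg_of_add_eq_zero_left h1)
      rw [norm_neg, norm_smul, norm_smul, Real.norm_of_nonneg hε.le, Real.norm_eq_abs] at h4
      rw [h4]
      exact mul_le_of_le_one_left (norm_nonneg _) hs'
    have h5 : K * (ε * ‖L x‖) ≤ ε * ‖x‖ / 2 :=
      calc K * (ε * ‖L x‖) ≤ K * ((K : ℝ)⁻¹ / 2 * (ε * ‖x‖)) := 
          mul_le_mul_of_nonneg_left (h3.trans h2) hK'.le
        _ = _ := by field_simp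
    have h6 : ε * ‖x‖ ≤ K * (ε * ‖L x‖) := by nlinarith [hlow x]
    have h7 : ‖x‖ = 0 := by nlinarith [norm_nonneg x]
    exact norm_eq_zero.mp h7
  refine ⟨fun u v huv => ?_, fun u hu => ?_⟩
  · have h1 := hzero (u - v) ((ψ (ε • (u : ℂ)) - L (ε • (u : ℂ))) -
      (ψ (ε • (v : ℂ)) - L (ε • (v : ℂ)))) (by
        rw [map_sub, smul_sub, smul_sub, ← sub_eq_zero.mpr huv]
        simp only [straighten, ← hL]
        abel) (by
        have h2 := hlip.norm_sub_le (hmem u) (hmem v)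
        rw [← smul_sub, norm_smul, Real.norm_of_nonneg hε.le] at h2
        simpa using h2)
    exact Circle.ext (sub_eq_zero.mp h1)
  · rw [(hasFDerivAt_straighten (hd u)).fderiv] at hu
    have h2 : ‖fderiv ℝ (fun w => ψ w - L w) (ε • (u : ℂ))‖ ≤ (K⁻¹ / 2 : NNReal) :=
      ((hd u).sub L.differentiableAt).hasFDerivAt.le_of_lipschitzOn
        (Metric.isOpen_ball.mem_nhds (hmem u)) hlip
    have h1 := hzero (u * Complex.I)
      (ε • fderiv ℝ (fun w => ψ w - L w) (ε • (u : ℂ)) (u * Complex.I)) (by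
        simpa using hu) (by
        rw [norm_smul, Real.norm_of_nonneg hε.le, mul_left_comm]
        refine mul_le_mul_of_nonneg_left ((ContinuousLinearMap.le_of_opNorm_le _ h2 _).trans ?_)
          hε.le
        simp)
    exact mul_ne_zero u.coe_ne_zero Complex.I_ne_zero h1

/-- A knot that bounds an embedded disc is trivial. -/
theorem Knot.isTrivial_of_hasSeifertSurface_zero {K : Knot} (h : K.HasSeifertSurface 0) :
    K.IsTrivial := by
  obtain ⟨D, φ, hφ, hs, hK⟩ := h
  have hD : ∀ z : ℂ, ‖z‖ ≤ 1 → z ∈ D.domain := fun z hz =>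
    ⟨hz, fun i => by rcases i with ⟨j, _⟩ | j <;> exact j.elim0⟩
  have hsm : ∀ z : ℂ, ‖z‖ ≤ 1 → ContDiffAt ℝ ∞ φ z := fun z hz => hφ.smooth z (hD z hz)
  have hnorm : ∀ z : ℂ, ‖z‖ ≤ 1 → ‖φ z‖ = 1 := fun z hz => by simpa using hs z (hD z hz)
  have horth : ∀ z : ℂ, ‖z‖ ≤ 1 → ∀ ζ, inner ℝ (φ z) (fderiv ℝ φ z ζ) = 0 := fun z hz =>
    D.inner_fderiv_eq_zero (hD z hz) ((hsm z hz).differentiableAt (by simp)) hs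
  have hinj : ∀ z w : ℂ, ‖z‖ ≤ 1 → ‖w‖ ≤ 1 → φ z = φ w → z = w := fun z w hz hw h => by
    rcases (hφ.eq_iff z (hD z hz) w (hD w hw)).mp h with h | ⟨j, -⟩
    · exact h
    · exact j.elim0
  have h0 : ‖(0 : ℂ)‖ ≤ 1 := by simp
  set p := φ 0 with hp
  have hp1 : ‖p‖ = 1 := hnorm 0 h0
  set q : ℂ → ℝ := fun z => inner ℝ p (φ z) with hq
  have hq0 : q 0 = 1 := by
    simp only [hq, ← hp]; rw [real_inner_self_eq_norm_sq, hp1, one_pow]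
  have hqsm : ∀ z : ℂ, ‖z‖ ≤ 1 → ContDiffAt ℝ ∞ q z := fun z hz =>
    contDiffAt_const.inner ℝ (hsm z hz)
  -- Central projection to the affine hyperplane through p orthogonal to p. Straight-line
  -- deformations within this hyperplane never meet the origin, and distinct points of it lie on
  -- distinct rays.
  set ψ : ℂ → E4 := fun z => (q z)⁻¹ • φ z - p with hψ
  have hψsm : ∀ z : ℂ, ‖z‖ ≤ 1 → q z ≠ 0 → ContDiffAt ℝ ∞ ψ z := fun z hz hqz =>
    (((hqsm z hz).inv hqz).smul (hsm z hz)).sub contDiffAt_const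
  have hψp : ∀ z, q z ≠ 0 → p + ψ z = (q z)⁻¹ • φ z := fun z _ => add_sub_cancel _ _
  have hψorth : ∀ z, q z ≠ 0 → inner ℝ p (ψ z) = 0 := fun z hz => by
    simp only [hψ]
    rw [inner_sub_right, inner_smul_right, real_inner_self_eq_norm_sq, hp1]
    show (q z)⁻¹ * q z - 1 ^ 2 = 0
    rw [inv_mul_cancel₀ hz]; norm_num
  have hqev : ∀ᶠ z in 𝓝 (0 : ℂ), 0 < q z :=
    (hqsm 0 h0).continuousAt.eventually (lt_mem_nhds (by rw [hq0]; exact one_pos))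
  have hψ0 : ContDiffAt ℝ ∞ ψ 0 := hψsm 0 h0 (by rw [hq0]; exact one_ne_zero)
  have hψz : ψ 0 = 0 := by simp only [hψ, hq0]; rw [inv_one, one_smul, sub_self]
  -- the gnomonic projection does not change the derivative at the base point
  have hL : ∀ ζ, fderiv ℝ ψ 0 ζ = fderiv ℝ φ 0 ζ := by
    intro ζ
    have h1 : φ =ᶠ[𝓝 0] fun z => q z • (p + ψ z) := by
      filter_upwards [hqev] with z hz
      rw [hψp z hz.ne', smul_smul, mul_inv_cancel₀ hz.ne', one_smul]
    have h2 : HasFDerivAt q ((innerSL ℝ p).comp (fderiv ℝ φ 0)) 0 :=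
      (innerSL ℝ p).hasFDerivAt.comp (0 : ℂ) ((hsm 0 h0).differentiableAt (by simp)).hasFDerivAt
    have h3 := h2.smul ((hψ0.differentiableAt (by simp)).hasFDerivAt.const_add p)
    have h4 : fderiv ℝ φ 0 = _ := h1.fderiv_eq.trans h3.fderiv
    have h5 : inner ℝ p (fderiv ℝ φ 0 ζ) = 0 := horth 0 h0 ζ
    conv_rhs => rw [h4]
    simp [hq0, hψz, h5]
  have hLinj : Function.Injective (fderiv ℝ ψ 0) := fun x y hxy =>
    hφ.immersion 0 (hD 0 h0) (by rw [← hL, ← hL]; exact hxy)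
  have hLorth : ∀ ζ, inner ℝ p (fderiv ℝ ψ 0 ζ) = 0 := fun ζ => by
    rw [hL]; exact horth 0 h0 ζ
  obtain ⟨δ, hδ, hemb⟩ := exists_straighten_embedded hψ0 hLinj
  obtain ⟨δ', hδ', hqball⟩ := Metric.eventually_nhds_iff_ball.mp hqev
  -- The circle of radius ε must lie in the disc, where straightening keeps the curve embedded, and
  -- in the hemisphere of p, where the projection is defined.
  obtain ⟨ε, hε, hεlt⟩ : ∃ ε : ℝ, 0 < ε ∧ ε < min 1 (min δ δ') :=
    exists_between (by positivity)
  have hε1 : ε < 1 := hεlt.trans_le (min_le_left _ _)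
  have hεδ : ε < δ := hεlt.trans_le ((min_le_right _ _).trans (min_le_left _ _))
  have hεδ' : ε < δ' := hεlt.trans_le ((min_le_right _ _).trans (min_le_right _ _))
  have hεn : ∀ u : Circle, ‖ε • (u : ℂ)‖ = ε := fun u => by
    rw [norm_smul, u.norm_coe, mul_one, Real.norm_of_nonneg hε.le]
  have hεq : ∀ u : Circle, 0 < q (ε • (u : ℂ)) := fun u =>
    hqball _ (by rw [mem_ball_zero_iff, hεn]; exact hεδ')
  have hψε : ∀ u : Circle, ContDiffAt ℝ ∞ ψ (ε • (u : ℂ)) := fun u =>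
    hψsm _ ((hεn u).trans_le hε1.le) (hεq u).ne'
  -- shrinking the disc
  have hshrink : ∀ r : ℝ, 0 < r → r ≤ 1 → IsLoop (fun z => φ (r • z)) := by
    intro r hr hr1
    have hrn : ∀ u : Circle, ‖r • (u : ℂ)‖ ≤ 1 := fun u => by
      rw [norm_smul, u.norm_coe, mul_one, Real.norm_of_nonneg hr.le]; exact hr1
    have hd : ∀ u : Circle, HasFDerivAt (fun z => φ (r • z))
        ((fderiv ℝ φ (r • (u : ℂ))).comp (r • ContinuousLinearMap.id ℝ ℂ)) (u : ℂ) := fun u =>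
      HasFDerivAt.comp (g := φ) (f := fun z : ℂ => r • z) (u : ℂ)
        ((hsm _ (hrn u)).differentiableAt (by simp)).hasFDerivAt
        ((hasFDerivAt_id (u : ℂ)).const_smul r)
    refine isLoop_of_norm_eq_one (fun u => ?_) (fun u => hnorm _ (hrn u)) (fun u v huv => ?_)
      (fun u => ?_) (fun u => ?_)
    · exact ContDiffAt.comp (g := φ) (f := fun z : ℂ => r • z) (u : ℂ) (hsm _ (hrn u))
        (by fun_prop)
    · exact Circle.ext (smul_right_injective ℂ hr.ne' (hinj _ _ (hrn u) (hrn v) huv))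
    · rw [(hd u).fderiv]
      exact horth _ (hrn u) _
    · rw [(hd u).fderiv]
      intro h
      have h1 := hφ.immersion _ (hD _ (hrn u)) (h.trans (map_zero _).symm)
      exact smul_ne_zero hr.ne' (mul_ne_zero u.coe_ne_zero Complex.I_ne_zero) h1
  have hstage₁ : Isotopic K (hshrink ε hε hε1.le).knot := by
    refine isotopic_of_loops (Ψ := fun t z => φ ((1 - t * (1 - ε)) • z)) (fun t ht u => ?_)
      (fun t ht => hshrink _ ?_ ?_) (fun u => ?_) (fun u => ?_)
    · refine ContDiffAt.comp (g := φ) (f := fun p : ℝ × ℂ => (1 - p.1 * (1 - ε)) • p.2) _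
        (hsm _ ?_) (by fun_prop)
      rw [norm_smul, u.norm_coe, mul_one, Real.norm_eq_abs, abs_le]
      constructor <;> nlinarith [ht.1, ht.2]
    · nlinarith [ht.1, ht.2]
    · nlinarith [ht.1, ht.2]
    · apply Subtype.ext
      simp only [zero_mul, sub_zero, one_smul]
      rw [coe_toSphere_of_norm (hnorm _ u.norm_coe.le), hK]
    · show toSphere (φ (ε • (u : ℂ))) = _
      simp
  set M : ℂ →L[ℝ] E4 := ε • fderiv ℝ ψ 0 with hM
  have hMinj : Function.Injective M := fun x y hxy =>
    hLinj (smul_right_injective E4 hε.ne' hxy)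
  have hMorth : ∀ (a : ℝ) ζ, inner ℝ (a • p) (M ζ) = 0 := fun a ζ => by
    show inner ℝ (a • p) (ε • fderiv ℝ ψ 0 ζ) = 0
    rw [inner_smul_left, inner_smul_right, hLorth]; simp
  have hMp : ∀ ζ, inner ℝ p (M ζ) = 0 := fun ζ => by simpa using hMorth 1 ζ
  have hstage₂ : Isotopic (hshrink ε hε hε1.le).knot (isLoop_affine hMinj hMp).knot := by
    refine isotopic_of_loops (Ψ := fun t z => p + straighten ψ ε t z) (fun t ht u => ?_)
      (fun t ht => ?_) (fun u => ?_) (fun u => ?_)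
    · exact contDiffAt_const.add (contDiffAt_straighten (x := (t, (u : ℂ))) (hψε u))
    · obtain ⟨h1, h2⟩ := hemb ε hε hεδ (fun u => (hψε u).differentiableAt (by simp)) t ht
      refine isLoop_const_add hp1 (fun u => ?_) (fun u => ?_) h1 h2
      · exact ContDiffAt.comp (g := fun x : ℝ × ℂ => straighten ψ ε x.1 x.2)
          (f := fun z : ℂ => (t, z)) (u : ℂ) (contDiffAt_straighten (hψε u)) (by fun_prop)
      · have h3 : ∀ᶠ z in 𝓝 (u : ℂ), 0 < q (ε • z) := by
          have h4 : ContinuousAt (fun z : ℂ => q (ε • z)) u :=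
            ContinuousAt.comp (g := q) (f := fun z : ℂ => ε • z)
              (hqsm _ ((hεn u).trans_le hε1.le)).continuousAt (by fun_prop)
          exact h4.eventually (lt_mem_nhds (hεq u))
        filter_upwards [h3] with z hz
        rw [straighten, inner_add_right, inner_smul_right, inner_smul_right, inner_sub_right,
          hLorth, hLorth, hψorth _ hz.ne']
        simp
    · show toSphere (φ (ε • (u : ℂ))) = toSphere (p + straighten ψ ε 0 u)
      have h1 : straighten ψ ε 0 u = ψ (ε • (u : ℂ)) := by
        rw [straighten, map_smul, sub_zero, one_smul]
        exact add_sub_cancel _ _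
      rw [h1, hψp _ (hεq u).ne', toSphere_smul (inv_pos.mpr (hεq u))]
    · show toSphere (p + ε • fderiv ℝ ψ 0 u) = toSphere (p + straighten ψ ε 1 u)
      rw [straighten]
      simp
  -- The plane of the ellipse is translated to the origin along p, to which it is orthogonal.
  have hstage₃ : Isotopic (isLoop_affine hMinj hMp).knot (isLoop_linear hMinj).knot := by
    refine isotopic_of_loops (Ψ := fun t z => (1 - t) • p + M z) (fun t ht u => ?_)
      (fun t ht => isLoop_affine hMinj (hMorth _)) (fun u => ?_) (fun u => ?_)
    · have h1 : ContDiff ℝ ∞ fun x : ℝ × ℂ => (1 - x.1) • p + M x.2 := by fun_prop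
      exact h1.contDiffAt
    · show toSphere (p + M u) = _
      simp
    · show toSphere (M u) = _
      simp
  exact isTrivial_of_isotopic hMinj (hstage₁.trans (hstage₂.trans hstage₃))

end KnotCobordism

end

/-! ### The genus inequality. -/

theorem theorem1p1 (K : KnotCobordism.Knot) (hK : ¬ K.IsTrivial) :
    KnotCobordism.smoothDist K K.reverse + 1 ≤ 2 * K.threeGenus ∧
    KnotCobordism.topDist K K.reverse + 1 ≤ 2 * K.threeGenus := by
  by_cases hne : ∃ g, K.HasSeifertSurface g
  · classical
    have hmin := Nat.find_spec hne
    have hgenus : K.threeGenus = (Nat.find hne : ℕ) := by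
      apply le_antisymm
      · exact iInf₂_le _ hmin
      · exact le_iInf₂ fun g hg => by exact_mod_cast Nat.find_min' hne hg
    rw [hgenus]
    -- Minimal genus zero is excluded by nontriviality; minimal genus k + 1 gives a cobordism of
    -- genus 2k + 1 = 2(k + 1) - 1.
    rcases hk : Nat.find hne with _ | k
    · rw [hk] at hmin
      exact absurd (KnotCobordism.Knot.isTrivial_of_hasSeifertSurface_zero hmin) hK
    · rw [hk] at hmin
      obtain ⟨h1, h2⟩ := KnotCobordism.hasCobordism_of_hasSeifertSurface hmin
      have e : ((2 * k + 1 : ℕ) : ℕ∞) + 1 = 2 * ((k + 1 : ℕ) : ℕ∞) := by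
        push_cast; ring
      refine ⟨?_, ?_⟩
      · rw [← e]
        exact add_le_add_left (iInf₂_le _ h1) 1
      · rw [← e]
        exact add_le_add_left (iInf₂_le _ h2) 1
  -- Existence of Seifert surfaces is not needed: an empty infimum is ⊤, and both bounds hold
  -- trivially.
  · have hgenus : K.threeGenus = ⊤ := by
      simp only [KnotCobordism.Knot.threeGenus, iInf_eq_top]
      exact fun g hg => absurd ⟨g, hg⟩ hne
    rw [hgenus]
    simp
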